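/- Let $\Bbbk$ be a field and let $R$, $S$ be standard graded $\Bbbk$-algebras, i.e. graded quotients of polynomial rings $\Bbbk[x_1,\dots,x_n]$ with $\deg x_i=1$ by homogeneous ideals. Let $I\subsetneq R$ and $J\subsetneq S$ be proper homogeneous ideals, $M$ a $\mathbb{Z}$-graded $R$-module and $N$ a $\mathbb{Z}$-graded $S$-module. The Segre products are $R\#S=\bigoplus_{n\ge 0}R_n\otimes_\Bbbk S_n$ (a graded $\Bbbk$-algebra), $I\#J=\bigoplus_{n\ge 0}I_n\otimes_\Bbbk J_n$ (an ideal of $R\#S$) and $M\#N=\bigoplus_{n\in\mathbb{Z}}M_n\otimes_\Bbbk N_n$ (a $\mathbb{Z}$-graded $R\#S$-module). For a graded ring $A$ and a homogeneous ideal $\mathfrak{a}$ of $A$, $H^j_{\mathfrak{a}}$ denotes the $j$-th right derived functor, on the category of $\mathbb{Z}$-graded $A$-modules and degree-preserving homomorphisms, of the functor $\Gamma_{\mathfrak{a}}(M)=\{z\in M : \mathfrak{a}^tz=0 \text{ for some } t\}$. The $I$-saturation of $M$ is the graded $R$-module $$M^{sat}_I=\bigoplus_{\ell\in\mathbb{Z}}H^0\big(U,\widetilde{M}(\ell)\big),\qquad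 U=\operatorname{Proj}(R)\setminus\operatorname{Proj}(R/I),$$ where $\widetilde{M}$ is the sheaf on $\operatorname{Proj}(R)$ induced by $M$ and $\widetilde M(\ell)=\widetilde{M(\ell)}$ is its $\ell$-th twist; $N^{sat}_J$ is defined in the same way. There are canonical homomorphisms $M\to M^{sat}_I$ and $N\to N^{sat}_J$ sending a homogeneous element $z$ to the section $z/1$. Then there is an exact sequence of $\mathbb{Z}$-graded $R\#S$-modules $$0\to H^0_{I\#J}(M\#N)\to M\#N\to M^{sat}_I\#N^{sat}_J\to H^1_{I\#J}(M\#N)\to 0,$$ whose middle map is the Segre product of the canonical homomorphisms $M\to M^{sat}_I$ and $N\to N^{sat}_J$, and for every $k\ge 2$ there is an isomorphism of $\mathbb{Z}$-graded $R\#S$-modules $$H^k_{I\#J}(M\#N)\cong\Big(M^{sat}_I\#H^k_J(N)\Big)\oplus\Big(H^k_I(M)\#N^{sat}_J\Big)\oplus\Big(\bigoplus_{\substack{i+j=k+1\\ i,j\ge 2}}H^i_I(M)\#H^j_J(N)\Big).$$ -/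

import Mathlib

open CategoryTheory CategoryTheory.Limits TensorProduct DirectSum

universe u

noncomputable section

/-- `𝒜` makes `R` a standard graded `k`-algebra: `R` is, as a graded algebra, a quotient
`k[x₁, …, xₙ] / 𝔟` of a polynomial ring in finitely many variables of degree one by a homogeneous
ideal (necessarily the kernel of the graded surjection `φ`). -/
def IsStandardGraded {k R : Type u} [Field k] [CommRing R] [Algebra k R]
    (𝒜 : ℕ → Submodule k R) [GradedAlgebra 𝒜] : Prop :=
  ∃ (n : ℕ) (φ : MvPolynomial (Fin n) k →ₐ[k] R),
    Function.Surjective φ ∧ ∀ i, φ (MvPolynomial.X i) ∈ 𝒜 1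

/-! ### The category of `ℤ`-graded modules -/

/-- A `ℤ`-graded module over the graded `k`-algebra `(R, 𝒜)`, given by its homogeneous components
`X n` and by the multiplication maps `𝒜 i × X m → X (i + m)`. The underlying `R`-module is
`GrMod.Total`. -/
structure GrMod {k R : Type u} [Field k] [CommRing R] [Algebra k R]
    (𝒜 : ℕ → Submodule k R) [GradedAlgebra 𝒜] where
  /-- the component of degree `n` -/
  X : ℤ → Type u
  [addCommGroup : ∀ n, AddCommGroup (X n)]
  [module : ∀ n, Module k (X n)]
  /-- multiplication by homogeneous elements of the ring -/
  act : ∀ {i : ℕ} {m n : ℤ}, (i : ℤ) + m = n → (𝒜 i →ₗ[k] X m →ₗ[k] X n)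
  one_act : ∀ {n : ℤ} (h : ((0 : ℕ) : ℤ) + n = n) (x : X n),
    act h ⟨1, SetLike.one_mem_graded 𝒜⟩ x = x
  mul_act : ∀ {i j : ℕ} {l m n : ℤ} (h₁ : (j : ℤ) + l = m) (h₂ : (i : ℤ) + m = n)
    (h₃ : ((i + j : ℕ) : ℤ) + l = n) (r : 𝒜 i) (s : 𝒜 j) (x : X l),
    act h₃ ⟨(r : R) * s, SetLike.mul_mem_graded r.2 s.2⟩ x = act h₂ r (act h₁ s x)

namespace GrMod

attribute [instance] GrMod.addCommGroup GrMod.module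

section Category

variable {k R : Type u} [Field k] [CommRing R] [Algebra k R]
variable {𝒜 : ℕ → Submodule k R} [GradedAlgebra 𝒜]

/-- Graded (degree-preserving) module homomorphisms. -/
@[ext]
structure Hom (M N : GrMod 𝒜) where
  /-- the component of degree `n` -/
  app : ∀ n, M.X n →ₗ[k] N.X n
  comm : ∀ {i : ℕ} {m n : ℤ} (h : (i : ℤ) + m = n) (r : 𝒜 i) (x : M.X m),
    app n (M.act h r x) = N.act h r (app m x)

instance : Category (GrMod 𝒜) where
  Hom := Hom
  id M := ⟨fun _ => LinearMap.id, fun _ _ _ => rfl⟩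
  comp f g := ⟨fun n => g.app n ∘ₗ f.app n, fun h r x => by simp [f.comm, g.comm]⟩

@[ext]
lemma hom_ext {M N : GrMod 𝒜} {f g : M ⟶ N} (h : ∀ n x, f.app n x = g.app n x) : f = g :=
  Hom.ext (funext fun n => LinearMap.ext (h n))

@[simp]
lemma id_app (M : GrMod 𝒜) (n : ℤ) (x : M.X n) : Hom.app (𝟙 M) n x = x := rfl

@[simp]
lemma comp_app {M N P : GrMod 𝒜} (f : M ⟶ N) (g : N ⟶ P) (n : ℤ) (x : M.X n) :
    Hom.app (f ≫ g) n x = g.app n (f.app n x) := rfl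

instance (M N : GrMod 𝒜) : Zero (M ⟶ N) := ⟨⟨fun _ => 0, fun _ _ _ => by simp⟩⟩

instance (M N : GrMod 𝒜) : Add (M ⟶ N) :=
  ⟨fun f g => ⟨fun n => f.app n + g.app n, fun h r x => by simp [f.comm, g.comm]⟩⟩

instance (M N : GrMod 𝒜) : Neg (M ⟶ N) :=
  ⟨fun f => ⟨fun n => - f.app n, fun h r x => by simp [f.comm]⟩⟩

@[simp]
lemma zero_app {M N : GrMod 𝒜} (n : ℤ) (x : M.X n) : Hom.app (0 : M ⟶ N) n x = 0 := rfl

@[simp]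
lemma add_app {M N : GrMod 𝒜} (f g : M ⟶ N) (n : ℤ) (x : M.X n) :
    Hom.app (f + g) n x = f.app n x + g.app n x := rfl

@[simp]
lemma neg_app {M N : GrMod 𝒜} (f : M ⟶ N) (n : ℤ) (x : M.X n) :
    Hom.app (-f) n x = - f.app n x := rfl

instance (M N : GrMod 𝒜) : AddCommGroup (M ⟶ N) where
  add_assoc f g h := by ext; simp [add_assoc]
  zero_add f := by ext; simp
  add_zero f := by ext; simp
  add_comm f g := by ext; simp [add_comm]
  neg_add_cancel f := by ext; simp
  nsmul := nsmulRec
  zsmul := zsmulRec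

instance : Preadditive (GrMod 𝒜) where
  add_comp _ _ _ f f' g := by ext; simp
  comp_add _ _ _ f g g' := by ext; simp

/-! #### The category is abelian -/

/-- The zero graded module. -/
def zeroObj (𝒜 : ℕ → Submodule k R) [GradedAlgebra 𝒜] : GrMod 𝒜 where
  X _ := PUnit
  act _ := 0
  one_act _ _ := rfl
  mul_act _ _ _ _ _ _ := rfl

instance : HasZeroObject (GrMod 𝒜) :=
  ⟨zeroObj 𝒜, by
    rw [IsZero.iff_id_eq_zero]
    ext n x
    rfl⟩

/-- The direct sum of two graded modules. -/
def prodObj (M N : GrMod 𝒜) : GrMod 𝒜 where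
  X n := M.X n × N.X n
  act h := LinearMap.mk₂ k (fun r x => (M.act h r x.1, N.act h r x.2))
    (by intros; simp) (by intros; simp) (by intros; simp) (by intros; simp)
  one_act h x := by simp [M.one_act, N.one_act]
  mul_act h₁ h₂ h₃ r s x := by simp [M.mul_act h₁ h₂ h₃, N.mul_act h₁ h₂ h₃]

instance : HasBinaryBiproducts (GrMod 𝒜) where
  has_binary_biproduct M N := hasBinaryBiproduct_of_total
    { pt := prodObj M N
      fst := ⟨fun n => LinearMap.fst k _ _, fun _ _ _ => rfl⟩
      snd := ⟨fun n => LinearMap.snd k _ _, fun _ _ _ => rfl⟩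
      inl := ⟨fun n => LinearMap.inl k _ _, fun h r x => by
        refine Prod.ext rfl ?_
        change 0 = N.act h r 0
        simp⟩
      inr := ⟨fun n => LinearMap.inr k _ _, fun h r x => by
        refine Prod.ext ?_ rfl
        change 0 = M.act h r 0
        simp⟩
      inl_fst := by ext; rfl
      inl_snd := by ext; rfl
      inr_fst := by ext; rfl
      inr_snd := by ext; rfl } (by
    ext n x
    exact Prod.ext (add_zero x.1) (zero_add x.2))

/-- A graded submodule, given by a compatible family of subspaces. -/
def subObj (M : GrMod 𝒜) (V : ∀ n, Submodule k (M.X n))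
    (hV : ∀ {i : ℕ} {m n : ℤ} (h : (i : ℤ) + m = n) (r : 𝒜 i) (x : M.X m),
      x ∈ V m → M.act h r x ∈ V n) : GrMod 𝒜 where
  X n := V n
  act h := LinearMap.mk₂ k (fun r x => ⟨M.act h r x, hV h r x x.2⟩)
    (by intros; ext; simp) (by intros; ext; simp) (by intros; ext; simp) (by intros; ext; simp)
  one_act h x := by ext; simp [M.one_act]
  mul_act h₁ h₂ h₃ r s x := by ext; simp [M.mul_act h₁ h₂ h₃]

/-- The inclusion of a graded submodule. -/
def subι (M : GrMod 𝒜) (V : ∀ n, Submodule k (M.X n))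
    (hV : ∀ {i : ℕ} {m n : ℤ} (h : (i : ℤ) + m = n) (r : 𝒜 i) (x : M.X m),
      x ∈ V m → M.act h r x ∈ V n) : subObj M V hV ⟶ M :=
  ⟨fun n => (V n).subtype, fun _ _ _ => rfl⟩

/-- The quotient by a graded submodule. -/
def quotObj (M : GrMod 𝒜) (V : ∀ n, Submodule k (M.X n))
    (hV : ∀ {i : ℕ} {m n : ℤ} (h : (i : ℤ) + m = n) (r : 𝒜 i) (x : M.X m),
      x ∈ V m → M.act h r x ∈ V n) : GrMod 𝒜 where
  X n := M.X n ⧸ V n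
  act {i m n} h :=
    { toFun := fun r => (V m).mapQ (V n) (M.act h r) (fun x hx => hV h r x hx)
      map_add' := fun r s => by ext; simp
      map_smul' := fun c r => by ext; simp }
  one_act h x := by
    obtain ⟨x, rfl⟩ := Submodule.mkQ_surjective _ x
    simp [M.one_act]
  mul_act h₁ h₂ h₃ r s x := by
    obtain ⟨x, rfl⟩ := Submodule.mkQ_surjective _ x
    simp [M.mul_act h₁ h₂ h₃]

/-- The projection to the quotient by a graded submodule. -/
def quotπ (M : GrMod 𝒜) (V : ∀ n, Submodule k (M.X n))
    (hV : ∀ {i : ℕ} {m n : ℤ} (h : (i : ℤ) + m = n) (r : 𝒜 i) (x : M.X m),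
      x ∈ V m → M.act h r x ∈ V n) : M ⟶ quotObj M V hV :=
  ⟨fun n => (V n).mkQ, fun _ _ _ => rfl⟩

lemma ker_act {M N : GrMod 𝒜} (f : M ⟶ N) {i : ℕ} {m n : ℤ} (h : (i : ℤ) + m = n) (r : 𝒜 i)
    (x : M.X m) (hx : x ∈ LinearMap.ker (f.app m)) : M.act h r x ∈ LinearMap.ker (f.app n) := by
  rw [LinearMap.mem_ker] at hx ⊢
  rw [f.comm, hx, map_zero]

lemma range_act {M N : GrMod 𝒜} (f : M ⟶ N) {i : ℕ} {m n : ℤ} (h : (i : ℤ) + m = n) (r : 𝒜 i)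
    (y : N.X m) (hy : y ∈ LinearMap.range (f.app m)) :
    N.act h r y ∈ LinearMap.range (f.app n) := by
  obtain ⟨x, rfl⟩ := hy
  exact ⟨M.act h r x, f.comm h r x⟩

/-- Lifting through a degreewise injective homomorphism. -/
def liftOfInjective {K M N : GrMod 𝒜} (i : K ⟶ M) (hi : ∀ n, Function.Injective (i.app n))
    (f : N ⟶ M) (hf : ∀ n x, f.app n x ∈ LinearMap.range (i.app n)) : N ⟶ K where
  app n := (LinearEquiv.ofInjective (i.app n) (hi n)).symm.toLinearMap ∘ₗ
    (f.app n).codRestrict _ (hf n)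
  comm {j m n} h r x := by
    apply hi
    have key : ∀ n (z : N.X n), i.app n ((LinearEquiv.ofInjective (i.app n) (hi n)).symm
        ((f.app n).codRestrict _ (hf n) z)) = f.app n z := fun n z => by
      exact congrArg Subtype.val (LinearEquiv.apply_symm_apply
        (LinearEquiv.ofInjective (i.app n) (hi n)) ((f.app n).codRestrict _ (hf n) z))
    simp only [LinearMap.comp_apply, LinearEquiv.coe_coe]
    rw [key, i.comm, key, f.comm]

lemma liftOfInjective_comp {K M N : GrMod 𝒜} (i : K ⟶ M) (hi : ∀ n, Function.Injective (i.app n))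
    (f : N ⟶ M) (hf : ∀ n x, f.app n x ∈ LinearMap.range (i.app n)) :
    liftOfInjective i hi f hf ≫ i = f := by
  ext n x
  exact congrArg Subtype.val (LinearEquiv.apply_symm_apply
    (LinearEquiv.ofInjective (i.app n) (hi n)) ((f.app n).codRestrict _ (hf n) x))

/-- Descending along a degreewise surjective homomorphism. -/
def descOfSurjective {M N P : GrMod 𝒜} (p : M ⟶ N) (hp : ∀ n, Function.Surjective (p.app n))
    (f : M ⟶ P) (hf : ∀ n, LinearMap.ker (p.app n) ≤ LinearMap.ker (f.app n)) : N ⟶ P where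
  app n := (LinearMap.ker (p.app n)).liftQ (f.app n) (hf n) ∘ₗ
    ((p.app n).quotKerEquivOfSurjective (hp n)).symm.toLinearMap
  comm {j m n} h r y := by
    have key : ∀ n (z : M.X n), (LinearMap.ker (p.app n)).liftQ (f.app n) (hf n)
        (((p.app n).quotKerEquivOfSurjective (hp n)).symm (p.app n z)) = f.app n z := fun n z => by
      rw [show p.app n z = (p.app n).quotKerEquivOfSurjective (hp n) (Submodule.Quotient.mk z)
        from rfl, LinearEquiv.symm_apply_apply]
      rfl
    obtain ⟨x, rfl⟩ := hp m y
    simp only [LinearMap.comp_apply, LinearEquiv.coe_coe]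
    rw [← p.comm, key, key, f.comm]

lemma comp_descOfSurjective {M N P : GrMod 𝒜} (p : M ⟶ N)
    (hp : ∀ n, Function.Surjective (p.app n)) (f : M ⟶ P)
    (hf : ∀ n, LinearMap.ker (p.app n) ≤ LinearMap.ker (f.app n)) :
    p ≫ descOfSurjective p hp f hf = f := by
  ext n z
  change (LinearMap.ker (p.app n)).liftQ (f.app n) (hf n)
        (((p.app n).quotKerEquivOfSurjective (hp n)).symm (p.app n z)) = f.app n z
  rw [show p.app n z = (p.app n).quotKerEquivOfSurjective (hp n) (Submodule.Quotient.mk z)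
    from rfl, LinearEquiv.symm_apply_apply]
  rfl

lemma mono_of_injective {M N : GrMod 𝒜} (f : M ⟶ N) (hf : ∀ n, Function.Injective (f.app n)) :
    Mono f := ⟨fun g h w => by
  ext n x
  exact hf n (by simpa using congrArg (fun q => Hom.app q n x) w)⟩

lemma epi_of_surjective {M N : GrMod 𝒜} (f : M ⟶ N) (hf : ∀ n, Function.Surjective (f.app n)) :
    Epi f := ⟨fun g h w => by
  ext n y
  obtain ⟨x, rfl⟩ := hf n y
  simpa using congrArg (fun q => Hom.app q n x) w⟩

lemma subι_ker_comp {M N : GrMod 𝒜} (f : M ⟶ N) :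
    subι M (fun n => LinearMap.ker (f.app n)) (ker_act f) ≫ f = 0 := by
  ext n y
  exact LinearMap.mem_ker.1 y.2

lemma injective_of_mono {M N : GrMod 𝒜} (f : M ⟶ N) [Mono f] (n : ℤ) :
    Function.Injective (f.app n) := by
  rw [← LinearMap.ker_eq_bot, Submodule.eq_bot_iff]
  intro x hx
  have h : subι M (fun n => LinearMap.ker (f.app n)) (ker_act f) = 0 := by
    rw [← cancel_mono f, subι_ker_comp, zero_comp]
  exact congrArg (fun q : subObj M _ (ker_act f) ⟶ M => Hom.app q n ⟨x, hx⟩) h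

lemma surjective_of_epi {M N : GrMod 𝒜} (f : M ⟶ N) [Epi f] (n : ℤ) :
    Function.Surjective (f.app n) := by
  rw [← LinearMap.range_eq_top, eq_top_iff]
  intro y _
  have h : quotπ N (fun n => LinearMap.range (f.app n)) (range_act f) = 0 := by
    rw [← cancel_epi f]
    ext n x
    simp only [comp_app, zero_app]
    exact (Submodule.Quotient.mk_eq_zero _).2 ⟨x, rfl⟩
  have h' : Submodule.Quotient.mk y = 0 := congrArg (fun q => Hom.app q n y) h
  exact (Submodule.Quotient.mk_eq_zero _).1 h'

/-- A degreewise injective homomorphism onto the kernel of `f` is a kernel of `f`. -/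
def isKernel {K M N : GrMod 𝒜} (i : K ⟶ M) (f : M ⟶ N) (w : i ≫ f = 0)
    (hi : ∀ n, Function.Injective (i.app n))
    (hK : ∀ n x, f.app n x = 0 → x ∈ LinearMap.range (i.app n)) :
    IsLimit (KernelFork.ofι i w) :=
  haveI := mono_of_injective i hi
  KernelFork.IsLimit.ofι i w
    (fun g hg => liftOfInjective i hi g fun n x => hK n _
      (by simpa using congrArg (fun q => Hom.app q n x) hg))
    (fun g hg => liftOfInjective_comp i hi g _)
    (fun g hg m hm => by rw [← cancel_mono i, hm, liftOfInjective_comp])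

/-- A degreewise surjective homomorphism with kernel the image of `f` is a cokernel of `f`. -/
def isCokernel {M N Q : GrMod 𝒜} (f : M ⟶ N) (p : N ⟶ Q) (w : f ≫ p = 0)
    (hp : ∀ n, Function.Surjective (p.app n))
    (hQ : ∀ n y, p.app n y = 0 → y ∈ LinearMap.range (f.app n)) :
    IsColimit (CokernelCofork.ofπ p w) :=
  haveI := epi_of_surjective p hp
  CokernelCofork.IsColimit.ofπ p w
    (fun g hg => descOfSurjective p hp g fun n y hy => by
      obtain ⟨x, rfl⟩ := hQ n y hy
      simpa using congrArg (fun q => Hom.app q n x) hg)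
    (fun g hg => comp_descOfSurjective p hp g _)
    (fun g hg m hm => by rw [← cancel_epi p, hm, comp_descOfSurjective])

lemma comp_quotπ_range {M N : GrMod 𝒜} (f : M ⟶ N) :
    f ≫ quotπ N (fun n => LinearMap.range (f.app n)) (range_act f) = 0 := by
  ext n x
  exact (Submodule.Quotient.mk_eq_zero _).2 ⟨x, rfl⟩

instance : HasKernels (GrMod 𝒜) where
  has_limit f := ⟨⟨⟨_, isKernel _ f (subι_ker_comp f) (fun _ => Subtype.val_injective)
    (fun _ x hx => ⟨⟨x, hx⟩, rfl⟩)⟩⟩⟩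

instance : HasCokernels (GrMod 𝒜) where
  has_colimit f := ⟨⟨⟨_, isCokernel f _ (comp_quotπ_range f)
    (fun _ => Submodule.mkQ_surjective _)
    (fun _ _ hy => (Submodule.Quotient.mk_eq_zero _).1 hy)⟩⟩⟩

instance : HasFiniteProducts (GrMod 𝒜) :=
  hasFiniteProducts_of_has_binary_and_terminal

instance : IsNormalMonoCategory (GrMod 𝒜) where
  normalMonoOfMono f _ := ⟨
    { Z := _
      g := quotπ _ (fun n => LinearMap.range (f.app n)) (range_act f)
      w := comp_quotπ_range f
      isLimit := isKernel f _ _ (injective_of_mono f)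
        (fun _ _ hx => (Submodule.Quotient.mk_eq_zero _).1 hx) }⟩

instance : IsNormalEpiCategory (GrMod 𝒜) where
  normalEpiOfEpi f _ := ⟨
    { W := _
      g := subι _ (fun n => LinearMap.ker (f.app n)) (ker_act f)
      w := subι_ker_comp f
      isColimit := isCokernel _ f _ (surjective_of_epi f)
        (fun _ y hy => ⟨⟨y, hy⟩, rfl⟩) }⟩

instance : Abelian (GrMod 𝒜) where

instance : HasFiniteBiproducts (GrMod 𝒜) := HasFiniteBiproducts.of_hasFiniteProducts

/-! #### The underlying module, and enough injectives -/

/-- The underlying `R`-module `⨁ n, M.X n` of a graded module. -/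
def Total (M : GrMod 𝒜) : Type u := ⨁ n, M.X n

instance (M : GrMod 𝒜) : AddCommGroup M.Total := inferInstanceAs (AddCommGroup (⨁ n, M.X n))

instance (M : GrMod 𝒜) : Module k M.Total := inferInstanceAs (Module k (⨁ n, M.X n))

/-- The inclusion of a homogeneous component. -/
def of (M : GrMod 𝒜) (n : ℤ) : M.X n →ₗ[k] M.Total := DirectSum.lof k ℤ M.X n

lemma total_ext (M : GrMod 𝒜) {P : Type*} [AddCommGroup P] [Module k P]
    {f g : M.Total →ₗ[k] P} (h : ∀ n x, f (M.of n x) = g (M.of n x)) : f = g :=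
  DirectSum.linearMap_ext k fun n => LinearMap.ext fun x => h n x

lemma total_induction (M : GrMod 𝒜) {p : M.Total → Prop} (zero : p 0)
    (of : ∀ n x, p (M.of n x)) (add : ∀ x y, p x → p y → p (x + y)) (x : M.Total) : p x :=
  DirectSum.induction_on x zero of add

/-- The linear map out of the underlying module with given values on the components. -/
def totalLift (M : GrMod 𝒜) {P : Type*} [AddCommGroup P] [Module k P]
    (f : ∀ n, M.X n →ₗ[k] P) : M.Total →ₗ[k] P :=
  DirectSum.toModule k ℤ P f

@[simp]
lemma totalLift_of (M : GrMod 𝒜) {P : Type*} [AddCommGroup P] [Module k P]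
    (f : ∀ n, M.X n →ₗ[k] P) (n : ℤ) (x : M.X n) : M.totalLift f (M.of n x) = f n x :=
  DirectSum.toModule_lof k n x

/-- Multiplication by homogeneous elements of degree `i` on the whole module. -/
def homogAct (M : GrMod 𝒜) (i : ℕ) : 𝒜 i →ₗ[k] Module.End k M.Total where
  toFun r := M.totalLift fun n => M.of (i + n) ∘ₗ M.act rfl r
  map_add' r s := M.total_ext fun n x => by simp
  map_smul' c r := M.total_ext fun n x => by simp

/-- Multiplication by arbitrary elements of the ring: decompose into homogeneous components. -/
def totalAct (M : GrMod 𝒜) : R →ₗ[k] Module.End k M.Total :=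
  DirectSum.toModule k ℕ _ M.homogAct ∘ₗ (decomposeLinearEquiv 𝒜).toLinearMap

lemma totalAct_of (M : GrMod 𝒜) {i : ℕ} {m n : ℤ} (h : (i : ℤ) + m = n) (r : 𝒜 i) (x : M.X m) :
    M.totalAct (r : R) (M.of m x) = M.of n (M.act h r x) := by
  subst h
  have e : M.totalAct (r : R) = M.homogAct i r := by
    have h := DirectSum.toModule_lof k (φ := M.homogAct) i r
    rw [← decomposeLinearEquiv_apply_coe] at h
    exact h
  rw [e]
  exact M.totalLift_of _ m x

lemma totalAct_one (M : GrMod 𝒜) : M.totalAct 1 = LinearMap.id :=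
  M.total_ext fun n x => by
    rw [show (1 : R) = ((⟨1, SetLike.one_mem_graded 𝒜⟩ : 𝒜 0) : R) from rfl,
      M.totalAct_of (n := n) (by simp), M.one_act]
    rfl

lemma totalAct_mul (M : GrMod 𝒜) (r s : R) (x : M.Total) :
    M.totalAct (r * s) x = M.totalAct r (M.totalAct s x) := by
  induction r using DirectSum.Decomposition.inductionOn 𝒜 with
  | zero => simp
  | add a b ha hb => simp [add_mul, ha, hb]
  | @homogeneous i r =>
    induction s using DirectSum.Decomposition.inductionOn 𝒜 with
    | zero => simp
    | add a b ha hb => simp [mul_add, ha, hb]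
    | @homogeneous j s =>
      induction x using M.total_induction with
      | zero => simp
      | add x y hx hy => simp [hx, hy]
      | of n x =>
      rw [M.totalAct_of rfl s, M.totalAct_of rfl r,
        show (r : R) * s = ((⟨(r : R) * s, SetLike.mul_mem_graded r.2 s.2⟩ : 𝒜 (i + j)) : R)
          from rfl, M.totalAct_of (n := (i : ℤ) + (j + n)) (by push_cast; ring),
        M.mul_act rfl rfl]

instance (M : GrMod 𝒜) : Module R M.Total where
  smul r x := M.totalAct r x
  one_smul x := congrArg (fun f => f x) M.totalAct_one
  mul_smul r s x := M.totalAct_mul r s x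
  smul_zero r := map_zero (M.totalAct r)
  smul_add r := map_add (M.totalAct r)
  add_smul r s x := by
    change M.totalAct (r + s) x = M.totalAct r x + M.totalAct s x
    simp
  zero_smul x := by
    change M.totalAct 0 x = 0
    simp

lemma smul_of (M : GrMod 𝒜) {i : ℕ} {m n : ℤ} (h : (i : ℤ) + m = n) (r : 𝒜 i) (x : M.X m) :
    (r : R) • M.of m x = M.of n (M.act h r x) :=
  M.totalAct_of h r x

instance (M : GrMod 𝒜) : IsScalarTower k R M.Total where
  smul_assoc c r x := by
    change M.totalAct (c • r) x = c • M.totalAct r x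
    simp

lemma of_injective (M : GrMod 𝒜) (n : ℤ) : Function.Injective (M.of n) :=
  DirectSum.of_injective n

/-- A graded homomorphism as a linear map between the underlying modules. -/
def totalMap {M N : GrMod 𝒜} (f : M ⟶ N) : M.Total →ₗ[R] N.Total :=
  let g : M.Total →ₗ[k] N.Total := M.totalLift fun n => N.of n ∘ₗ f.app n
  have hg : ∀ n x, g (M.of n x) = N.of n (f.app n x) := fun n x => M.totalLift_of _ n x
  { g with
    map_smul' := fun r x => by
      change g (r • x) = r • g x
      induction r using DirectSum.Decomposition.inductionOn 𝒜 with
      | zero => simp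
      | add a b ha hb => simp [add_smul, ha, hb]
      | @homogeneous i r =>
        induction x using M.total_induction with
        | zero => simp
        | add x y hx hy => simp [hx, hy]
        | of n x =>
        rw [M.smul_of rfl, hg, hg, N.smul_of rfl, f.comm] }

lemma totalMap_of {M N : GrMod 𝒜} (f : M ⟶ N) (n : ℤ) (x : M.X n) :
    totalMap f (M.of n x) = N.of n (f.app n x) :=
  M.totalLift_of _ n x

lemma totalMap_hom_ext {M : GrMod 𝒜} {P : Type*} [AddCommGroup P] [Module R P]
    {f g : M.Total →ₗ[R] P} (h : ∀ n x, f (M.of n x) = g (M.of n x)) : f = g :=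
  LinearMap.ext fun x => by
    induction x using M.total_induction with
    | zero => simp
    | add x y hx hy => simp [hx, hy]
    | of n x => exact h n x

/-- The functor forgetting the grading. -/
def forgetGrading (𝒜 : ℕ → Submodule k R) [GradedAlgebra 𝒜] : GrMod 𝒜 ⥤ ModuleCat.{u} R where
  obj M := ModuleCat.of R M.Total
  map f := ModuleCat.ofHom (totalMap f)
  map_id M := by
    ext : 1
    exact totalMap_hom_ext fun n x => by rw [ModuleCat.hom_ofHom, totalMap_of]; rfl
  map_comp f g := by
    ext : 1
    exact totalMap_hom_ext fun n x => by
      simp [totalMap_of]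

/-- The right adjoint of the forgetful functor: every component is the given module. -/
def cofree (𝒜 : ℕ → Submodule k R) [GradedAlgebra 𝒜] (P : ModuleCat.{u} R) : GrMod 𝒜 where
  X _ := P
  module _ := Module.compHom P (algebraMap k R)
  act _ :=
    letI : Module k P := Module.compHom P (algebraMap k R)
    haveI : IsScalarTower k R P := ⟨fun c r x => by
      rw [Algebra.smul_def, mul_smul]; rfl⟩
    (Algebra.lsmul k k P).toLinearMap ∘ₗ (𝒜 _).subtype
  one_act _ x := one_smul R x
  mul_act _ _ _ r s x := mul_smul (r : R) (s : R) x

/-- The functor `cofree`. -/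
def cofreeFunctor (𝒜 : ℕ → Submodule k R) [GradedAlgebra 𝒜] : ModuleCat.{u} R ⥤ GrMod 𝒜 where
  obj P := cofree 𝒜 P
  map f := ⟨fun _ =>
    { toFun := fun x => f.hom x
      map_add' := fun x y => map_add f.hom x y
      map_smul' := fun c x => f.hom.map_smul (algebraMap k R c) x },
    fun _ r x => f.hom.map_smul (r : R) x⟩

lemma algebraMap_smul_total (M : GrMod 𝒜) (c : k) (x : M.Total) :
    algebraMap k R c • x = c • x := by
  rw [algebraMap_smul]

/-- Graded homomorphisms to `cofree 𝒜 P` are linear maps to `P`. -/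
def cofreeEquiv (M : GrMod 𝒜) (P : ModuleCat.{u} R) :
    (M.Total →ₗ[R] P) ≃ (M ⟶ cofree 𝒜 P) where
  toFun f := ⟨fun n =>
    { toFun := fun x => f (M.of n x)
      map_add' := fun x y => by rw [map_add, map_add]; rfl
      map_smul' := fun c x => by rw [map_smul, ← algebraMap_smul_total, map_smul]; rfl },
    fun h r x => by
      change f (M.of _ (M.act h r x)) = (r : R) • f (M.of _ x)
      rw [← smul_of, map_smul]⟩
  invFun g :=
    letI : Module k P := Module.compHom P (algebraMap k R)
    let φ : M.Total →ₗ[k] P := M.totalLift fun n => g.app n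
    have hφ : ∀ n x, φ (M.of n x) = g.app n x := fun n x => M.totalLift_of _ n x
    { toFun := φ
      map_add' := map_add φ
      map_smul' := fun r x => by
        change φ (r • x) = r • φ x
        induction r using DirectSum.Decomposition.inductionOn 𝒜 with
        | zero => simp
        | add a b ha hb => simp [add_smul, ha, hb]
        | @homogeneous i r =>
          induction x using M.total_induction with
          | zero => simp
          | add x y hx hy => simp [hx, hy]
          | of n x =>
          rw [M.smul_of rfl, hφ, hφ, g.comm]
          rfl }
  left_inv f := totalMap_hom_ext fun n x =>
    letI : Module k P := Module.compHom P (algebraMap k R)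
    M.totalLift_of _ n x
  right_inv g := by
    ext n x
    let : Module k P := Module.compHom P (algebraMap k R)
    exact M.totalLift_of _ n x

/-- Forgetting the grading is left adjoint to `cofree`. -/
def forgetAdj (𝒜 : ℕ → Submodule k R) [GradedAlgebra 𝒜] : forgetGrading 𝒜 ⊣ cofreeFunctor 𝒜 :=
  Adjunction.mkOfHomEquiv
    { homEquiv := fun M P => ModuleCat.homEquiv.trans (cofreeEquiv M P)
      homEquiv_naturality_left_symm := fun {M M' P} f g => by
        rw [Equiv.symm_apply_eq]
        ext n x
        exact (congrFun (congrArg (fun q => (Hom.app q n : _ → _))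
          ((cofreeEquiv M' P).right_inv g)) (f.app n x)).symm.trans
          (congrArg ((cofreeEquiv M' P).symm g) (totalMap_of f n x).symm)
      homEquiv_naturality_right := fun f g => rfl }

instance : (forgetGrading 𝒜).PreservesMonomorphisms where
  preserves {M N} f _ := by
    rw [ModuleCat.mono_iff_injective]
    have h : Function.Injective (DirectSum.lmap (R := k) f.app) :=
      (DirectSum.lmap_injective f.app).2 (injective_of_mono f)
    have e : ∀ x : M.Total, totalMap f x = DirectSum.lmap (R := k) f.app x := fun x =>
      congrArg (fun (φ : M.Total →ₗ[k] N.Total) => φ x)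
        (M.total_ext (f := (totalMap f).restrictScalars k) (g := DirectSum.lmap (R := k) f.app)
          fun n x => (totalMap_of f n x).trans (DirectSum.lmap_lof f.app n x).symm)
    intro x y hxy
    exact h ((e x).symm.trans (hxy.trans (e y)))

instance : (forgetGrading 𝒜).ReflectsMonomorphisms where
  reflects {M N} f hf := by
    rw [ModuleCat.mono_iff_injective] at hf
    refine mono_of_injective f fun n x y hxy => M.of_injective n (hf ?_)
    change totalMap f (M.of n x) = totalMap f (M.of n y)
    rw [totalMap_of, totalMap_of, hxy]

instance : EnoughInjectives (GrMod 𝒜) :=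
  EnoughInjectives.of_adjunction (forgetAdj 𝒜)

/-! ### Local cohomology -/

/-- The `I`-torsion `Γ_I(M) = {z | I ^ t z = 0 for some t}` in degree `n`. -/
def torsion (I : Ideal R) (M : GrMod 𝒜) (n : ℤ) : Submodule k (M.X n) where
  carrier := {z | ∃ t : ℕ, ∀ f ∈ I ^ t, f • M.of n z = 0}
  zero_mem' := ⟨0, fun f _ => by simp⟩
  add_mem' := by
    rintro x y ⟨a, ha⟩ ⟨b, hb⟩
    refine ⟨max a b, fun f hf => ?_⟩
    rw [map_add, smul_add, ha f (Ideal.pow_le_pow_right (le_max_left a b) hf),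
      hb f (Ideal.pow_le_pow_right (le_max_right a b) hf), add_zero]
  smul_mem' := by
    rintro c x ⟨a, ha⟩
    refine ⟨a, fun f hf => ?_⟩
    rw [map_smul, ← algebraMap_smul_total, smul_comm, ha f hf, smul_zero]

lemma torsion_act (I : Ideal R) (M : GrMod 𝒜) {i : ℕ} {m n : ℤ} (h : (i : ℤ) + m = n) (r : 𝒜 i)
    (x : M.X m) (hx : x ∈ torsion I M m) : M.act h r x ∈ torsion I M n := by
  obtain ⟨a, ha⟩ := hx
  refine ⟨a, fun f hf => ?_⟩
  rw [← smul_of, smul_comm, ha f hf, smul_zero]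

lemma torsion_map (I : Ideal R) {M N : GrMod 𝒜} (f : M ⟶ N) (n : ℤ) (x : M.X n)
    (hx : x ∈ torsion I M n) : f.app n x ∈ torsion I N n := by
  obtain ⟨a, ha⟩ := hx
  refine ⟨a, fun g hg => ?_⟩
  rw [← totalMap_of, ← map_smul, ha g hg, map_zero]

/-- The `I`-torsion functor on graded modules. -/
def torsionFunctor (𝒜 : ℕ → Submodule k R) [GradedAlgebra 𝒜] (I : Ideal R) :
    GrMod 𝒜 ⥤ GrMod 𝒜 where
  obj M := subObj M (torsion I M) (torsion_act I M)
  map {M N} f := ⟨fun n => (f.app n).restrict (torsion_map I f n),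
    fun h r x => Subtype.ext (f.comm h r x.1)⟩

instance (I : Ideal R) : (torsionFunctor 𝒜 I).Additive where
  map_add := rfl

/-- Local cohomology `H^j_I(M)`: the `j`-th right derived functor of `Γ_I` in the category of
graded modules. -/
def localCohomology (I : Ideal R) (j : ℕ) (M : GrMod 𝒜) : GrMod 𝒜 :=
  ((torsionFunctor 𝒜 I).rightDerived j).obj M

/-! ### The saturation -/

/-- The multiplicative set of homogeneous elements outside the homogeneous prime `P`. -/
def homogCompl (P : ProjectiveSpectrum 𝒜) : Submonoid R where
  carrier := {f | SetLike.IsHomogeneousElem 𝒜 f ∧ f ∉ P.asHomogeneousIdeal.toIdeal}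
  one_mem' := ⟨SetLike.isHomogeneousElem_one 𝒜, P.isPrime.one_notMem⟩
  mul_mem' := fun ha hb => ⟨ha.1.mul hb.1, fun h => (P.isPrime.mem_or_mem h).elim ha.2 hb.2⟩

/-- The open subset `U = Proj R \ Proj (R / I)` of `Proj R`. -/
abbrev projCompl (𝒜 : ℕ → Submodule k R) [GradedAlgebra 𝒜] (I : Ideal R) :
    Set (ProjectiveSpectrum 𝒜) :=
  (ProjectiveSpectrum.zeroLocus 𝒜 (I : Set R))ᶜ

/-- A section over `U` of the sheaf `M(ℓ)~` induced by the twist `M(ℓ)` on `Proj R`: a family of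
elements of the localizations of `M` at the points of `U` which locally on `U` is a fraction
`x / f` with `x` and `f` homogeneous and `deg x - deg f = ℓ`, that is, a fraction of degree zero
of `M(ℓ)`. -/
def IsTwistSection (M : GrMod 𝒜) (I : Ideal R) (ℓ : ℤ)
    (s : ∀ P : projCompl 𝒜 I, LocalizedModule (homogCompl P.1) M.Total) : Prop :=
  ∀ P : projCompl 𝒜 I, ∃ V : Set (ProjectiveSpectrum 𝒜), IsOpen V ∧ P.1 ∈ V ∧
    ∃ (d : ℕ) (n : ℤ) (_ : (d : ℤ) + ℓ = n) (f : 𝒜 d) (x : M.X n),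
      ∀ Q : projCompl 𝒜 I, Q.1 ∈ V → ∃ hf : (f : R) ∉ Q.1.asHomogeneousIdeal.toIdeal,
        s Q = LocalizedModule.mk (M.of n x) (⟨f, ⟨d, f.2⟩, hf⟩ : homogCompl Q.1)

/-- The space `H⁰(U, M(ℓ)~)`, where `U = Proj R \ Proj (R / I)`. -/
def twistSections (M : GrMod 𝒜) (I : Ideal R) (ℓ : ℤ) :
    Submodule k (∀ P : projCompl 𝒜 I, LocalizedModule (homogCompl P.1) M.Total) where
  carrier := {s | M.IsTwistSection I ℓ s}
  zero_mem' := fun P => ⟨Set.univ, isOpen_univ, trivial, 0, ℓ, by simp,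
    ⟨1, SetLike.one_mem_graded 𝒜⟩, 0, fun Q _ => ⟨Q.1.isPrime.one_notMem, by
      rw [map_zero, LocalizedModule.zero_mk]; rfl⟩⟩
  add_mem' := by
    intro s t hs ht P
    obtain ⟨V, hV, hPV, d, n, hn, f, x, hx⟩ := hs P
    obtain ⟨W, hW, hPW, e, m, hm, g, y, hy⟩ := ht P
    refine ⟨V ∩ W, hV.inter hW, ⟨hPV, hPW⟩, d + e, d + e + ℓ, by push_cast; ring,
      ⟨f * g, SetLike.mul_mem_graded f.2 g.2⟩,
      M.act (by omega) g x + M.act (by omega) f y, fun Q hQ => ?_⟩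
    obtain ⟨hf, h1⟩ := hx Q hQ.1
    obtain ⟨hg, h2⟩ := hy Q hQ.2
    refine ⟨fun h => (Q.1.isPrime.mem_or_mem h).elim hf hg, ?_⟩
    rw [Pi.add_apply, h1, h2, LocalizedModule.mk_add_mk, map_add, ← M.smul_of, ← M.smul_of]
    rfl
  smul_mem' := by
    intro c s hs P
    obtain ⟨V, hV, hPV, d, n, hn, f, x, hx⟩ := hs P
    refine ⟨V, hV, hPV, d, n, hn, f, c • x, fun Q hQ => ?_⟩
    obtain ⟨hf, h1⟩ := hx Q hQ
    exact ⟨hf, by rw [Pi.smul_apply, h1, LocalizedModule.smul'_mk, map_smul]⟩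

lemma smul_mem_twistSections (M : GrMod 𝒜) (I : Ideal R) {i : ℕ} {l n : ℤ} (h : (i : ℤ) + l = n)
    (r : 𝒜 i) (s : ∀ P : projCompl 𝒜 I, LocalizedModule (homogCompl P.1) M.Total)
    (hs : s ∈ M.twistSections I l) : (r : R) • s ∈ M.twistSections I n := by
  intro P
  obtain ⟨V, hV, hPV, d, m, hm, f, x, hx⟩ := hs P
  refine ⟨V, hV, hPV, d, i + m, by omega, f, M.act rfl r x, fun Q hQ => ?_⟩
  obtain ⟨hf, h1⟩ := hx Q hQ
  exact ⟨hf, by rw [Pi.smul_apply, h1, LocalizedModule.smul'_mk, M.smul_of rfl]⟩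

/-- The `I`-saturation `⨁ ℓ, H⁰(U, M(ℓ)~)` of `M`, where `U = Proj R \ Proj (R / I)`. -/
def saturation (I : Ideal R) (M : GrMod 𝒜) : GrMod 𝒜 where
  X ℓ := M.twistSections I ℓ
  act h := LinearMap.mk₂ k
    (fun r s =>
      ⟨(r : R) • s.1, M.smul_mem_twistSections I h r s.1 s.2⟩)
    (fun r r' s => Subtype.ext (add_smul (r : R) (r' : R) s.1))
    (fun c r s => Subtype.ext (smul_assoc c (r : R) s.1))
    (fun r s s' => Subtype.ext (smul_add (r : R) s.1 s'.1))
    (fun c r s => Subtype.ext (smul_comm (r : R) c s.1))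
  one_act _ s := Subtype.ext (one_smul R s.1)
  mul_act _ _ _ r r' s := Subtype.ext (mul_smul (r : R) (r' : R) s.1)

/-- The canonical homomorphism from a graded module to its `I`-saturation, sending a homogeneous
element `z` to the section `z / 1`. -/
def toSaturation (I : Ideal R) (M : GrMod 𝒜) : M ⟶ saturation I M where
  app ℓ :=
    { toFun := fun z => ⟨fun P => LocalizedModule.mk (M.of ℓ z) 1, fun P =>
        ⟨Set.univ, isOpen_univ, trivial, 0, ℓ, by simp, ⟨1, SetLike.one_mem_graded 𝒜⟩, z,
          fun Q _ => ⟨Q.1.isPrime.one_notMem, rfl⟩⟩⟩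
      map_add' := fun x y => Subtype.ext (funext fun P => by
        change LocalizedModule.mk (M.of ℓ (x + y)) (1 : homogCompl P.1) =
          LocalizedModule.mk (M.of ℓ x) (1 : homogCompl P.1) +
            LocalizedModule.mk (M.of ℓ y) (1 : homogCompl P.1)
        rw [map_add, LocalizedModule.mk_add_mk, one_smul, one_smul, mul_one])
      map_smul' := fun c x => Subtype.ext (funext fun P => by
        change LocalizedModule.mk (M.of ℓ (c • x)) (1 : homogCompl P.1) =
          c • LocalizedModule.mk (M.of ℓ x) (1 : homogCompl P.1)
        rw [map_smul, LocalizedModule.smul'_mk]) }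
  comm h r x := Subtype.ext (funext fun P => by
    change LocalizedModule.mk (M.of _ (M.act h r x)) (1 : homogCompl P.1) =
      (r : R) • LocalizedModule.mk (M.of _ x) (1 : homogCompl P.1)
    rw [LocalizedModule.smul'_mk, M.smul_of h])

end Category

end GrMod

/-- The pairs `(i, j)` with `i + j = m`, `2 ≤ i` and `2 ≤ j`. -/
def pairsGeTwo (m : ℕ) : Finset (ℕ × ℕ) :=
  (Finset.HasAntidiagonal.antidiagonal m).filter fun p => 2 ≤ p.1 ∧ 2 ≤ p.2

/-! ### Segre products -/

section Segre

variable {k R S : Type u} [Field k] [CommRing R] [Algebra k R] [CommRing S] [Algebra k S]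

/-- The subspace `⨁ n, V n ⊗ W n` of `R ⊗ S`, for subspaces `V n` of `R` and `W n` of `S`. -/
def segreSpan (V : ℕ → Submodule k R) (W : ℕ → Submodule k S) : Submodule k (R ⊗[k] S) :=
  ⨆ n, LinearMap.range (TensorProduct.mapIncl (V n) (W n))

lemma tmul_mem_segreSpan {V : ℕ → Submodule k R} {W : ℕ → Submodule k S} {n : ℕ} {r : R} {s : S}
    (hr : r ∈ V n) (hs : s ∈ W n) : r ⊗ₜ[k] s ∈ segreSpan V W :=
  Submodule.mem_iSup_of_mem n ⟨(⟨r, hr⟩ : V n) ⊗ₜ (⟨s, hs⟩ : W n), rfl⟩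

lemma range_mapIncl_induction {V : Submodule k R} {W : Submodule k S} {p : R ⊗[k] S → Prop}
    (h0 : p 0) (h1 : ∀ r ∈ V, ∀ s ∈ W, p (r ⊗ₜ s)) (h2 : ∀ x y, p x → p y → p (x + y))
    (x : R ⊗[k] S) (hx : x ∈ LinearMap.range (TensorProduct.mapIncl V W)) : p x := by
  obtain ⟨y, rfl⟩ := hx
  induction y using TensorProduct.induction_on with
  | zero => simpa using h0
  | tmul r s => exact h1 r r.2 s s.2
  | add x y hx hy => rw [map_add]; exact h2 _ _ hx hy

lemma segreSpan_induction {V : ℕ → Submodule k R} {W : ℕ → Submodule k S} {p : R ⊗[k] S → Prop}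
    (h0 : p 0) (h1 : ∀ n, ∀ r ∈ V n, ∀ s ∈ W n, p (r ⊗ₜ s))
    (h2 : ∀ x y, p x → p y → p (x + y)) (x : R ⊗[k] S) (hx : x ∈ segreSpan V W) : p x :=
  Submodule.iSup_induction _ (motive := p) hx
    (fun n x hx => range_mapIncl_induction h0 (h1 n) h2 x hx) h0 h2

lemma mul_mem_segreSpan {V V' V'' : ℕ → Submodule k R} {W W' W'' : ℕ → Submodule k S}
    (hV : ∀ m n, ∀ a ∈ V m, ∀ b ∈ V' n, a * b ∈ V'' (m + n))
    (hW : ∀ m n, ∀ a ∈ W m, ∀ b ∈ W' n, a * b ∈ W'' (m + n)) {x y : R ⊗[k] S}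
    (hx : x ∈ segreSpan V W) (hy : y ∈ segreSpan V' W') : x * y ∈ segreSpan V'' W'' := by
  refine segreSpan_induction (p := fun x => x * y ∈ segreSpan V'' W'') (by simp)
    (fun m r hr s hs => ?_) (fun x x' hx hx' => by rw [add_mul]; exact add_mem hx hx') x hx
  refine segreSpan_induction (p := fun y => r ⊗ₜ[k] s * y ∈ segreSpan V'' W'') (by simp) (fun n r' hr' s' hs' => ?_)
    (fun x x' hx hx' => by rw [mul_add]; exact add_mem hx hx') y hy
  rw [Algebra.TensorProduct.tmul_mul_tmul]
  exact tmul_mem_segreSpan (hV m n r hr r' hr') (hW m n s hs s' hs')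

variable (𝒜 : ℕ → Submodule k R) [GradedAlgebra 𝒜] (ℬ : ℕ → Submodule k S) [GradedAlgebra ℬ]

/-- The subspace `⨁ n, R_n ⊗ S_n` is a subalgebra of `R ⊗ S`. -/
def segreSubalgebra : Subalgebra k (R ⊗[k] S) :=
  (segreSpan 𝒜 ℬ).toSubalgebra
    (tmul_mem_segreSpan (SetLike.one_mem_graded 𝒜) (SetLike.one_mem_graded ℬ))
    (fun _ _ hx hy => mul_mem_segreSpan (fun _ _ _ ha _ hb => SetLike.mul_mem_graded ha hb)
      (fun _ _ _ ha _ hb => SetLike.mul_mem_graded ha hb) hx hy)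

/-- The Segre product `R # S = ⨁ n, R_n ⊗ S_n`. -/
def SegreRing : Type u := segreSubalgebra 𝒜 ℬ

instance : CommRing (SegreRing 𝒜 ℬ) := inferInstanceAs (CommRing (segreSubalgebra 𝒜 ℬ))

instance : Algebra k (SegreRing 𝒜 ℬ) := inferInstanceAs (Algebra k (segreSubalgebra 𝒜 ℬ))

/-- The inclusion of the Segre product in the tensor product. -/
def segreVal : SegreRing 𝒜 ℬ →ₐ[k] R ⊗[k] S := (segreSubalgebra 𝒜 ℬ).val

lemma segreVal_injective : Function.Injective (segreVal 𝒜 ℬ) := Subtype.val_injective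

lemma segreVal_mem (t : SegreRing 𝒜 ℬ) : segreVal 𝒜 ℬ t ∈ segreSpan 𝒜 ℬ := t.2

/-- The grading of the Segre product: the component of degree `n` is `R_n ⊗ S_n`. -/
def segreGrading (n : ℕ) : Submodule k (SegreRing 𝒜 ℬ) :=
  (LinearMap.range (TensorProduct.mapIncl (𝒜 n) (ℬ n))).comap (segreVal 𝒜 ℬ).toLinearMap

lemma mem_segreGrading {n : ℕ} {t : SegreRing 𝒜 ℬ} : t ∈ segreGrading 𝒜 ℬ n ↔
    segreVal 𝒜 ℬ t ∈ LinearMap.range (TensorProduct.mapIncl (𝒜 n) (ℬ n)) := Iff.rfl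

instance : SetLike.GradedMonoid (segreGrading 𝒜 ℬ) where
  one_mem := ⟨(⟨1, SetLike.one_mem_graded 𝒜⟩ : 𝒜 0) ⊗ₜ (⟨1, SetLike.one_mem_graded ℬ⟩ : ℬ 0),
    (map_one (segreVal 𝒜 ℬ)).symm⟩
  mul_mem i j x y hx hy := by
    rw [mem_segreGrading] at hx hy ⊢
    rw [map_mul]
    refine range_mapIncl_induction
      (p := fun x => x * segreVal 𝒜 ℬ y ∈
        LinearMap.range (TensorProduct.mapIncl (𝒜 (i + j)) (ℬ (i + j))))
      (by simp) (fun r hr s hs => ?_)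
      (fun x x' hx hx' => by rw [add_mul]; exact add_mem hx hx') _ hx
    refine range_mapIncl_induction
      (p := fun y => r ⊗ₜ[k] s * y ∈
        LinearMap.range (TensorProduct.mapIncl (𝒜 (i + j)) (ℬ (i + j))))
      (by simp) (fun r' hr' s' hs' => ?_)
      (fun x x' hx hx' => by rw [mul_add]; exact add_mem hx hx') _ hy
    rw [Algebra.TensorProduct.tmul_mul_tmul]
    exact ⟨(⟨r * r', SetLike.mul_mem_graded hr hr'⟩ : 𝒜 (i + j)) ⊗ₜ
      (⟨s * s', SetLike.mul_mem_graded hs hs'⟩ : ℬ (i + j)), rfl⟩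

/-- The projection of `R` to its component of degree `n`. -/
def gradedProj (n : ℕ) : R →ₗ[k] 𝒜 n :=
  DirectSum.component k ℕ (fun i => 𝒜 i) n ∘ₗ (decomposeLinearEquiv 𝒜).toLinearMap

@[simp]
lemma gradedProj_coe {n : ℕ} (r : 𝒜 n) : gradedProj 𝒜 n (r : R) = r := by
  have h : decomposeLinearEquiv 𝒜 (r : R) = DirectSum.lof k ℕ (fun i => 𝒜 i) n r :=
    decomposeLinearEquiv_apply_coe 𝒜 n r
  exact (congrArg (fun z : ⨁ i, 𝒜 i => z n) h).trans (DirectSum.lof_apply (M := fun i => 𝒜 i) k n r)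

/-- The element `r ⊗ s` of `R_n ⊗ S_n` as an element of the Segre product. -/
def segreIncl (n : ℕ) : 𝒜 n ⊗[k] ℬ n →ₗ[k] segreGrading 𝒜 ℬ n where
  toFun z := ⟨⟨TensorProduct.mapIncl (𝒜 n) (ℬ n) z, Submodule.mem_iSup_of_mem n ⟨z, rfl⟩⟩, z, rfl⟩
  map_add' x y := Subtype.ext (Subtype.ext (map_add (TensorProduct.mapIncl (𝒜 n) (ℬ n)) x y))
  map_smul' c x := Subtype.ext (Subtype.ext (map_smul (TensorProduct.mapIncl (𝒜 n) (ℬ n)) c x))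

lemma segreIncl_surjective (n : ℕ) : Function.Surjective (segreIncl 𝒜 ℬ n) := by
  rintro ⟨t, z, hz⟩
  exact ⟨z, Subtype.ext (Subtype.ext hz)⟩

/-- The decomposition of the Segre product into homogeneous components. -/
def segreDecompose : R ⊗[k] S →ₗ[k] ⨁ n, segreGrading 𝒜 ℬ n :=
  TensorProduct.lift
    (DirectSum.toModule k ℕ (S →ₗ[k] ⨁ n, segreGrading 𝒜 ℬ n) (fun n =>
      ((TensorProduct.mk k (𝒜 n) (ℬ n)).compr₂
        (DirectSum.lof k ℕ (fun n => segreGrading 𝒜 ℬ n) n ∘ₗ segreIncl 𝒜 ℬ n)).compl₂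
          (gradedProj ℬ n)) ∘ₗ (decomposeLinearEquiv 𝒜).toLinearMap)

lemma segreDecompose_tmul {n : ℕ} (r : 𝒜 n) (s : ℬ n) :
    segreDecompose 𝒜 ℬ ((r : R) ⊗ₜ (s : S)) =
      DirectSum.lof k ℕ (fun n => segreGrading 𝒜 ℬ n) n (segreIncl 𝒜 ℬ n (r ⊗ₜ s)) := by
  have h : decomposeLinearEquiv 𝒜 (r : R) = DirectSum.lof k ℕ (fun i => 𝒜 i) n r :=
    decomposeLinearEquiv_apply_coe 𝒜 n r
  rw [segreDecompose, TensorProduct.lift.tmul, LinearMap.comp_apply, LinearEquiv.coe_coe, h,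
    DirectSum.toModule_lof]
  simp

lemma segreDecompose_mapIncl {n : ℕ} (z : 𝒜 n ⊗[k] ℬ n) :
    segreDecompose 𝒜 ℬ (TensorProduct.mapIncl (𝒜 n) (ℬ n) z) =
      DirectSum.lof k ℕ (fun n => segreGrading 𝒜 ℬ n) n (segreIncl 𝒜 ℬ n z) := by
  induction z using TensorProduct.induction_on with
  | zero => simp
  | tmul r s => exact segreDecompose_tmul 𝒜 ℬ r s
  | add x y hx hy => simp only [map_add, hx, hy]

instance : GradedAlgebra (segreGrading 𝒜 ℬ) where
  __ := (inferInstance : SetLike.GradedMonoid (segreGrading 𝒜 ℬ))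
  __ := DirectSum.Decomposition.ofLinearMap (segreGrading 𝒜 ℬ)
    (segreDecompose 𝒜 ℬ ∘ₗ (segreVal 𝒜 ℬ).toLinearMap)
    (by
      refine LinearMap.ext fun t => segreVal_injective 𝒜 ℬ ?_
      change segreVal 𝒜 ℬ (DirectSum.coeLinearMap (segreGrading 𝒜 ℬ)
        (segreDecompose 𝒜 ℬ (segreVal 𝒜 ℬ t))) = segreVal 𝒜 ℬ t
      refine segreSpan_induction
        (p := fun x => segreVal 𝒜 ℬ (DirectSum.coeLinearMap (segreGrading 𝒜 ℬ)
          (segreDecompose 𝒜 ℬ x)) = x) (by simp) (fun n r hr s hs => ?_)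
        (fun x y hx hy => by rw [map_add, map_add, map_add, hx, hy]) _ (segreVal_mem 𝒜 ℬ t)
      rw [segreDecompose_tmul 𝒜 ℬ (⟨r, hr⟩ : 𝒜 n) (⟨s, hs⟩ : ℬ n), DirectSum.coeLinearMap_lof]
      rfl)
    (by
      refine DirectSum.linearMap_ext k fun n => LinearMap.ext fun t => ?_
      obtain ⟨z, rfl⟩ := segreIncl_surjective 𝒜 ℬ n t
      change segreDecompose 𝒜 ℬ (segreVal 𝒜 ℬ (DirectSum.coeLinearMap (segreGrading 𝒜 ℬ)
        (DirectSum.lof k ℕ (fun n => segreGrading 𝒜 ℬ n) n (segreIncl 𝒜 ℬ n z)))) = _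
      rw [DirectSum.coeLinearMap_lof]
      exact segreDecompose_mapIncl 𝒜 ℬ z)

/-- The Segre product of ideals `I # J = ⨁ n, I_n ⊗ J_n`, an ideal of `R # S`. -/
def segreIdeal (I : Ideal R) (J : Ideal S) : Ideal (SegreRing 𝒜 ℬ) where
  carrier := {t | segreVal 𝒜 ℬ t ∈
    segreSpan (fun n => I.restrictScalars k ⊓ 𝒜 n) (fun n => J.restrictScalars k ⊓ ℬ n)}
  zero_mem' := Submodule.zero_mem (segreSpan _ _)
  add_mem' := fun ha hb => Submodule.add_mem (segreSpan _ _) ha hb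
  smul_mem' := fun t _ hx => mul_mem_segreSpan
    (V' := fun n => I.restrictScalars k ⊓ 𝒜 n) (W' := fun n => J.restrictScalars k ⊓ ℬ n)
    (V'' := fun n => I.restrictScalars k ⊓ 𝒜 n) (W'' := fun n => J.restrictScalars k ⊓ ℬ n)
    (fun _ _ a ha _ hb => ⟨I.mul_mem_left a hb.1, SetLike.mul_mem_graded ha hb.2⟩)
    (fun _ _ a ha _ hb => ⟨J.mul_mem_left a hb.1, SetLike.mul_mem_graded ha hb.2⟩) t.2 hx

variable {𝒜 ℬ}

namespace GrMod

/-- The action of `R_i ⊗ S_i` on `M_m ⊗ N_m`, by `(r ⊗ s) (x ⊗ y) = r x ⊗ s y`. -/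
def segreAct (M : GrMod 𝒜) (N : GrMod ℬ) {i : ℕ} {m n : ℤ} (h : (i : ℤ) + m = n) :
    segreGrading 𝒜 ℬ i →ₗ[k] M.X m ⊗[k] N.X m →ₗ[k] M.X n ⊗[k] N.X n :=
  TensorProduct.homTensorHomMap (RingHom.id k) (M.X m) (N.X m) (M.X n) (N.X n) ∘ₗ
    TensorProduct.map (M.act h ∘ₗ gradedProj 𝒜 i) (N.act h ∘ₗ gradedProj ℬ i) ∘ₗ
      (segreVal 𝒜 ℬ).toLinearMap ∘ₗ (segreGrading 𝒜 ℬ i).subtype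

lemma segreAct_tmul (M : GrMod 𝒜) (N : GrMod ℬ) {i : ℕ} {m n : ℤ} (h : (i : ℤ) + m = n)
    (r : 𝒜 i) (s : ℬ i) (x : M.X m) (y : N.X m) :
    segreAct M N h (segreIncl 𝒜 ℬ i (r ⊗ₜ s)) (x ⊗ₜ y) = M.act h r x ⊗ₜ N.act h s y := by
  change TensorProduct.homTensorHomMap (RingHom.id k) (M.X m) (N.X m) (M.X n) (N.X n)
    (TensorProduct.map (M.act h ∘ₗ gradedProj 𝒜 i) (N.act h ∘ₗ gradedProj ℬ i)
      ((r : R) ⊗ₜ (s : S))) (x ⊗ₜ y) = _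
  simp

lemma segreGrading_induction {i : ℕ} {p : segreGrading 𝒜 ℬ i → Prop} (zero : p 0)
    (tmul : ∀ (r : 𝒜 i) (s : ℬ i), p (segreIncl 𝒜 ℬ i (r ⊗ₜ s)))
    (add : ∀ x y, p x → p y → p (x + y)) (t : segreGrading 𝒜 ℬ i) : p t := by
  obtain ⟨z, rfl⟩ := segreIncl_surjective 𝒜 ℬ i t
  induction z using TensorProduct.induction_on with
  | zero => simpa using zero
  | tmul r s => exact tmul r s
  | add x y hx hy =>
    rw [map_add]
    exact add _ _ hx hy

/-- The Segre product `M # N = ⨁ n, M_n ⊗ N_n`, a graded module over `R # S`. -/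
def segre (M : GrMod 𝒜) (N : GrMod ℬ) : GrMod (segreGrading 𝒜 ℬ) where
  X n := M.X n ⊗[k] N.X n
  act h := segreAct M N h
  one_act {n} h x := by
    have e : (⟨1, SetLike.one_mem_graded (segreGrading 𝒜 ℬ)⟩ : segreGrading 𝒜 ℬ 0) =
      segreIncl 𝒜 ℬ 0 ((⟨1, SetLike.one_mem_graded 𝒜⟩ : 𝒜 0) ⊗ₜ
        (⟨1, SetLike.one_mem_graded ℬ⟩ : ℬ 0)) := rfl
    rw [e]
    induction x using TensorProduct.induction_on with
    | zero => simp
    | tmul x y => rw [segreAct_tmul, M.one_act, N.one_act]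
    | add x y hx hy => rw [map_add, hx, hy]
  mul_act {i j l m n} h₁ h₂ h₃ t t' x := by
    let μ : segreGrading 𝒜 ℬ i →ₗ[k] segreGrading 𝒜 ℬ j →ₗ[k] segreGrading 𝒜 ℬ (i + j) :=
      LinearMap.mk₂ k (fun a b => ⟨a.1 * b.1, SetLike.mul_mem_graded a.2 b.2⟩)
        (fun a b c => Subtype.ext (add_mul a.1 b.1 c.1))
        (fun c a b => Subtype.ext (smul_mul_assoc c a.1 b.1))
        (fun a b c => Subtype.ext (mul_add a.1 b.1 c.1))
        (fun c a b => Subtype.ext (mul_smul_comm c a.1 b.1))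
    change segreAct M N h₃ (μ t t') x = segreAct M N h₂ t (segreAct M N h₁ t' x)
    induction t using segreGrading_induction with
    | zero => simp
    | add a b ha hb => simp only [map_add, LinearMap.add_apply, ha, hb]
    | tmul r s =>
    induction t' using segreGrading_induction with
    | zero => simp
    | add a b ha hb => simp only [map_add, LinearMap.add_apply, ha, hb]
    | tmul r' s' =>
    have e : μ (segreIncl 𝒜 ℬ i (r ⊗ₜ s)) (segreIncl 𝒜 ℬ j (r' ⊗ₜ s')) =
        segreIncl 𝒜 ℬ (i + j)
          ((⟨r * r', SetLike.mul_mem_graded r.2 r'.2⟩ : 𝒜 (i + j)) ⊗ₜ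
            (⟨s * s', SetLike.mul_mem_graded s.2 s'.2⟩ : ℬ (i + j))) :=
      Subtype.ext (Subtype.ext (Algebra.TensorProduct.tmul_mul_tmul _ _ _ _))
    rw [e]
    induction x using TensorProduct.induction_on with
    | zero => simp
    | tmul x y => simp only [segreAct_tmul, M.mul_act h₁ h₂ h₃, N.mul_act h₁ h₂ h₃]
    | add x y hx hy => simp only [map_add, hx, hy]

/-- The Segre product `f # g` of graded homomorphisms. -/
def segreMap {M M' : GrMod 𝒜} {N N' : GrMod ℬ} (f : M ⟶ M') (g : N ⟶ N') :
    segre M N ⟶ segre M' N' where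
  app n := TensorProduct.map (f.app n) (g.app n)
  comm {i m n} h t x := by
    change M.X m ⊗[k] N.X m at x
    change TensorProduct.map (f.app n) (g.app n) (segreAct M N h t x) =
      segreAct M' N' h t (TensorProduct.map (f.app m) (g.app m) x)
    induction t using segreGrading_induction with
    | zero => simp
    | add a b ha hb => simp only [map_add, LinearMap.add_apply, ha, hb]
    | tmul r s =>
    induction x using TensorProduct.induction_on with
    | zero => simp
    | tmul x y => simp only [segreAct_tmul, TensorProduct.map_tmul, f.comm, g.comm]
    | add x y hx hy => simp only [map_add, hx, hy]

end GrMod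

end Segre
end

/-!
Write `A = R # S` and `𝔞 = I # J`. Let `E` and `F` be graded injective resolutions of `M` and `N`.
Both sides of the asserted isomorphisms are computed from the double complexes `E # F` and
`E^sat # F^sat`.

*Forms and torsion.* Choose forms `f_1, …, f_r` and `g_1, …, g_s` of one common degree `D > 0` which
generate `I` and `J` up to radical. Then the `f_i ⊗ g_j`, which are forms of `A`, generate `𝔞` up to
radical, and torsion with respect to an ideal is torsion with respect to each of these forms. A
graded module is called acyclic (`GrMod.Acyclic`) if, on its submodule of torsion for `f_1, …, f_i`,
the functor of `f_{i+1}`-torsion has no first cohomology, for all `i`. This elementary condition is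
stable under quotients by acyclic submodules and under extensions, so torsion preserves exactness
of exact complexes of acyclic modules, and local cohomology can be computed with any acyclic
resolution (`GrMod.nonempty_localCohomology_iso`).

*Injective modules.* Over a Noetherian ring the `f`-torsion of an injective graded module is a
direct summand, and `f` is bijective on the complementary summand. Hence an injective module is a
finite direct sum of pure modules, on each of which every `f_i` acts bijectively or locally
nilpotently (`GrMod.injective_induction`). Three statements follow by reduction to pure modules:
injective modules are acyclic; Segre products of injective modules are acyclic
(`GrMod.acyclic_segre`); and `E → E^sat` is surjective for injective `E`, where the case of a
bijective `f_j` is the computation of the sections over the affine scheme `D₊(f_j)`. The kernel of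
`E → E^sat` is the torsion.

*Torsion-free quotients.* If `T` is an acyclic resolution of `X` and `W` the quotient of `T` by its
torsion, then the long exact sequence of `0 → Γ(T) → T → W → 0` reads
`0 → H⁰(X) → X → H⁰(W) → H¹(X) → 0` and `H^q(W) ≅ H^{q+1}(X)` for `q > 0`
(`GrMod.exists_localCohomology_sequence`, `GrMod.nonempty_localCohomology_iso_coh`). Applied to
`E → E^sat`, this gives the cohomology of `E^sat`: it is `M^sat` in degree `0`, since saturation is
left exact, and `H^{q+1}_I(M)` in degree `q > 0`. By the Künneth formula `Tot(E # F)` is a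
resolution of `M # N`, and it is acyclic over `A`. A Segre product of torsion-free
modules is torsion-free and the kernel of `E # F → E^sat # F^sat` is torsion, so
`Tot(E^sat # F^sat)` is the quotient of `Tot(E # F)` by its `𝔞`-torsion
(`GrMod.isTorsionFreeQuotient_segre`). The
low-degree sequence for it is the asserted exact sequence, and for `k ≥ 2` the module
`H^k_𝔞(M # N)` is the cohomology of `Tot(E^sat # F^sat)` in degree `k - 1`, which the Künneth
formula (`GrMod.kunnethIso`) expresses as the sum of the products of the cohomology
modules of `E^sat` and `F^sat`.
-/

noncomputable section

namespace GrMod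

section Torsion

variable {k R : Type u} [Field k] [CommRing R] [Algebra k R]
variable {𝒜 : ℕ → Submodule k R} [GradedAlgebra 𝒜]

/-! ### Torsion elements and short exact sequences -/

/-- The element `x` is killed by a power of `f`. -/
def IsTors (f : R) {M : GrMod 𝒜} {n : ℤ} (x : M.X n) : Prop :=
  ∃ t : ℕ, f ^ t • M.of n x = 0

lemma pow_smul_eq_zero_of_le {f : R} {M : GrMod 𝒜} {t s : ℕ} {z : M.Total} (h : f ^ t • z = 0)
    (hts : t ≤ s) : f ^ s • z = 0 := by
  obtain ⟨a, rfl⟩ := Nat.exists_eq_add_of_le hts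
  rw [add_comm, pow_add, mul_smul, h, smul_zero]

namespace IsTors

variable {f : R} {M N : GrMod 𝒜} {n : ℤ}

lemma zero : IsTors f (0 : M.X n) := ⟨0, by simp⟩

lemma add {x y : M.X n} (hx : IsTors f x) (hy : IsTors f y) : IsTors f (x + y) := by
  obtain ⟨a, ha⟩ := hx
  obtain ⟨b, hb⟩ := hy
  exact ⟨max a b, by rw [map_add, smul_add,
    pow_smul_eq_zero_of_le ha (le_max_left a b), pow_smul_eq_zero_of_le hb (le_max_right a b),
    add_zero]⟩

lemma neg {x : M.X n} (hx : IsTors f x) : IsTors f (-x) := by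
  obtain ⟨a, ha⟩ := hx
  exact ⟨a, by rw [map_neg, smul_neg, ha, neg_zero]⟩

lemma sub {x y : M.X n} (hx : IsTors f x) (hy : IsTors f y) : IsTors f (x - y) :=
  sub_eq_add_neg x y ▸ hx.add hy.neg

lemma smul (c : k) {x : M.X n} (hx : IsTors f x) : IsTors f (c • x) := by
  obtain ⟨a, ha⟩ := hx
  exact ⟨a, by rw [map_smul, ← algebraMap_smul_total, smul_comm, ha, smul_zero]⟩

lemma act {i : ℕ} {m : ℤ} (h : (i : ℤ) + n = m) (r : 𝒜 i) {x : M.X n} (hx : IsTors f x) :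
    IsTors f (M.act h r x) := by
  obtain ⟨a, ha⟩ := hx
  exact ⟨a, by rw [← smul_of, smul_comm, ha, smul_zero]⟩

lemma of_act {i : ℕ} {m : ℤ} (h : (i : ℤ) + n = m) (r : 𝒜 i) {x : M.X n}
    (hx : IsTors (r : R) (M.act h r x)) : IsTors (r : R) x := by
  obtain ⟨a, ha⟩ := hx
  exact ⟨a + 1, by rw [pow_succ, mul_smul, smul_of M h, ha]⟩

lemma map (φ : M ⟶ N) {x : M.X n} (hx : IsTors f x) : IsTors f (φ.app n x) := by
  obtain ⟨a, ha⟩ := hx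
  exact ⟨a, by rw [← totalMap_of, ← map_smul, ha, map_zero]⟩

end IsTors

/-- The homogeneous component of degree `n` of an element of the underlying module. -/
def component (M : GrMod 𝒜) (n : ℤ) : M.Total →ₗ[k] M.X n := DirectSum.component k ℤ M.X n

lemma component_of (M : GrMod 𝒜) (n : ℤ) (x : M.X n) : M.component n (M.of n x) = x :=
  DirectSum.component.lof_self (ι := ℤ) (M := M.X) k n x

lemma component_of_ne (M : GrMod 𝒜) {m n : ℤ} (h : m ≠ n) (x : M.X m) :
    M.component n (M.of m x) = 0 :=
  DirectSum.of_eq_of_ne _ _ _ h.symm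

lemma eq_zero_of_component (M : GrMod 𝒜) {z : M.Total} (h : ∀ n, M.component n z = 0) : z = 0 :=
  DFinsupp.ext h

lemma component_smul (M : GrMod 𝒜) {i : ℕ} {m n : ℤ} (h : (i : ℤ) + m = n) (r : 𝒜 i)
    (z : M.Total) : M.component n ((r : R) • z) = M.act h r (M.component m z) := by
  induction z using M.total_induction with
  | zero => simp
  | add x y hx hy => rw [smul_add, map_add, hx, hy, map_add, map_add]
  | of l x =>
    rw [M.smul_of rfl]
    rcases eq_or_ne l m with rfl | hl
    · subst h
      rw [component_of, component_of]
    · rw [component_of_ne _ hl, map_zero, component_of_ne _ (by omega)]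

lemma eq_zero_of_smul_eq_zero (M : GrMod 𝒜) {i : ℕ} (r : 𝒜 i)
    (hr : ∀ n : ℤ, Function.Injective (M.act (m := n) (n := i + n) rfl r)) {z : M.Total}
    (hz : (r : R) • z = 0) : z = 0 :=
  M.eq_zero_of_component fun n => hr n (by rw [← M.component_smul, hz, map_zero, map_zero])

lemma totalMap_injective {M N : GrMod 𝒜} {φ : M ⟶ N}
    (h : ∀ n, Function.Injective (φ.app n)) : Function.Injective (totalMap φ) :=
  haveI := mono_of_injective φ h
  (ModuleCat.mono_iff_injective ((forgetGrading 𝒜).map φ)).1 inferInstance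

lemma isTors_map_iff {f : R} {M N : GrMod 𝒜} {φ : M ⟶ N}
    (h : ∀ n, Function.Injective (φ.app n)) {n : ℤ} {x : M.X n} :
    IsTors f (φ.app n x) ↔ IsTors f x := by
  refine ⟨fun ⟨t, ht⟩ => ⟨t, totalMap_injective h ?_⟩, fun hx => hx.map φ⟩
  rw [map_smul, totalMap_of, ht, map_zero]

lemma isTors_sub_val {f : R} {M : GrMod 𝒜} (V : ∀ n, Submodule k (M.X n))
    (hV : ∀ {i : ℕ} {m n : ℤ} (h : (i : ℤ) + m = n) (r : 𝒜 i) (x : M.X m),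
      x ∈ V m → M.act h r x ∈ V n) {n : ℤ} {x : (subObj M V hV).X n} :
    IsTors f x ↔ IsTors f (show M.X n from x.1) :=
  (isTors_map_iff (φ := subι M V hV) fun _ => Subtype.val_injective).symm

/-- A degreewise exact sequence `0 → A → B → C → 0`. -/
structure IsShortExact {A B C : GrMod 𝒜} (i : A ⟶ B) (p : B ⟶ C) : Prop where
  inj : ∀ n, Function.Injective (i.app n)
  exact : ∀ n, Function.Exact (i.app n) (p.app n)
  surj : ∀ n, Function.Surjective (p.app n)

lemma isShortExact_sub_quot (M : GrMod 𝒜) (V : ∀ n, Submodule k (M.X n))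
    (hV : ∀ {i : ℕ} {m n : ℤ} (h : (i : ℤ) + m = n) (r : 𝒜 i) (x : M.X m),
      x ∈ V m → M.act h r x ∈ V n) : IsShortExact (subι M V hV) (quotπ M V hV) where
  inj _ := Subtype.val_injective
  exact _ x := (Submodule.Quotient.mk_eq_zero _).trans
    ⟨fun h => ⟨⟨x, h⟩, rfl⟩, fun ⟨y, hy⟩ => hy ▸ y.2⟩
  surj _ := Submodule.mkQ_surjective _

/-! ### Modules with vanishing higher torsion for a sequence of elements -/

variable {D r : ℕ}

/-- `T` is `f`-acyclic for a sequence `f₁, …, f_r` of forms of degree `D` when, with `T_i` the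
elements that are torsion for `f₁, …, f_i`, one has `T_i = f_{i+1} T_i + T_{i+1}` for all `i`.
Equivalently, `H¹` of each successive functor `Γ_{f_{i+1}}` vanishes on `T_i`. -/
def Acyclic (f : Fin r → 𝒜 D) (T : GrMod 𝒜) : Prop :=
  ∀ (i : Fin r) {m n : ℤ} (e : (D : ℤ) + m = n) (x : T.X n), (∀ j < i, IsTors (f j : R) x) →
    ∃ y : T.X m, (∀ j < i, IsTors (f j : R) y) ∧ IsTors (f i : R) (x - T.act e (f i) y)

/-- Each `f_i` acts on `T` either bijectively or locally nilpotently. -/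
def Pure (f : Fin r → 𝒜 D) (T : GrMod 𝒜) : Prop :=
  ∀ i : Fin r, (∀ {m n : ℤ} (e : (D : ℤ) + m = n), Function.Bijective (T.act e (f i))) ∨
    ∀ (n : ℤ) (x : T.X n), IsTors (f i : R) x

lemma Pure.acyclic {f : Fin r → 𝒜 D} {T : GrMod 𝒜} (h : Pure f T) : Acyclic f T := by
  intro i m n e x hx
  rcases h i with hb | ht
  · obtain ⟨y, rfl⟩ := (hb e).2 x
    refine ⟨y, fun j hj => ?_, by simpa using IsTors.zero⟩
    obtain ⟨t, ht⟩ := hx j hj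
    -- a power of `f_j` kills `f_i y`, hence `y`, as `f_i` is injective on `T.Total`
    refine ⟨t, T.eq_zero_of_smul_eq_zero (f i) (fun n => (hb rfl).1) ?_⟩
    rw [smul_comm, T.smul_of e, ht]
  · exact ⟨0, fun j _ => IsTors.zero, ht n _⟩

namespace Acyclic

variable {f : Fin r → 𝒜 D} {A B C : GrMod 𝒜} {i : A ⟶ B} {p : B ⟶ C}

/-- Torsion elements lift along a surjection with acyclic kernel. -/
lemma exists_lift (hA : Acyclic f A) (h : IsShortExact i p) (l : ℕ) {n : ℤ} (z : C.X n)
    (hz : ∀ j : Fin r, (j : ℕ) < l → IsTors (f j : R) z) :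
    ∃ b : B.X n, p.app n b = z ∧ ∀ j : Fin r, (j : ℕ) < l → IsTors (f j : R) b := by
  induction l generalizing n z with
  | zero =>
    obtain ⟨b, hb⟩ := h.surj n z
    exact ⟨b, hb, by simp⟩
  | succ l ih =>
  rcases lt_or_ge l r with hl | hl
  swap
  · obtain ⟨b, hb, hb'⟩ := ih z fun j hj => hz j (by omega)
    exact ⟨b, hb, fun j _ => hb' j (by omega)⟩
  obtain ⟨t, ht⟩ := hz ⟨l, hl⟩ (Nat.lt_succ_self l)
  -- induction on the exponent `t` with `f_l ^ t z = 0`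
  induction t generalizing n z with
  | zero =>
    refine ⟨0, ?_, fun _ _ => IsTors.zero⟩
    rw [map_zero]
    exact (C.of_injective n (by simpa using ht)).symm
  | succ t iht =>
    obtain ⟨b, rfl, hb'⟩ := ih z fun j hj => hz j (by omega)
    obtain ⟨b₁, hb₁, hb₁'⟩ := iht (n := D + n) (C.act rfl (f ⟨l, hl⟩) (p.app n b))
      (fun j hj => (hz j hj).act _ _) (by rw [← C.smul_of, ← mul_smul, ← pow_succ, ht])
    obtain ⟨a, ha⟩ := (h.exact _ (B.act rfl (f ⟨l, hl⟩) b - b₁)).1 (by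
      rw [map_sub, hb₁, p.comm, sub_self])
    have ha' : ∀ j : Fin r, j < ⟨l, hl⟩ → IsTors (f j : R) a := fun j hj => by
      rw [← isTors_map_iff h.inj, ha]
      exact ((hb' j hj).act _ _).sub (hb₁' j (Nat.lt_succ_of_lt hj))
    obtain ⟨a', ha₁, ha₂⟩ := hA ⟨l, hl⟩ rfl a ha'
    refine ⟨b - i.app n a', ?_, fun j hj => ?_⟩
    · rw [map_sub, (h.exact n).apply_apply_eq_zero, sub_zero]
    · rcases Nat.lt_succ_iff_lt_or_eq.1 hj with hj | hj
      · exact (hb' j hj).sub ((ha₁ j hj).map i)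
      · obtain rfl : j = ⟨l, hl⟩ := Fin.ext hj
        refine IsTors.of_act (m := D + n) rfl (f ⟨l, hl⟩) ?_
        have e : B.act (m := n) (n := D + n) rfl (f ⟨l, hl⟩) (b - i.app n a') =
            b₁ + i.app _ (a - A.act rfl (f ⟨l, hl⟩) a') := by
          rw [map_sub, map_sub, ha, i.comm]
          abel
        rw [e]
        exact (hb₁' _ (Nat.lt_succ_self l)).add (ha₂.map i)

lemma exists_lift_all (hA : Acyclic f A) (h : IsShortExact i p) {n : ℤ} (z : C.X n)
    (hz : ∀ j : Fin r, IsTors (f j : R) z) :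
    ∃ b : B.X n, p.app n b = z ∧ ∀ j : Fin r, IsTors (f j : R) b := by
  obtain ⟨b, hb, hb'⟩ := hA.exists_lift h r z fun j _ => hz j
  exact ⟨b, hb, fun j => hb' j j.2⟩

/-- Quotients of acyclic modules by acyclic submodules are acyclic; this makes torsion exact on
long exact sequences of acyclic modules. -/
lemma coker (hA : Acyclic f A) (hB : Acyclic f B) (h : IsShortExact i p) : Acyclic f C := by
  intro l m n e z hz
  obtain ⟨b, rfl, hb⟩ := hA.exists_lift h l z fun j hj => hz j hj
  obtain ⟨y, hy, hy'⟩ := hB l e b fun j hj => hb j hj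
  exact ⟨p.app m y, fun j hj => (hy j hj).map p, by
    rw [← p.comm, ← map_sub]
    exact hy'.map p⟩

/-- Extensions of acyclic modules are acyclic. -/
lemma extension (hA : Acyclic f A) (hC : Acyclic f C) (h : IsShortExact i p) :
    Acyclic f B := by
  intro l m n e x hx
  obtain ⟨c, hc, hc'⟩ := hC l e (p.app n x) fun j hj => (hx j hj).map p
  obtain ⟨b, rfl, hb⟩ := hA.exists_lift h l c fun j hj => hc j hj
  obtain ⟨b₁, hb₁, hb₁'⟩ := hA.exists_lift h (l + 1) (p.app n x - C.act e (f l) (p.app m b))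
    fun j hj => by
      rcases Nat.lt_succ_iff_lt_or_eq.1 hj with hj | hj
      · exact ((hx j hj).map p).sub ((hc j hj).act _ _)
      · obtain rfl : j = l := Fin.ext hj
        exact hc'
  obtain ⟨a, ha⟩ := (h.exact n (x - B.act e (f l) b - b₁)).1 (by
    rw [map_sub, map_sub, hb₁, p.comm, sub_self])
  obtain ⟨a', ha₁, ha₂⟩ := hA l e a fun j hj => by
    rw [← isTors_map_iff h.inj, ha]
    exact ((hx j hj).sub ((hb j hj).act _ _)).sub (hb₁' j (Nat.lt_succ_of_lt hj))
  refine ⟨b + i.app m a', fun j hj => (hb j hj).add ((ha₁ j hj).map i), ?_⟩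
  have e' : x - B.act e (f l) (b + i.app m a') = b₁ + i.app n (a - A.act e (f l) a') := by
    rw [map_sub, ha, map_add, i.comm]
    abel
  rw [e']
  exact (hb₁' l (Nat.lt_succ_self _)).add (ha₂.map i)

end Acyclic

end Torsion

end GrMod

namespace GrMod

section Injectives

variable {k R : Type u} [Field k] [CommRing R] [Algebra k R]
variable {𝒜 : ℕ → Submodule k R} [GradedAlgebra 𝒜]

/-! ### Injective graded modules -/

/-- The shift `M(D)`, with `M(D)_n = M_{n + D}`. -/
def shift (M : GrMod 𝒜) (D : ℤ) : GrMod 𝒜 where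
  X n := M.X (n + D)
  act {i m n} h := M.act (m := m + D) (n := n + D) (by omega)
  one_act _ x := M.one_act _ x
  mul_act _ _ _ a b x := M.mul_act _ _ _ a b x

lemma act_comm (M : GrMod 𝒜) {i j : ℕ} {l m m' n : ℤ} (h₁ : (j : ℤ) + l = m)
    (h₂ : (i : ℤ) + m = n) (h₃ : (i : ℤ) + l = m') (h₄ : (j : ℤ) + m' = n) (r : 𝒜 i) (s : 𝒜 j)
    (x : M.X l) : M.act h₂ r (M.act h₁ s x) = M.act h₄ s (M.act h₃ r x) := by
  apply M.of_injective n
  rw [← M.smul_of, ← M.smul_of, ← M.smul_of, ← M.smul_of, smul_comm]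

/-- Multiplication by a form of degree `D`, as a homomorphism `M → M(D)`. -/
def mulHom (M : GrMod 𝒜) {D : ℕ} (f : 𝒜 D) : M ⟶ M.shift D where
  app n := M.act (m := n) (n := n + D) (by omega) f
  comm _ r x := M.act_comm _ _ _ _ f r x

/-- A form acting injectively on an injective graded module acts bijectively: multiplication
`C → C(D)` has a retraction `ρ`, and `x = f ρ(x)` since `ρ` kills `x - f ρ(x)` and therefore also
`f (x - f ρ(x))`, which lies in the image of `C`. -/
lemma act_bijective_of_injective (C : GrMod 𝒜) [Injective C] {D : ℕ} (f : 𝒜 D)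
    (hf : ∀ (n : ℤ) (x : C.X n), IsTors (f : R) x → x = 0) {m n : ℤ} (e : (D : ℤ) + m = n) :
    Function.Bijective (C.act e f) := by
  have hinj : ∀ {m n : ℤ} (e : (D : ℤ) + m = n), Function.Injective (C.act e f) := by
    intro m n e
    rw [injective_iff_map_eq_zero]
    exact fun x hx => hf m x (IsTors.of_act e f (hx ▸ IsTors.zero))
  refine ⟨hinj e, fun x => ?_⟩
  have := mono_of_injective (C.mulHom f) fun n => hinj _
  let ρ : C.shift D ⟶ C := Injective.factorThru (𝟙 C) (C.mulHom f)
  have hρ : ∀ n (x : C.X n), ρ.app n ((C.mulHom f).app n x) = x := fun n x =>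
    congrArg (fun q => Hom.app q n x) (Injective.comp_factorThru (𝟙 C) (C.mulHom f))
  have key : ∀ m (x : (C.shift D).X m), (C.mulHom f).app m (ρ.app m x) = x := by
    intro m x
    set w : (C.shift D).X m := x - (C.mulHom f).app m (ρ.app m x) with hw
    have h1 : ρ.app m w = 0 := by rw [hw, map_sub, hρ, sub_self]
    have h2 : ρ.app (m + D) ((C.mulHom f).app (m + D) (show C.X (m + D) from w)) =
        C.act (by omega) f (ρ.app m w) :=
      ρ.comm (n := m + D) (by omega) f w
    rw [h1, map_zero, hρ] at h2
    exact (sub_eq_zero.1 (hw.symm.trans h2)).symm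
  obtain rfl : n = m + D := by omega
  exact ⟨ρ.app m x, key m x⟩

lemma injective_of_retract {M N : GrMod 𝒜} [Injective N] (i : M ⟶ N) (p : N ⟶ M)
    (h : ∀ n x, p.app n (i.app n x) = x) : Injective M :=
  Retract.injective ⟨i, p, hom_ext h⟩

/-- The graded submodule of `f`-torsion elements. -/
def elemTorsion (f : R) (M : GrMod 𝒜) (n : ℤ) : Submodule k (M.X n) where
  carrier := {x | IsTors f x}
  zero_mem' := IsTors.zero
  add_mem' := IsTors.add
  smul_mem' c _ := IsTors.smul c

lemma elemTorsion_act (f : R) (M : GrMod 𝒜) {i : ℕ} {m n : ℤ} (h : (i : ℤ) + m = n) (r : 𝒜 i)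
    (x : M.X m) (hx : x ∈ elemTorsion f M m) : M.act h r x ∈ elemTorsion f M n :=
  IsTors.act h r hx

/-- In a Noetherian ring every element `z` of a module has a multiple `w = f ^ N • z` such that
the submodule generated by `w` has no `f`-torsion. -/
lemma exists_pow_smul_torsionFree [IsNoetherianRing R] {P : Type*} [AddCommGroup P] [Module R P]
    (f : R) (z : P) :
    ∃ N : ℕ, ∀ (r : R) (a : ℕ), f ^ a • r • f ^ N • z = 0 → r • f ^ N • z = 0 := by
  let K : ℕ →o Ideal R :=
    ⟨fun N => LinearMap.ker (LinearMap.toSpanSingleton R P (f ^ N • z)), fun N N' h r hr => by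
      rw [LinearMap.mem_ker, LinearMap.toSpanSingleton_apply] at hr ⊢
      obtain ⟨a, rfl⟩ := Nat.exists_eq_add_of_le h
      rw [add_comm, pow_add, mul_smul, smul_comm, hr, smul_zero]⟩
  obtain ⟨N, hN⟩ := monotone_stabilizes_iff_noetherian.2 ‹_› K
  refine ⟨N, fun r a h => ?_⟩
  have h' : r ∈ K (N + a) := by
    change LinearMap.toSpanSingleton R P (f ^ (N + a) • z) r = 0
    rw [LinearMap.toSpanSingleton_apply, add_comm, pow_add, mul_smul, smul_comm, h]
  rw [← hN _ (Nat.le_add_right N a)] at h'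
  exact h'

/-- The `f`-torsion of an injective graded module over a Noetherian ring is a direct summand. If `C`
is a graded submodule maximal with `C ∩ Γ_f(E) = 0`, then `E / C` is an essential extension of
`Γ_f(E)`, hence `f`-torsion, and the extension to `E / C` of the inclusion of `Γ_f(E)` in `E` takes
values in `Γ_f(E)`. -/
lemma exists_retraction_elemTorsion [IsNoetherianRing R] (E : GrMod 𝒜) [Injective E] {D : ℕ}
    (f : 𝒜 D) : ∃ ρ : E ⟶ subObj E (elemTorsion (f : R) E) (elemTorsion_act (f : R) E),
      ∀ n x, ρ.app n ((subι E _ (elemTorsion_act (f : R) E)).app n x) = x := by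
  let Γ := elemTorsion (f : R) E
  let 𝒮 : Set (∀ n, Submodule k (E.X n)) := {V |
    (∀ {i : ℕ} {m n : ℤ} (h : (i : ℤ) + m = n) (r : 𝒜 i) (x : E.X m),
      x ∈ V m → E.act h r x ∈ V n) ∧ ∀ n, ∀ x ∈ V n, x ∈ Γ n → x = 0}
  obtain ⟨C, hC⟩ : ∃ C, Maximal (· ∈ 𝒮) C := by
    refine zorn_le₀ 𝒮 fun c hc hchain => ?_
    rcases c.eq_empty_or_nonempty with rfl | hne
    · refine ⟨fun _ => ⊥, ⟨fun h r x hx => ?_, fun n x hx _ => by simpa using hx⟩, by simp⟩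
      rw [Submodule.mem_bot] at hx ⊢
      rw [hx, map_zero]
    have hmem : ∀ n x, x ∈ (⨆ V : c, V.1 n) ↔ ∃ V ∈ c, x ∈ V n := fun n x => by
      have := hne.to_subtype
      rw [Submodule.mem_iSup_of_directed _ fun V W => ?_]
      · simp
      · rcases hchain.total V.2 W.2 with h | h
        · exact ⟨W, h n, le_rfl⟩
        · exact ⟨V, le_rfl, h n⟩
    refine ⟨fun n => ⨆ V : c, V.1 n, ⟨fun {i m n} h r x hx => ?_, fun n x hx hx' => ?_⟩,
      fun V hV n => le_iSup (fun V : c => V.1 n) ⟨V, hV⟩⟩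
    · obtain ⟨V, hV, hx⟩ := (hmem m x).1 hx
      exact (hmem n _).2 ⟨V, hV, (hc hV).1 h r x hx⟩
    · obtain ⟨V, hV, hx⟩ := (hmem n x).1 hx
      exact (hc hV).2 n x hx hx'
  obtain ⟨⟨hCact, hCΓ⟩, hmax⟩ := hC
  let Q := quotObj E C hCact
  let π : E ⟶ Q := quotπ E C hCact
  have hπ : ∀ n x, π.app n x = 0 ↔ x ∈ C n := fun n x => Submodule.Quotient.mk_eq_zero _
  let ι := subι E Γ (elemTorsion_act (f : R) E)
  have : Mono (ι ≫ π) := mono_of_injective _ fun n => (injective_iff_map_eq_zero _).2 fun x hx =>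
    Subtype.ext (hCΓ n x.1 ((hπ n x.1).1 hx) x.2)
  -- the quotient by `C` is `f`-torsion
  have htors : ∀ n (z : Q.X n), IsTors (f : R) z := by
    intro n z
    obtain ⟨N, hN⟩ := exists_pow_smul_torsionFree (f : R) (Q.of n z)
    let fN : 𝒜 (N • D) := ⟨(f : R) ^ N, SetLike.pow_mem_graded N f.2⟩
    obtain ⟨w₀, hw₀⟩ : ∃ w₀ : ℤ, ((N • D : ℕ) : ℤ) + n = w₀ := ⟨_, rfl⟩
    obtain ⟨e, he⟩ := Submodule.mkQ_surjective _ (Q.act hw₀ fN z)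
    have hw : Q.of w₀ (π.app w₀ e) = (f : R) ^ N • Q.of n z := by
      rw [show (f : R) ^ N = (fN : R) from rfl, Q.smul_of hw₀]
      exact congrArg _ he
    -- `C` enlarged by the submodule generated by `e`
    let V : ∀ n, Submodule k (E.X n) := fun n =>
      { carrier := {x | ∃ c ∈ C n, ∃ r : R, E.of n x = E.of n c + r • E.of w₀ e}
        zero_mem' := ⟨0, zero_mem _, 0, by simp⟩
        add_mem' := by
          rintro x y ⟨c, hc, r, h⟩ ⟨c', hc', r', h'⟩
          exact ⟨c + c', add_mem hc hc', r + r', by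
            rw [map_add, map_add, h, h', add_smul]; abel⟩
        smul_mem' := by
          rintro a x ⟨c, hc, r, h⟩
          exact ⟨a • c, Submodule.smul_mem _ _ hc, a • r, by
            rw [map_smul, map_smul, h, smul_add, smul_assoc]⟩ }
    have hV : V ∈ 𝒮 := by
      refine ⟨?_, ?_⟩
      · rintro i m n h s x ⟨c, hc, r, hx⟩
        exact ⟨E.act h s c, hCact h s c hc, s * r, by
          rw [← E.smul_of h, hx, smul_add, E.smul_of h, mul_smul]⟩
      · rintro n x ⟨c, hc, r, hx⟩ ⟨a, ha⟩
        have h1 : Q.of n (π.app n x) = r • (f : R) ^ N • Q.of _ z := by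
          rw [← hw, ← totalMap_of, hx, map_add, totalMap_of, (hπ n c).2 hc, map_zero, zero_add,
            map_smul, totalMap_of]
        have h2 : r • (f : R) ^ N • Q.of _ z = 0 := hN r a (by
          rw [← h1, ← totalMap_of, ← map_smul, ha, map_zero])
        rw [h2] at h1
        refine hCΓ n x ((hπ n x).1 (Q.of_injective n (by rw [h1, map_zero]))) ⟨a, ha⟩
    have hle : V ≤ C := hmax hV fun n x hx => ⟨x, hx, 0, by simp⟩
    have he' : e ∈ C w₀ := hle w₀ ⟨0, zero_mem _, 1, by simp⟩
    exact ⟨N, by rw [← hw, (hπ _ _).2 he', map_zero]⟩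
  let ψ : Q ⟶ E := Injective.factorThru ι (ι ≫ π)
  have hψ : ∀ n (x : (subObj E Γ (elemTorsion_act (f : R) E)).X n),
      ψ.app n (π.app n (ι.app n x)) = ι.app n x := fun n x =>
    congrArg (fun q => Hom.app q n x) (Injective.comp_factorThru ι (ι ≫ π))
  have hψ' : ∀ n z, ψ.app n z ∈ LinearMap.range (ι.app n) := fun n z =>
    ⟨⟨ψ.app n z, (htors n z).map ψ⟩, rfl⟩
  refine ⟨π ≫ liftOfInjective ι (fun _ => Subtype.val_injective) ψ hψ', fun n x => ?_⟩
  refine Subtype.val_injective ?_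
  refine Eq.trans ?_ (hψ n x)
  exact congrArg (fun q : Q ⟶ E => Hom.app q n (π.app n (ι.app n x)))
    (liftOfInjective_comp ι (fun _ => Subtype.val_injective) ψ hψ')

/-- If a form acts bijectively on a split extension, then it does so on both summands. -/
lemma IsShortExact.act_bijective {A B C : GrMod 𝒜} {i : A ⟶ B} {p : B ⟶ C}
    (h : IsShortExact i p) (ρ : B ⟶ A) (hρ : ∀ n x, ρ.app n (i.app n x) = x) {D : ℕ} {f : 𝒜 D}
    (hf : ∀ {m n : ℤ} (e : (D : ℤ) + m = n), Function.Bijective (B.act e f)) {m n : ℤ}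
    (e : (D : ℤ) + m = n) :
    Function.Bijective (A.act e f) ∧ Function.Bijective (C.act e f) := by
  have hA : Function.Surjective (A.act e f) := fun a => by
    obtain ⟨b, hb⟩ := (hf e).2 (i.app n a)
    exact ⟨ρ.app m b, by rw [← ρ.comm, hb, hρ]⟩
  refine ⟨⟨fun a a' h' => h.inj m ((hf e).1 ?_), hA⟩, ?_, fun c => ?_⟩
  · rw [← i.comm, ← i.comm, h']
  · refine (injective_iff_map_eq_zero _).2 fun c hc => ?_
    obtain ⟨b, rfl⟩ := h.surj m c
    obtain ⟨a, ha⟩ := (h.exact n _).1 ((p.comm e f b).trans hc)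
    obtain ⟨a', rfl⟩ := hA a
    rw [i.comm] at ha
    rw [← (hf e).1 ha]
    exact (h.exact m).apply_apply_eq_zero a'
  · obtain ⟨b, rfl⟩ := h.surj n c
    obtain ⟨b, rfl⟩ := (hf e).2 b
    exact ⟨p.app m b, (p.comm e f b).symm⟩

/-- The quotient of a graded module by its `f`-torsion has no `f`-torsion. -/
lemma eq_zero_of_isTors_quot_elemTorsion (E : GrMod 𝒜) {D : ℕ} (f : 𝒜 D) {n : ℤ}
    (z : (quotObj E (elemTorsion (f : R) E) (elemTorsion_act (f : R) E)).X n)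
    (hz : IsTors (f : R) z) : z = 0 := by
  have hse := isShortExact_sub_quot E (elemTorsion (f : R) E) (elemTorsion_act (f : R) E)
  obtain ⟨x, rfl⟩ := hse.surj n z
  obtain ⟨t, ht⟩ := hz
  let ft : 𝒜 (t • D) := ⟨(f : R) ^ t, SetLike.pow_mem_graded t f.2⟩
  rw [show (f : R) ^ t = (ft : R) from rfl, smul_of _ rfl, ← Hom.comm] at ht
  obtain ⟨y, hy⟩ := (hse.exact _ _).1 (of_injective _ _ (ht.trans (map_zero _).symm))
  obtain ⟨s, hs⟩ := y.2
  refine (hse.exact n x).2 ⟨⟨x, s + t, ?_⟩, rfl⟩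
  rw [pow_add, mul_smul, show (f : R) ^ t = (ft : R) from rfl, smul_of _ rfl,
    ← hy]
  exact hs

/-- A property of graded modules stable under split extensions and valid for pure modules is valid
for injective modules: by `exists_retraction_elemTorsion`, an injective module is the direct sum of
two injective modules such that `f₁` is locally nilpotent on one and bijective on the other, and so
on for `f₂, …, f_r`. -/
lemma injective_induction [IsNoetherianRing R] {D r : ℕ} (f : Fin r → 𝒜 D)
    {P : GrMod 𝒜 → Prop} (pure : ∀ X, Pure f X → P X)
    (extension : ∀ {A B C : GrMod 𝒜} (i : A ⟶ B) (p : B ⟶ C) (ρ : B ⟶ A), IsShortExact i p →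
      (∀ n x, ρ.app n (i.app n x) = x) → P A → P C → P B)
    (E : GrMod 𝒜) [Injective E] : P E := by
  induction r generalizing P E with
  | zero => exact pure E fun i => i.elim0
  | succ r ih =>
  have hP : ∀ (E : GrMod 𝒜) [Injective E], ((∀ {m n : ℤ} (e : (D : ℤ) + m = n),
      Function.Bijective (E.act e (f 0))) ∨ ∀ (n : ℤ) (x : E.X n), IsTors (f 0 : R) x) → P E := by
    intro E _
    refine ih (fun i => f i.succ) (P := fun X => ((∀ {m n : ℤ} (e : (D : ℤ) + m = n),
      Function.Bijective (X.act e (f 0))) ∨ ∀ (n : ℤ) (x : X.X n), IsTors (f 0 : R) x) → P X)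
      (fun X hX h0 => pure X fun i => Fin.cases h0 hX i)
      (fun {A B C} i p ρ h hρ hA hC hB => extension i p ρ h hρ (hA ?_) (hC ?_)) E
    · rcases hB with hB | hB
      · exact .inl fun e => (h.act_bijective ρ hρ hB e).1
      · exact .inr fun n x => (isTors_map_iff h.inj).1 (hB n _)
    · rcases hB with hB | hB
      · exact .inl fun e => (h.act_bijective ρ hρ hB e).2
      · refine .inr fun n x => ?_
        obtain ⟨b, rfl⟩ := h.surj n x
        exact (hB n b).map p
  obtain ⟨ρ, hρ⟩ := exists_retraction_elemTorsion E (f 0)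
  let ι := subι E (elemTorsion (f 0 : R) E) (elemTorsion_act (f 0 : R) E)
  let π := quotπ E (elemTorsion (f 0 : R) E) (elemTorsion_act (f 0 : R) E)
  have hse : IsShortExact ι π := isShortExact_sub_quot _ _ _
  have : Injective (subObj E (elemTorsion (f 0 : R) E) (elemTorsion_act (f 0 : R) E)) :=
    injective_of_retract ι ρ hρ
  let σ := descOfSurjective π hse.surj (𝟙 E - ρ ≫ ι) fun n x hx => by
    obtain ⟨y, rfl⟩ := (hse.exact n x).1 hx
    rw [LinearMap.mem_ker, sub_eq_add_neg, add_app, neg_app, comp_app, hρ n y]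
    exact add_neg_cancel _
  have hσ : π ≫ σ = 𝟙 E - ρ ≫ ι := comp_descOfSurjective π hse.surj _ _
  have : Injective (quotObj E (elemTorsion (f 0 : R) E) (elemTorsion_act (f 0 : R) E)) := by
    refine injective_of_retract σ π fun n z => ?_
    obtain ⟨x, rfl⟩ := hse.surj n z
    have h1 := congrArg (fun q => Hom.app q n x) hσ
    simp only [comp_app] at h1
    rw [h1, sub_eq_add_neg, add_app, neg_app, map_add, map_neg, comp_app,
      (hse.exact n).apply_apply_eq_zero]
    simp
  exact extension ι π ρ hse hρ (hP _ (.inr fun n x => (isTors_sub_val _ _).2 x.2))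
    (hP _ (.inl fun e => act_bijective_of_injective _ (f 0)
      (fun n z hz => eq_zero_of_isTors_quot_elemTorsion E (f 0) z hz) e))

lemma acyclic_of_injective [IsNoetherianRing R] {D r : ℕ} (f : Fin r → 𝒜 D) (E : GrMod 𝒜)
    [Injective E] : Acyclic f E :=
  injective_induction f (fun _ hX => hX.acyclic) (fun _ _ _ h _ hA hC => hA.extension hC h) E

end Injectives

end GrMod

namespace GrMod

section Complexes

variable {k R : Type u} [Field k] [CommRing R] [Algebra k R]
variable {𝒜 : ℕ → Submodule k R} [GradedAlgebra 𝒜]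

/-! ### Isomorphisms, homology and exactness in terms of elements -/

/-- A homomorphism with values in a graded submodule, as a homomorphism to that submodule. -/
def subLift {Y M : GrMod 𝒜} (f : Y ⟶ M) (V : ∀ n, Submodule k (M.X n))
    (hV : ∀ {i : ℕ} {m n : ℤ} (h : (i : ℤ) + m = n) (r : 𝒜 i) (x : M.X m),
      x ∈ V m → M.act h r x ∈ V n) (hf : ∀ n y, f.app n y ∈ V n) : Y ⟶ subObj M V hV where
  app n := (f.app n).codRestrict (V n) (hf n)
  comm h r y := Subtype.ext (f.comm h r y)

lemma quotπ_eq_zero {M : GrMod 𝒜} {V : ∀ n, Submodule k (M.X n)}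
    {hV : ∀ {i : ℕ} {m n : ℤ} (h : (i : ℤ) + m = n) (r : 𝒜 i) (x : M.X m),
      x ∈ V m → M.act h r x ∈ V n} {n : ℤ} {x : M.X n} :
    (quotπ M V hV).app n x = 0 ↔ x ∈ V n :=
  Submodule.Quotient.mk_eq_zero _

lemma quotπ_surjective {M : GrMod 𝒜} {V : ∀ n, Submodule k (M.X n)}
    {hV : ∀ {i : ℕ} {m n : ℤ} (h : (i : ℤ) + m = n) (r : 𝒜 i) (x : M.X m),
      x ∈ V m → M.act h r x ∈ V n} (n : ℤ) : Function.Surjective ((quotπ M V hV).app n) :=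
  Submodule.mkQ_surjective _

/-- Two quotients of the same graded module with the same kernel are isomorphic. -/
def isoOfSurjective {Y A B : GrMod 𝒜} (u : Y ⟶ A) (v : Y ⟶ B)
    (hu : ∀ n, Function.Surjective (u.app n)) (hv : ∀ n, Function.Surjective (v.app n))
    (h : ∀ n, LinearMap.ker (u.app n) = LinearMap.ker (v.app n)) : A ≅ B where
  hom := descOfSurjective u hu v fun n => (h n).le
  inv := descOfSurjective v hv u fun n => (h n).ge
  hom_inv_id := by
    have := epi_of_surjective u hu
    rw [← cancel_epi u, ← Category.assoc, comp_descOfSurjective, comp_descOfSurjective,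
      Category.comp_id]
  inv_hom_id := by
    have := epi_of_surjective v hv
    rw [← cancel_epi v, ← Category.assoc, comp_descOfSurjective, comp_descOfSurjective,
      Category.comp_id]

/-- A degreewise bijective homomorphism is an isomorphism. -/
def isoOfBijective {A B : GrMod 𝒜} (v : A ⟶ B) (hv : ∀ n, Function.Bijective (v.app n)) : A ≅ B :=
  isoOfSurjective (𝟙 A) v (fun _ x => ⟨x, rfl⟩) (fun n => (hv n).2) fun n =>
    LinearMap.ker_id.trans (LinearMap.ker_eq_bot.2 (hv n).1).symm

/-- Kernels modulo images compute the homology of a short complex of graded modules. -/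
def leftHomologyData (S : ShortComplex (GrMod 𝒜)) (B : ∀ n, Submodule k (S.X₂.X n))
    (hB : ∀ n, B n = LinearMap.range (S.f.app n)) : S.LeftHomologyData :=
  let i := subι S.X₂ (fun n => LinearMap.ker (S.g.app n)) (ker_act S.g)
  let hi := isKernel i S.g (subι_ker_comp S.g) (fun _ => Subtype.val_injective)
    (fun _ x hx => ⟨⟨x, hx⟩, rfl⟩)
  let f' : S.X₁ ⟶ subObj S.X₂ (fun n => LinearMap.ker (S.g.app n)) (ker_act S.g) :=
    subLift S.f _ _ fun n y => congrArg (fun q => Hom.app q n y) S.zero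
  have hf : hi.lift (KernelFork.ofι S.f S.zero) = f' :=
    Fork.IsLimit.hom_ext hi (Fork.IsLimit.lift_ι hi)
  have hVB : ∀ {j : ℕ} {m n : ℤ} (h : (j : ℤ) + m = n) (r : 𝒜 j)
      (x : (subObj S.X₂ (fun n => LinearMap.ker (S.g.app n)) (ker_act S.g)).X m),
      x ∈ (B m).comap (i.app m) →
      (subObj S.X₂ _ (ker_act S.g)).act h r x ∈ (B n).comap (i.app n) :=
    fun {j m n} h r x hx => by
      refine Submodule.mem_comap.2 ?_
      rw [hB, i.comm]
      exact range_act S.f h r _ (hB m ▸ hx)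
  let π := quotπ (subObj S.X₂ (fun n => LinearMap.ker (S.g.app n)) (ker_act S.g))
    (fun n => (B n).comap (i.app n)) hVB
  have w : f' ≫ π = 0 := hom_ext fun n x =>
    (Submodule.Quotient.mk_eq_zero _).2 (Submodule.mem_comap.2 (hB n ▸ ⟨x, rfl⟩))
  { K := subObj S.X₂ (fun n => LinearMap.ker (S.g.app n)) (ker_act S.g)
    H := quotObj _ (fun n => (B n).comap (i.app n)) hVB
    i := i
    π := π
    wi := subι_ker_comp S.g
    hi := hi
    wπ := (congrArg (· ≫ π) hf).trans w
    hπ := by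
      refine isCokernel _ _ _ (fun n => Submodule.mkQ_surjective _) fun n y hy => ?_
      have hy₀ := quotπ_eq_zero.1 hy
      have hy' : i.app n y ∈ B n := Submodule.mem_comap.1 hy₀
      rw [hB] at hy'
      obtain ⟨x, hx⟩ := hy'
      exact ⟨x, (congrArg (fun q => Hom.app q n x) hf).trans (Subtype.ext hx)⟩ }

/-- Exactness can be checked on elements. -/
lemma exact_iff (S : ShortComplex (GrMod 𝒜)) :
    S.Exact ↔ ∀ n x, S.g.app n x = 0 → ∃ y, S.f.app n y = x := by
  rw [(leftHomologyData S _ fun _ => rfl).exact_iff, IsZero.iff_id_eq_zero]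
  constructor
  · intro h n x hx
    exact (Submodule.Quotient.mk_eq_zero _).1 (congrArg (fun q => Hom.app q n
      (Submodule.Quotient.mk (⟨x, hx⟩ : LinearMap.ker (S.g.app n)))) h)
  · intro h
    refine hom_ext fun n z => ?_
    obtain ⟨x, rfl⟩ := Submodule.mkQ_surjective _ z
    exact (Submodule.Quotient.mk_eq_zero _).2 (h n x.1 x.2)

/-! ### Complexes of graded modules -/

/-- A cochain complex of graded modules in degrees `≥ 0`. -/
structure GrComplex (𝒜 : ℕ → Submodule k R) [GradedAlgebra 𝒜] where
  /-- the terms -/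
  X : ℕ → GrMod 𝒜
  /-- the differentials -/
  d : ∀ q, X q ⟶ X (q + 1)
  d_d : ∀ q n x, (d (q + 1)).app n ((d q).app n x) = 0

namespace GrComplex

/-- The cocycles in cohomological degree `q`. -/
def cocycles (C : GrComplex 𝒜) (q : ℕ) : GrMod 𝒜 :=
  subObj (C.X q) (fun n => LinearMap.ker ((C.d q).app n)) (ker_act (C.d q))

/-- The coboundaries in cohomological degree `q`. -/
def boundaries (C : GrComplex 𝒜) : ∀ (q : ℕ) (n : ℤ), Submodule k ((C.X q).X n)
  | 0, _ => ⊥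
  | q + 1, n => LinearMap.range ((C.d q).app n)

lemma boundaries_act (C : GrComplex 𝒜) (q : ℕ) {i : ℕ} {m n : ℤ} (h : (i : ℤ) + m = n) (r : 𝒜 i)
    (x : (C.X q).X m) (hx : x ∈ C.boundaries q m) : (C.X q).act h r x ∈ C.boundaries q n := by
  cases q with
  | zero =>
    obtain rfl : x = 0 := hx
    rw [map_zero]
    exact zero_mem _
  | succ q => exact range_act (C.d q) h r x hx

/-- The inclusion of the cocycles. -/
def cocyclesι (C : GrComplex 𝒜) (q : ℕ) : C.cocycles q ⟶ C.X q := subι _ _ (ker_act (C.d q))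

lemma comap_boundaries_act (C : GrComplex 𝒜) (q : ℕ) {i : ℕ} {m n : ℤ} (h : (i : ℤ) + m = n)
    (r : 𝒜 i) (x : (C.cocycles q).X m) (hx : x ∈ (C.boundaries q m).comap ((C.cocyclesι q).app m)) :
    (C.cocycles q).act h r x ∈ (C.boundaries q n).comap ((C.cocyclesι q).app n) :=
  Submodule.mem_comap.2 (by
    rw [Hom.comm]
    exact C.boundaries_act q h r _ hx)

/-- The cohomology in degree `q`. -/
def coh (C : GrComplex 𝒜) (q : ℕ) : GrMod 𝒜 :=
  quotObj (C.cocycles q) (fun n => (C.boundaries q n).comap ((C.cocyclesι q).app n))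
    (C.comap_boundaries_act q)

/-- The class of a cocycle. -/
def cohπ (C : GrComplex 𝒜) (q : ℕ) : C.cocycles q ⟶ C.coh q :=
  quotπ _ _ (C.comap_boundaries_act q)

lemma cohπ_surjective (C : GrComplex 𝒜) (q : ℕ) (n : ℤ) : Function.Surjective ((C.cohπ q).app n) :=
  quotπ_surjective n

lemma cohπ_eq_zero (C : GrComplex 𝒜) {q : ℕ} {n : ℤ} {x : (C.cocycles q).X n} :
    (C.cohπ q).app n x = 0 ↔ x.1 ∈ C.boundaries q n :=
  quotπ_eq_zero

lemma cohπ_eq (C : GrComplex 𝒜) {q : ℕ} {n : ℤ} {x y : (C.cocycles q).X n}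
    (h : (C.cocyclesι q).app n x - (C.cocyclesι q).app n y ∈ C.boundaries q n) :
    (C.cohπ q).app n x = (C.cohπ q).app n y := by
  rw [← sub_eq_zero, ← map_sub]
  exact C.cohπ_eq_zero.2 h

/-- A homomorphism with values in cocycles. -/
def cocyclesLift (C : GrComplex 𝒜) {q : ℕ} {Y : GrMod 𝒜} (g : Y ⟶ C.X q)
    (hg : ∀ n y, (C.d q).app n (g.app n y) = 0) : Y ⟶ C.cocycles q :=
  subLift g _ (ker_act (C.d q)) hg

/-- A complex in the sense of `CochainComplex` as a complex of graded modules. -/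
def ofCochainComplex (K : CochainComplex (GrMod 𝒜) ℕ) : GrComplex 𝒜 where
  X := K.X
  d q := K.d q (q + 1)
  d_d q n x := congrArg (fun f => Hom.app f n x) (K.d_comp_d q (q + 1) (q + 2))

/-- The two notions of cohomology agree. -/
def homologyIso (K : CochainComplex (GrMod 𝒜) ℕ) (q : ℕ) :
    K.homology q ≅ (ofCochainComplex K).coh q :=
  have hp : (ComplexShape.up ℕ).prev q = q - 1 := by cases q <;> simp
  have hB : ∀ n, (ofCochainComplex K).boundaries q n =
      LinearMap.range ((K.sc' (q - 1) q (q + 1)).f.app n) := fun n => by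
    cases q with
    | zero =>
      change ⊥ = LinearMap.range ((K.d 0 0).app n)
      rw [K.shape 0 0 (by simp)]
      exact LinearMap.range_zero.symm
    | succ q => rfl
  ShortComplex.homologyMapIso (K.isoSc' (q - 1) q (q + 1) hp (by simp)) ≪≫
    (leftHomologyData (K.sc' (q - 1) q (q + 1)) _ hB).homologyIso

/-- The subcomplex of `I`-torsion elements. -/
def torsionComplex (I : Ideal R) (C : GrComplex 𝒜) : GrComplex 𝒜 where
  X q := (torsionFunctor 𝒜 I).obj (C.X q)
  d q := (torsionFunctor 𝒜 I).map (C.d q)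
  d_d q n x := Subtype.ext (C.d_d q n x.1)

/-- `η` makes `C` a right resolution of `X`. -/
structure IsResolution {X : GrMod 𝒜} (C : GrComplex 𝒜) (η : X ⟶ C.X 0) : Prop where
  inj : ∀ n, Function.Injective (η.app n)
  exact_zero : ∀ n, Function.Exact (η.app n) ((C.d 0).app n)
  exact_succ : ∀ q n, Function.Exact ((C.d q).app n) ((C.d (q + 1)).app n)

end GrComplex

open GrComplex

/-- The augmentation of an injective resolution. -/
def resolutionι {X : GrMod 𝒜} (G : InjectiveResolution X) : X ⟶ G.cocomplex.X 0 := G.ι.f 0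

lemma isResolution_of_injectiveResolution {X : GrMod 𝒜} (G : InjectiveResolution X) :
    IsResolution (ofCochainComplex G.cocomplex) (resolutionι G) where
  inj n := by
    have : Mono (resolutionι G) := inferInstanceAs (Mono (G.ι.f 0))
    exact injective_of_mono (resolutionι G) n
  exact_zero n x := ⟨(exact_iff _).1 G.exact₀ n x, by
    rintro ⟨y, rfl⟩
    exact congrArg (fun f => Hom.app f n y) G.ι_f_zero_comp_complex_d⟩
  exact_succ q n x := ⟨(exact_iff _).1 (G.exact_succ q) n x, by
    rintro ⟨y, rfl⟩
    exact (ofCochainComplex G.cocomplex).d_d q n y⟩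

/-- Local cohomology computed by an injective resolution. -/
def localCohomologyIso (I : Ideal R) (q : ℕ) {X : GrMod 𝒜} (G : InjectiveResolution X) :
    localCohomology I q X ≅ (torsionComplex I (ofCochainComplex G.cocomplex)).coh q :=
  G.isoRightDerivedObj (torsionFunctor 𝒜 I) q ≪≫
    homologyIso (((torsionFunctor 𝒜 I).mapHomologicalComplex _).obj G.cocomplex) q

/-! ### Acyclic resolutions compute local cohomology -/

/-- `f₁, …, f_r` detect `I`-torsion: an element is `I`-torsion if and only if it is torsion for
each `f_i`. -/
def Detects {D r : ℕ} (f : Fin r → 𝒜 D) (I : Ideal R) : Prop :=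
  ∀ (M : GrMod 𝒜) (n : ℤ) (x : M.X n), x ∈ torsion I M n ↔ ∀ j, IsTors (f j : R) x

variable {D r : ℕ} {f : Fin r → 𝒜 D} {I : Ideal R}

lemma exists_extension_injective {A B C J : GrMod 𝒜} [Injective J] (a : A ⟶ B) (b : B ⟶ C)
    (h : ∀ n, Function.Exact (a.app n) (b.app n)) (g : B ⟶ J) (hg : a ≫ g = 0) :
    ∃ g' : C ⟶ J, b ≫ g' = g := by
  have hS : (ShortComplex.mk a b (hom_ext fun n x => (h n).apply_apply_eq_zero x)).Exact :=
    (exact_iff _).2 fun n x hx => (h n x).1 hx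
  exact ⟨hS.descToInjective g hg, hS.comp_descToInjective g hg⟩

/-- A resolution maps to any complex of injectives with the same augmentation. -/
lemma exists_comparison {X : GrMod 𝒜} {T G : GrComplex 𝒜} {η : X ⟶ T.X 0} {η' : X ⟶ G.X 0}
    (hT : T.IsResolution η) (hG : η' ≫ G.d 0 = 0) [∀ q, Injective (G.X q)] :
    ∃ φ : ∀ q, T.X q ⟶ G.X q, η ≫ φ 0 = η' ∧ ∀ q, T.d q ≫ φ (q + 1) = φ q ≫ G.d q := by
  have hη := mono_of_injective η hT.inj
  have hGd : ∀ q, G.d q ≫ G.d (q + 1) = 0 := fun q => hom_ext fun n x => G.d_d q n x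
  obtain ⟨φ₁, hφ₁⟩ := exists_extension_injective η (T.d 0) hT.exact_zero
    (Injective.factorThru η' η ≫ G.d 0) (by rw [← Category.assoc, Injective.comp_factorThru, hG])
  have step : ∀ q (p : {p : (T.X q ⟶ G.X q) × (T.X (q + 1) ⟶ G.X (q + 1)) //
      T.d q ≫ p.2 = p.1 ≫ G.d q}), ∃ g : T.X (q + 2) ⟶ G.X (q + 2),
      T.d (q + 1) ≫ g = p.1.2 ≫ G.d (q + 1) := fun q p =>
    exists_extension_injective (T.d q) (T.d (q + 1)) (hT.exact_succ q) (p.1.2 ≫ G.d (q + 1))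
      (by rw [← Category.assoc, p.2, Category.assoc, hGd, comp_zero])
  choose g hg using step
  let s : ∀ q, {p : (T.X q ⟶ G.X q) × (T.X (q + 1) ⟶ G.X (q + 1)) //
      T.d q ≫ p.2 = p.1 ≫ G.d q} := fun q => Nat.rec ⟨(Injective.factorThru η' η, φ₁), hφ₁⟩
    (fun q p => ⟨(p.1.2, g q p), hg q p⟩) q
  exact ⟨fun q => (s q).1.1, Injective.comp_factorThru η' η, fun q => (s q).2⟩

lemma isShortExact_prod (M N : GrMod 𝒜) :
    ∃ (i : M ⟶ prodObj M N) (p : prodObj M N ⟶ N), IsShortExact i p :=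
  ⟨⟨fun _ => LinearMap.inl k _ _, fun h r _ => Prod.ext rfl (map_zero (N.act h r)).symm⟩,
    ⟨fun _ => LinearMap.snd k _ _, fun _ _ _ => rfl⟩,
    fun _ => LinearMap.inl_injective, fun _ => .inl_snd, fun _ => LinearMap.snd_surjective⟩

lemma isTors_prod {g : R} {M N : GrMod 𝒜} {n : ℤ} {x : (prodObj M N).X n} :
    IsTors g x ↔ IsTors g (show M.X n from x.1) ∧ IsTors g (show N.X n from x.2) := by
  let i₁ : M ⟶ prodObj M N :=
    ⟨fun n => LinearMap.inl k _ _, fun h r x => Prod.ext rfl (map_zero (N.act h r)).symm⟩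
  let i₂ : N ⟶ prodObj M N :=
    ⟨fun n => LinearMap.inr k _ _, fun h r x => Prod.ext (map_zero (M.act h r)).symm rfl⟩
  let p₁ : prodObj M N ⟶ M := ⟨fun n => LinearMap.fst k _ _, fun _ _ _ => rfl⟩
  let p₂ : prodObj M N ⟶ N := ⟨fun n => LinearMap.snd k _ _, fun _ _ _ => rfl⟩
  refine ⟨fun h => ⟨h.map p₁, h.map p₂⟩, fun ⟨h₁, h₂⟩ => ?_⟩
  have e : x = i₁.app n x.1 + i₂.app n x.2 :=
    Prod.ext (add_zero x.1).symm (zero_add x.2).symm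
  rw [e]
  exact (h₁.map i₁).add (h₂.map i₂)

/-- Taking torsion preserves exactness of an exact complex of acyclic modules: inductively the
cocycles are acyclic, so torsion cocycles lift to torsion elements. -/
lemma exists_torsion_primitive {C : GrComplex 𝒜} (hC : ∀ q, Acyclic f (C.X q))
    (h0 : ∀ n, Function.Injective ((C.d 0).app n))
    (hex : ∀ q n, Function.Exact ((C.d q).app n) ((C.d (q + 1)).app n)) (q : ℕ) {n : ℤ}
    (z : (C.X (q + 1)).X n) (hdz : (C.d (q + 1)).app n z = 0) (hz : ∀ j, IsTors (f j : R) z) :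
    ∃ w : (C.X q).X n, (∀ j, IsTors (f j : R) w) ∧ (C.d q).app n w = z := by
  have hse : ∀ q, IsShortExact (subι (C.X q) (fun n => LinearMap.ker ((C.d q).app n))
      (ker_act (C.d q))) (subLift (C.d q) (fun n => LinearMap.ker ((C.d (q + 1)).app n))
      (ker_act (C.d (q + 1))) fun n x => C.d_d q n x) := fun q =>
    { inj := fun n => Subtype.val_injective
      exact := fun n x => ⟨fun hx => ⟨⟨x, congrArg Subtype.val hx⟩, rfl⟩,
        fun ⟨y, hy⟩ => hy ▸ Subtype.ext y.2⟩
      surj := fun n y => by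
        obtain ⟨x, hx⟩ := (hex q n y.1).1 y.2
        exact ⟨x, Subtype.ext hx⟩ }
  have hker : ∀ q, Acyclic f (C.cocycles q) := by
    intro q
    induction q with
    | zero =>
      have hz : ∀ n (x : (C.cocycles 0).X n), x = 0 := fun n x =>
        Subtype.ext (h0 n (x.2.trans (map_zero _).symm))
      exact fun i m n e x _ => ⟨0, fun _ _ => IsTors.zero, by
        rw [hz n x, map_zero, sub_zero]; exact IsTors.zero⟩
    | succ q ih => exact ih.coker (hC q) (hse q)
  obtain ⟨w, hw, hw'⟩ := (hker q).exists_lift_all (hse q) ⟨z, hdz⟩ fun j =>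
    (isTors_sub_val _ _).2 (hz j)
  exact ⟨w, hw', congrArg Subtype.val hw⟩

/-- The mapping cone of a morphism of complexes, shifted so as to start in degree `0`. -/
def coneComplex {T G : GrComplex 𝒜} (φ : ∀ q, T.X q ⟶ G.X q)
    (hφ : ∀ q n x, (φ (q + 1)).app n ((T.d q).app n x) = (G.d q).app n ((φ q).app n x)) :
    GrComplex 𝒜 where
  X
    | 0 => T.X 0
    | q + 1 => prodObj (T.X (q + 1)) (G.X q)
  d
    | 0 => ⟨fun n => ((T.d 0).app n).prod ((φ 0).app n), fun h r x =>
        Prod.ext ((T.d 0).comm h r x) ((φ 0).comm h r x)⟩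
    | q + 1 => ⟨fun n => ((T.d (q + 1)).app n ∘ₗ LinearMap.fst k _ _).prod
        ((φ (q + 1)).app n ∘ₗ LinearMap.fst k _ _ - (G.d q).app n ∘ₗ LinearMap.snd k _ _),
        fun h r x => Prod.ext ((T.d (q + 1)).comm h r x.1) (by
          change (φ (q + 1)).app _ ((T.X (q + 1)).act h r x.1) -
            (G.d q).app _ ((G.X q).act h r x.2) =
            (G.X (q + 1)).act h r ((φ (q + 1)).app _ x.1 - (G.d q).app _ x.2)
          rw [(φ (q + 1)).comm, (G.d q).comm, map_sub])⟩
  d_d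
    | 0, n, x => Prod.ext (T.d_d 0 n x) (sub_eq_zero.2 (hφ 0 n x))
    | q + 1, n, x => Prod.ext (T.d_d (q + 1) n x.1) (by
        change (φ (q + 2)).app n ((T.d (q + 1)).app n x.1) -
          (G.d (q + 1)).app n ((φ (q + 1)).app n x.1 - (G.d q).app n x.2) = 0
        rw [hφ, map_sub, G.d_d, sub_zero, sub_self])

/-- Two resolutions of the same module by acyclic modules have isomorphic torsion cohomology, when
the second consists of injective modules: a comparison map exists, and its mapping cone is an exact
complex of acyclic modules, which remains exact after taking torsion. -/
lemma nonempty_torsion_coh_iso (hf : Detects f I) {X : GrMod 𝒜} {T G : GrComplex 𝒜}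
    {η : X ⟶ T.X 0} {η' : X ⟶ G.X 0} (hT : T.IsResolution η) (hG : G.IsResolution η')
    (haT : ∀ q, Acyclic f (T.X q)) (haG : ∀ q, Acyclic f (G.X q)) [∀ q, Injective (G.X q)]
    (q : ℕ) : Nonempty ((torsionComplex I T).coh q ≅ (torsionComplex I G).coh q) := by
  obtain ⟨φ, hφη, hφ⟩ := exists_comparison (η' := η') hT
    (hom_ext fun n x => (hG.exact_zero n).apply_apply_eq_zero x)
  replace hφη : ∀ n x, (φ 0).app n (η.app n x) = η'.app n x := fun n x =>
    congrArg (fun g => Hom.app g n x) hφη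
  replace hφ : ∀ q n x, (φ (q + 1)).app n ((T.d q).app n x) = (G.d q).app n ((φ q).app n x) :=
    fun q n x => congrArg (fun g => Hom.app g n x) (hφ q)
  let C := coneComplex φ hφ
  have hC : ∀ q, Acyclic f (C.X q) := by
    rintro (_ | q)
    · exact haT 0
    · obtain ⟨i, p, h⟩ := isShortExact_prod (T.X (q + 1)) (G.X q)
      exact (haT (q + 1)).extension (haG q) h
  have h0 : ∀ n, Function.Injective ((C.d 0).app n) := fun n =>
    (injective_iff_map_eq_zero _).2 fun t ht => by
      obtain ⟨x, rfl⟩ := (hT.exact_zero n t).1 (congrArg Prod.fst ht)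
      have h : (φ 0).app n (η.app n x) = 0 := congrArg Prod.snd ht
      rw [hφη] at h
      rw [hG.inj n (h.trans (map_zero _).symm)]
      exact map_zero _
  have hex : ∀ q n, Function.Exact ((C.d q).app n) ((C.d (q + 1)).app n) := by
    intro q n z
    refine ⟨fun hz => ?_, by rintro ⟨y, rfl⟩; exact C.d_d q n y⟩
    obtain ⟨t, g⟩ := z
    have hz₁ : (T.d (q + 1)).app n t = 0 := congrArg Prod.fst hz
    have hz₂ : (φ (q + 1)).app n t = (G.d q).app n g := sub_eq_zero.1 (congrArg Prod.snd hz)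
    obtain ⟨t, rfl⟩ := (hT.exact_succ q n t).1 hz₁
    rw [hφ, ← sub_eq_zero, ← map_sub] at hz₂
    cases q with
    | zero =>
      obtain ⟨x, hx⟩ := (hG.exact_zero n _).1 hz₂
      refine ⟨t - η.app n x, Prod.ext ?_ ?_⟩
      · change (T.d 0).app n (t - η.app n x) = (T.d 0).app n t
        rw [map_sub, (hT.exact_zero n).apply_apply_eq_zero, sub_zero]
      · change (φ 0).app n (t - η.app n x) = g
        rw [map_sub, hφη, hx, sub_sub_cancel]
    | succ q =>
      obtain ⟨g', hg'⟩ := (hG.exact_succ q n _).1 hz₂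
      refine ⟨(t, g'), Prod.ext rfl ?_⟩
      change (φ (q + 1)).app n t - (G.d q).app n g' = g
      rw [hg', sub_sub_cancel]
  have key := fun q {n} => exists_torsion_primitive hC h0 hex q (n := n)
  have htors : ∀ {M : GrMod 𝒜} {n : ℤ} (x : ((torsionFunctor 𝒜 I).obj M).X n) j,
      IsTors (f j : R) (show M.X n from x.1) := fun x => (hf _ _ _).1 x.2
  let v₀ : (torsionComplex I T).cocycles q ⟶ (torsionComplex I G).cocycles q :=
    cocyclesLift _ (cocyclesι _ q ≫ (torsionFunctor 𝒜 I).map (φ q)) fun n x => by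
      refine Subtype.ext ((hφ q n x.1.1).symm.trans ?_)
      rw [show (T.d q).app n x.1.1 = 0 from congrArg Subtype.val x.2, map_zero]
      rfl
  refine ⟨isoOfSurjective ((torsionComplex I T).cohπ q) (v₀ ≫ (torsionComplex I G).cohπ q)
    (cohπ_surjective _ _) (fun n z => ?_) fun n => Submodule.ext fun y => ?_⟩
  · obtain ⟨⟨⟨g, hg⟩, hdg⟩, rfl⟩ := cohπ_surjective _ _ _ z
    replace hdg : (G.d q).app n g = 0 := congrArg Subtype.val hdg
    obtain ⟨w, hw, hdw⟩ := key q (n := n) ((0, g) : (T.X (q + 1)).X n × (G.X q).X n)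
      (Prod.ext (map_zero ((T.d (q + 1)).app n)) (by
        change (φ (q + 1)).app n 0 - (G.d q).app n g = 0
        rw [hdg, map_zero, sub_zero]))
      fun j => isTors_prod.2 ⟨IsTors.zero, (hf _ _ _).1 hg j⟩
    have hw₁ := congrArg Prod.fst hdw
    have hw₂ := congrArg Prod.snd hdw
    cases q with
    | zero =>
      refine ⟨⟨⟨w, (hf _ _ _).2 hw⟩, Subtype.ext hw₁⟩, cohπ_eq _ (Subtype.ext ?_)⟩
      exact sub_eq_zero.2 hw₂
    | succ q =>
      obtain ⟨t, g'⟩ := w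
      refine ⟨⟨⟨t, (hf _ _ _).2 fun j => (isTors_prod.1 (hw j)).1⟩, Subtype.ext hw₁⟩,
        cohπ_eq _ ⟨⟨g', (hf _ _ _).2 fun j => (isTors_prod.1 (hw j)).2⟩, Subtype.ext ?_⟩⟩
      replace hw₂ : (φ (q + 1)).app n t - (G.d q).app n g' = g := hw₂
      change (G.d q).app n g' = (φ (q + 1)).app n t - g
      rw [← hw₂, sub_sub_cancel]
  · rw [LinearMap.mem_ker, LinearMap.mem_ker, comp_app, cohπ_eq_zero, cohπ_eq_zero]
    obtain ⟨⟨t, ht⟩, hdt⟩ := y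
    replace hdt : (T.d q).app n t = 0 := congrArg Subtype.val hdt
    cases q with
    | zero =>
      refine ⟨fun h => ?_, fun h => ?_⟩
      · refine Subtype.ext ?_
        change (φ 0).app n t = 0
        rw [show t = 0 from congrArg Subtype.val h, map_zero]
      · refine Subtype.ext (h0 n ?_)
        exact Prod.ext (hdt.trans (map_zero _).symm) ((congrArg Subtype.val h).trans
          (map_zero ((φ 0).app n)).symm)
    | succ q =>
      constructor
      · rintro ⟨t', ht'⟩
        refine ⟨((torsionFunctor 𝒜 I).map (φ q)).app n t', Subtype.ext ?_⟩
        change (G.d q).app n ((φ q).app n t'.1) = (φ (q + 1)).app n t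
        rw [← hφ]
        exact congrArg _ (congrArg Subtype.val ht')
      · rintro ⟨g', hg'⟩
        replace hg' : (G.d q).app n g'.1 = (φ (q + 1)).app n t := congrArg Subtype.val hg'
        obtain ⟨w, hw, hdw⟩ := key q (n := n) ((t, g'.1) : (T.X (q + 1)).X n × (G.X q).X n)
          (Prod.ext hdt (sub_eq_zero.2 hg'.symm))
          fun j => isTors_prod.2 ⟨(hf _ _ _).1 ht j, htors g' j⟩
        have hw₁ := congrArg Prod.fst hdw
        cases q with
        | zero => exact ⟨⟨w, (hf _ _ _).2 hw⟩, Subtype.ext hw₁⟩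
        | succ q =>
          exact ⟨⟨w.1, (hf _ _ _).2 fun j => (isTors_prod.1 (hw j)).1⟩, Subtype.ext hw₁⟩

end Complexes

end GrMod

namespace GrMod

section TorsionFreeQuotient

variable {k R : Type u} [Field k] [CommRing R] [Algebra k R]
variable {𝒜 : ℕ → Submodule k R} [GradedAlgebra 𝒜]

/-! ### Torsion-free quotients of acyclic resolutions -/

open GrComplex

/-- Local cohomology can be computed with any resolution by acyclic modules. -/
lemma nonempty_localCohomology_iso [IsNoetherianRing R] {D r : ℕ} {f : Fin r → 𝒜 D} {I : Ideal R}
    (hf : Detects f I) {X : GrMod 𝒜} {T : GrComplex 𝒜} {η : X ⟶ T.X 0} (hT : T.IsResolution η)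
    (haT : ∀ q, Acyclic f (T.X q)) (q : ℕ) :
    Nonempty (localCohomology I q X ≅ (torsionComplex I T).coh q) := by
  let G := injectiveResolution X
  have : ∀ q, Injective ((ofCochainComplex G.cocomplex).X q) := fun q =>
    inferInstanceAs (Injective (G.cocomplex.X q))
  obtain ⟨e⟩ := nonempty_torsion_coh_iso hf hT (isResolution_of_injectiveResolution G) haT
    (fun q => acyclic_of_injective f _) q
  exact ⟨localCohomologyIso I q G ≪≫ e.symm⟩

/-- A surjection of complexes `π : T → W` whose kernel is the `I`-torsion of `T`. -/
structure IsTorsionFreeQuotient (I : Ideal R) (T W : GrComplex 𝒜) (π : ∀ q, T.X q ⟶ W.X q) :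
    Prop where
  comm : ∀ q n x, (π (q + 1)).app n ((T.d q).app n x) = (W.d q).app n ((π q).app n x)
  surj : ∀ q n, Function.Surjective ((π q).app n)
  ker : ∀ q n x, (π q).app n x = 0 ↔ x ∈ torsion I (T.X q) n

variable {I : Ideal R} {T W : GrComplex 𝒜} {π : ∀ q, T.X q ⟶ W.X q}

lemma comap_torsion_act (I : Ideal R) (T : GrComplex 𝒜) (q : ℕ) {i : ℕ} {m n : ℤ}
    (h : (i : ℤ) + m = n) (a : 𝒜 i) (x : (T.X q).X m)
    (hx : x ∈ (torsion I (T.X (q + 1)) m).comap ((T.d q).app m)) :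
    (T.X q).act h a x ∈ (torsion I (T.X (q + 1)) n).comap ((T.d q).app n) := by
  rw [Submodule.mem_comap, (T.d q).comm]
  exact torsion_act I _ h a _ hx

/-- The elements of `T` whose differential is torsion, that is, whose image in `W` is a cocycle. -/
def preCocycles (I : Ideal R) (T : GrComplex 𝒜) (q : ℕ) : GrMod 𝒜 :=
  subObj (T.X q) (fun n => (torsion I (T.X (q + 1)) n).comap ((T.d q).app n))
    (comap_torsion_act I T q)

/-- The inclusion of `preCocycles`. -/
def preCocyclesι (I : Ideal R) (T : GrComplex 𝒜) (q : ℕ) : preCocycles I T q ⟶ T.X q :=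
  subι _ _ (comap_torsion_act I T q)

/-- The connecting homomorphism on representatives: `t ↦ d t`. -/
def preCocyclesD (I : Ideal R) (T : GrComplex 𝒜) (q : ℕ) :
    preCocycles I T q ⟶ (torsionComplex I T).coh (q + 1) :=
  cocyclesLift (torsionComplex I T)
    (subLift (preCocyclesι I T q ≫ T.d q) _ (torsion_act I (T.X (q + 1))) fun _ y => y.2)
    (fun n y => Subtype.ext (T.d_d q n y.1)) ≫ cohπ _ (q + 1)

lemma preCocyclesD_surjective {X : GrMod 𝒜} {η : X ⟶ T.X 0} (hT : T.IsResolution η) (q : ℕ)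
    (n : ℤ) : Function.Surjective ((preCocyclesD I T q).app n) := by
  intro z
  obtain ⟨⟨⟨z, hz⟩, hdz⟩, rfl⟩ := cohπ_surjective _ _ _ z
  replace hdz : (T.d (q + 1)).app n z = 0 := congrArg Subtype.val hdz
  obtain ⟨t, rfl⟩ := (hT.exact_succ q n z).1 hdz
  exact ⟨⟨t, hz⟩, rfl⟩

lemma preCocyclesD_eq_zero {q : ℕ} {n : ℤ} (y : (preCocycles I T q).X n) :
    (preCocyclesD I T q).app n y = 0 ↔
      ∃ t ∈ torsion I (T.X q) n, (T.d q).app n t = (T.d q).app n y.1 := by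
  refine cohπ_eq_zero _ |>.trans ⟨fun ⟨t, ht⟩ => ⟨t.1, t.2, congrArg Subtype.val ht⟩, ?_⟩
  rintro ⟨t, ht, h⟩
  exact ⟨⟨t, ht⟩, Subtype.ext h⟩

/-- The long exact cohomology sequence of `0 → Γ_I(T) → T → W → 0`, in positive degrees, where `T`
is exact: both sides are quotients of `preCocycles` with the same kernel. -/
lemma nonempty_localCohomology_iso_coh [IsNoetherianRing R] {D r : ℕ} {f : Fin r → 𝒜 D}
    (hf : Detects f I) {X : GrMod 𝒜} {η : X ⟶ T.X 0} (hT : T.IsResolution η)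
    (haT : ∀ q, Acyclic f (T.X q)) (hW : IsTorsionFreeQuotient I T W π) (q : ℕ) :
    Nonempty (localCohomology I (q + 2) X ≅ W.coh (q + 1)) := by
  obtain ⟨e⟩ := nonempty_localCohomology_iso hf hT haT (q + 2)
  refine ⟨e ≪≫ isoOfSurjective (preCocyclesD I T (q + 1))
    (cocyclesLift W (preCocyclesι I T (q + 1) ≫ π (q + 1)) (fun n y => ?_) ≫ W.cohπ (q + 1))
    (preCocyclesD_surjective hT (q + 1)) (fun n z => ?_) fun n => Submodule.ext fun y => ?_⟩
  · refine (hW.comm _ n y.1).symm.trans ((hW.ker _ n _).2 y.2)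
  · obtain ⟨⟨w, hw⟩, rfl⟩ := cohπ_surjective _ _ _ z
    obtain ⟨t, rfl⟩ := hW.surj _ n w
    exact ⟨⟨t, (hW.ker _ n _).1 ((hW.comm _ n t).trans hw)⟩, rfl⟩
  · rw [LinearMap.mem_ker, LinearMap.mem_ker, comp_app, cohπ_eq_zero, preCocyclesD_eq_zero]
    constructor
    · rintro ⟨t, ht, h⟩
      obtain ⟨t', ht'⟩ := (hT.exact_succ q n (y.1 - t)).1 (by rw [map_sub, h, sub_self])
      refine ⟨(π q).app n t', ?_⟩
      rw [← hW.comm, ht', map_sub, (hW.ker _ n t).2 ht, sub_zero]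
      rfl
    · rintro ⟨w, hw⟩
      obtain ⟨t, rfl⟩ := hW.surj _ n w
      refine ⟨y.1 - (T.d q).app n t, (hW.ker _ n _).1 ?_, ?_⟩
      · rw [map_sub, hW.comm, sub_eq_zero]
        exact hw.symm
      · rw [map_sub, T.d_d, sub_zero]

/-- The long exact cohomology sequence of `0 → Γ_I(T) → T → W → 0`, in low degrees; `X'` is the
cohomology of `W` in degree `0`. -/
lemma exists_localCohomology_sequence [IsNoetherianRing R] {D r : ℕ} {f : Fin r → 𝒜 D}
    (hf : Detects f I) {X X' : GrMod 𝒜} {η : X ⟶ T.X 0} (hT : T.IsResolution η)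
    (haT : ∀ q, Acyclic f (T.X q)) (hW : IsTorsionFreeQuotient I T W π) (θ : X' ⟶ W.X 0)
    (hθ : ∀ n, Function.Injective (θ.app n))
    (hθ' : ∀ n, Function.Exact (θ.app n) ((W.d 0).app n)) (τ : X ⟶ X')
    (hτ : ∀ n x, θ.app n (τ.app n x) = (π 0).app n (η.app n x)) :
    ∃ (ι : localCohomology I 0 X ⟶ X) (δ : X' ⟶ localCohomology I 1 X) (w₁ : ι ≫ τ = 0)
      (w₂ : τ ≫ δ = 0),
      Mono ι ∧ (ShortComplex.mk _ _ w₁).Exact ∧ (ShortComplex.mk _ _ w₂).Exact ∧ Epi δ := by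
  obtain ⟨e₀⟩ := nonempty_localCohomology_iso hf hT haT 0
  obtain ⟨e₁⟩ := nonempty_localCohomology_iso hf hT haT 1
  have hker : ∀ n x, τ.app n x = 0 ↔ x ∈ torsion I X n := fun n x => by
    rw [← (hθ n).eq_iff, map_zero, hτ, hW.ker, hf, hf]
    exact forall_congr' fun j => isTors_map_iff hT.inj
  -- `H⁰` is the torsion submodule
  let ΓX := subObj X (torsion I X) (torsion_act I X)
  let v : ΓX ⟶ (torsionComplex I T).coh 0 :=
    cocyclesLift (torsionComplex I T) ((torsionFunctor 𝒜 I).map η)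
      (fun n y => Subtype.ext ((hT.exact_zero n).apply_apply_eq_zero y.1)) ≫ cohπ _ 0
  have hv : ∀ n, Function.Bijective (v.app n) := by
    intro n
    refine ⟨(injective_iff_map_eq_zero _).2 fun x hx => ?_, fun z => ?_⟩
    · exact Subtype.ext (hT.inj n ((congrArg Subtype.val ((cohπ_eq_zero _).1 hx)).trans
        (map_zero (η.app n)).symm))
    · obtain ⟨⟨⟨z, hz⟩, hdz⟩, rfl⟩ := cohπ_surjective _ _ _ z
      replace hdz : (T.d 0).app n z = 0 := congrArg Subtype.val hdz
      obtain ⟨x, rfl⟩ := (hT.exact_zero n z).1 hdz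
      exact ⟨⟨x, (hf _ _ _).2 fun j => (isTors_map_iff hT.inj).1 ((hf _ _ _).1 hz j)⟩, rfl⟩
  let a : localCohomology I 0 X ≅ ΓX := e₀ ≪≫ (isoOfBijective v hv).symm
  let ι₀ : ΓX ⟶ X := subι X (torsion I X) (torsion_act I X)
  have : Mono ι₀ := mono_of_injective _ fun n => Subtype.val_injective
  -- the connecting homomorphism
  have hu₀ : ∀ n y, (preCocyclesι I T 0 ≫ π 0).app n y ∈ LinearMap.range (θ.app n) := fun n y =>
    (hθ' n _).1 ((hW.comm 0 n y.1).symm.trans ((hW.ker _ n _).2 y.2))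
  let u : preCocycles I T 0 ⟶ X' := liftOfInjective θ hθ _ hu₀
  have hu : ∀ n y, θ.app n (u.app n y) = (π 0).app n y.1 := fun n y =>
    congrArg (fun q => Hom.app q n y) (liftOfInjective_comp θ hθ _ hu₀)
  have hus : ∀ n, Function.Surjective (u.app n) := fun n x => by
    obtain ⟨t, ht⟩ := hW.surj 0 n (θ.app n x)
    refine ⟨⟨t, (hW.ker _ n _).1 ?_⟩, hθ n ((hu n _).trans ht)⟩
    exact ((hW.comm 0 n t).trans (congrArg _ ht)).trans ((hθ' n).apply_apply_eq_zero x)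
  have hudD : ∀ n, LinearMap.ker (u.app n) ≤ LinearMap.ker ((preCocyclesD I T 0).app n) :=
    fun n y hy => (preCocyclesD_eq_zero y).2 ⟨y.1, (hW.ker _ n _).1 (by
      rw [← hu, LinearMap.mem_ker.1 hy, map_zero]), rfl⟩
  let δ₀ : X' ⟶ (torsionComplex I T).coh 1 := descOfSurjective u hus (preCocyclesD I T 0) hudD
  have hδ₀ : ∀ n y, δ₀.app n (u.app n y) = (preCocyclesD I T 0).app n y := fun n y =>
    congrArg (fun q => Hom.app q n y) (comp_descOfSurjective u hus (preCocyclesD I T 0) hudD)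
  have : Epi δ₀ := epi_of_surjective _ fun n z => by
    obtain ⟨y, rfl⟩ := preCocyclesD_surjective hT 0 n z
    exact ⟨u.app n y, hδ₀ n y⟩
  have hδ : ∀ n x, δ₀.app n x = 0 ↔ ∃ y, τ.app n y = x := by
    intro n x
    obtain ⟨t, rfl⟩ := hus n x
    rw [hδ₀, preCocyclesD_eq_zero]
    constructor
    · rintro ⟨s, hs, h⟩
      obtain ⟨x, hx⟩ := (hT.exact_zero n (t.1 - s)).1 (by rw [map_sub, h, sub_self])
      refine ⟨x, hθ n ?_⟩
      rw [hτ, hu, hx, map_sub, (hW.ker _ n s).2 hs, sub_zero]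
    · rintro ⟨x, hx⟩
      refine ⟨t.1 - η.app n x, (hW.ker _ n _).1 ?_, ?_⟩
      · rw [map_sub, ← hτ, hx, hu, sub_self]
      · rw [map_sub, (hT.exact_zero n).apply_apply_eq_zero, sub_zero]
  refine ⟨a.hom ≫ ι₀, δ₀ ≫ e₁.inv, ?_, ?_, mono_comp _ _, (exact_iff _).2 fun n x hx => ?_,
    (exact_iff _).2 fun n x hx => ?_, epi_comp _ _⟩
  · rw [Category.assoc, show ι₀ ≫ τ = 0 from hom_ext fun n x => (hker n x.1).2 x.2, comp_zero]
  · rw [← Category.assoc, show τ ≫ δ₀ = 0 from hom_ext fun n x => (hδ n _).2 ⟨x, rfl⟩, zero_comp]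
  · refine ⟨a.inv.app n ⟨x, (hker n x).1 hx⟩, ?_⟩
    exact congrArg (fun q : ΓX ⟶ ΓX => ι₀.app n (q.app n ⟨x, (hker n x).1 hx⟩)) a.inv_hom_id
  · refine (hδ n x).1 (injective_of_mono e₁.inv n ?_)
    rw [map_zero]
    exact hx

end TorsionFreeQuotient

end GrMod

namespace GrMod

section Saturation

variable {k R : Type u} [Field k] [CommRing R] [Algebra k R]
variable {𝒜 : ℕ → Submodule k R} [GradedAlgebra 𝒜]

/-! ### Torsion and the points of `Proj` -/

/-- Forms `f₁, …, f_r` of the same positive degree in `I` which generate `I` up to radical. -/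
structure GeneratesRadical {D r : ℕ} (f : Fin r → 𝒜 D) (I : Ideal R) : Prop where
  pos : 0 < D
  mem : ∀ j, (f j : R) ∈ I
  le_radical : I ≤ (Ideal.span (Set.range fun j => (f j : R))).radical

variable {D r : ℕ} {f : Fin r → 𝒜 D} {I : Ideal R}

/-- The annihilator of a homogeneous element. -/
def ann (M : GrMod 𝒜) {n : ℤ} (x : M.X n) : Ideal R :=
  LinearMap.ker (LinearMap.toSpanSingleton R M.Total (M.of n x))

lemma mem_ann {M : GrMod 𝒜} {n : ℤ} {x : M.X n} {r : R} : r ∈ M.ann x ↔ r • M.of n x = 0 :=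
  Iff.rfl

lemma isHomogeneous_ann (M : GrMod 𝒜) {n : ℤ} (x : M.X n) : (M.ann x).IsHomogeneous 𝒜 := by
  intro i r hr
  have key : M.component (i + n) (r • M.of n x) = M.act rfl (decompose 𝒜 r i) x := by
    clear hr
    induction r using DirectSum.Decomposition.inductionOn 𝒜 with
    | zero => simp
    | add a b ha hb =>
      rw [add_smul, map_add, ha, hb, decompose_add, DirectSum.add_apply, map_add]
      rfl
    | @homogeneous j r =>
      rw [M.smul_of rfl]
      rcases eq_or_ne j i with rfl | h
      · rw [component_of, decompose_coe, of_eq_same]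
      · rw [component_of_ne _ (by omega), decompose_coe, of_eq_of_ne _ _ _ h.symm, map_zero]
        rfl
  rw [mem_ann] at hr ⊢
  rw [M.smul_of (n := i + n) rfl, ← key, hr, map_zero, map_zero]

/-- The `f_j`-torsion for all `j` is the `I`-torsion, since `I` is finitely generated. -/
lemma GeneratesRadical.detects [IsNoetherianRing R] (hf : GeneratesRadical f I) :
    Detects f I := by
  intro M n x
  constructor
  · rintro ⟨t, ht⟩ j
    exact ⟨t, ht _ (Ideal.pow_mem_pow (hf.mem j) t)⟩
  · intro h
    have hle : I ≤ (M.ann x).radical := by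
      refine hf.le_radical.trans (Ideal.radical_le_radical_iff.2 (Ideal.span_le.2 ?_))
      rintro _ ⟨j, rfl⟩
      obtain ⟨t, ht⟩ := h j
      exact ⟨t, mem_ann.2 ht⟩
    obtain ⟨t, ht⟩ := Ideal.exists_pow_le_of_le_radical_of_fg hle (IsNoetherian.noetherian I)
    exact ⟨t, fun g hg => mem_ann.1 (ht hg)⟩

lemma GeneratesRadical.exists_notMem (hf : GeneratesRadical f I) (P : projCompl 𝒜 I) :
    ∃ j, (f j : R) ∉ P.1.asHomogeneousIdeal.toIdeal := by
  by_contra! h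
  refine P.2 ((hf.le_radical.trans ?_ : I ≤ P.1.asHomogeneousIdeal.toIdeal))
  rw [P.1.isPrime.radical_le_iff, Ideal.span_le]
  rintro _ ⟨j, rfl⟩
  exact h j

/-- If a homogeneous ideal is contained in no point of `U` at which neither `f_j` nor `g` vanishes,
then it contains a power of `f_j g`. -/
lemma GeneratesRadical.mul_mem_radical (hf : GeneratesRadical f I) (j : Fin r) (g : R) {𝔟 : Ideal R}
    (h𝔟 : 𝔟.IsHomogeneous 𝒜)
    (h : ∀ P : projCompl 𝒜 I, (f j : R) ∉ P.1.asHomogeneousIdeal.toIdeal →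
      g ∉ P.1.asHomogeneousIdeal.toIdeal → ¬ 𝔟 ≤ P.1.asHomogeneousIdeal.toIdeal) :
    (f j : R) * g ∈ 𝔟.radical := by
  rw [h𝔟.radical_eq, Submodule.mem_sInf]
  rintro P ⟨hP, hle, hprime⟩
  by_contra hP'
  have h1 : (f j : R) ∉ P := fun h => hP' (Ideal.mul_mem_right _ P h)
  have h2 : g ∉ P := fun h => hP' (Ideal.mul_mem_left P _ h)
  refine h ⟨⟨⟨P, hP⟩, hprime, fun h => h1 (h ?_)⟩, fun h => h1 (h (hf.mem j))⟩ h1 h2 hle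
  exact HomogeneousIdeal.mem_irrelevant_of_mem 𝒜 hf.pos (f j).2

lemma GeneratesRadical.exists_pow_smul_eq_zero (hf : GeneratesRadical f I) (j : Fin r) (g : R)
    {M : GrMod 𝒜} {n : ℤ} (x : M.X n)
    (h : ∀ P : projCompl 𝒜 I, (f j : R) ∉ P.1.asHomogeneousIdeal.toIdeal →
      g ∉ P.1.asHomogeneousIdeal.toIdeal → ∃ u : homogCompl P.1, u • M.of n x = 0) :
    ∃ N : ℕ, ((f j : R) * g) ^ N • M.of n x = 0 :=
  hf.mul_mem_radical j g (M.isHomogeneous_ann x) fun P h1 h2 hle => by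
    obtain ⟨u, hu⟩ := h P h1 h2
    exact u.2.2 (hle (mem_ann.2 hu))

lemma mk_eq_zero_iff {P : ProjectiveSpectrum 𝒜} {M : GrMod 𝒜} {z : M.Total} {s : homogCompl P} :
    LocalizedModule.mk z s = 0 ↔ ∃ u : homogCompl P, u • z = 0 := by
  rw [← LocalizedModule.zero_mk (1 : homogCompl P), LocalizedModule.mk_eq]
  simp

/-- A form outside the homogeneous prime `P`, as an element of the multiplicative set at `P`. -/
def complOf {P : ProjectiveSpectrum 𝒜} {d : ℕ} (e : 𝒜 d)
    (he : (e : R) ∉ P.asHomogeneousIdeal.toIdeal) : homogCompl P :=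
  ⟨e, ⟨d, e.2⟩, he⟩

lemma eq_zero_of_smul_localized {P : ProjectiveSpectrum 𝒜} {M : GrMod 𝒜} {d : ℕ} (e : 𝒜 d)
    (he : (e : R) ∉ P.asHomogeneousIdeal.toIdeal) (t : ℕ)
    {z : LocalizedModule (homogCompl P) M.Total} (hz : (e : R) ^ t • z = 0) : z = 0 := by
  induction z using LocalizedModule.induction_on with
  | h z s =>
    rw [LocalizedModule.smul'_mk, mk_eq_zero_iff] at hz
    obtain ⟨u, hu⟩ := hz
    exact mk_eq_zero_iff.2 ⟨u * complOf e he ^ t, (mul_smul _ _ _).trans hu⟩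

/-- The kernel of `M → M^sat` is the torsion. -/
lemma GeneratesRadical.toSaturation_eq_zero (hf : GeneratesRadical f I) {M : GrMod 𝒜} {n : ℤ}
    (x : M.X n) : (toSaturation I M).app n x = 0 ↔ ∀ j, IsTors (f j : R) x := by
  constructor
  · intro h j
    obtain ⟨N, hN⟩ := hf.exists_pow_smul_eq_zero j 1 x fun P _ _ =>
      mk_eq_zero_iff.1 (congrFun (congrArg Subtype.val h) P)
    exact ⟨N, by rwa [mul_one] at hN⟩
  · intro h
    refine Subtype.ext (funext fun P => ?_)
    obtain ⟨j, hj⟩ := hf.exists_notMem P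
    obtain ⟨t, ht⟩ := h j
    exact mk_eq_zero_iff.2 ⟨complOf (f j) hj ^ t, ht⟩

/-- The saturation has no torsion. -/
lemma GeneratesRadical.saturation_torsionFree (hf : GeneratesRadical f I) {M : GrMod 𝒜} {n : ℤ}
    (s : (saturation I M).X n) (hs : ∀ j, IsTors (f j : R) s) : s = 0 := by
  refine Subtype.ext (funext fun P => ?_)
  obtain ⟨j, hj⟩ := hf.exists_notMem P
  obtain ⟨t, ht⟩ := hs j
  let ft : 𝒜 (t • D) := ⟨(f j : R) ^ t, SetLike.pow_mem_graded t (f j).2⟩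
  rw [show (f j : R) ^ t = (ft : R) from rfl, smul_of _ rfl] at ht
  have h := of_injective _ _ (ht.trans (map_zero _).symm)
  exact eq_zero_of_smul_localized (f j) hj t (congrFun (congrArg Subtype.val h) P)

/-! ### The saturation as a left exact functor -/

/-- On the part of `U` where the form `e` does not vanish, `s` is a fraction with denominator
`e` and numerator `y`. -/
def IsFrac {M : GrMod 𝒜} {ℓ : ℤ} (s : (saturation I M).X ℓ) {d : ℕ} {n : ℤ} (e : 𝒜 d) (y : M.X n) :
    Prop :=
  ∀ (P : projCompl 𝒜 I) (he : (e : R) ∉ P.1.asHomogeneousIdeal.toIdeal),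
    s.1 P = LocalizedModule.mk (M.of n y) (complOf e he)

/-- Sections are fractions on basic open sets. -/
lemma exists_isFrac {M : GrMod 𝒜} {ℓ : ℤ} (s : (saturation I M).X ℓ) (P : projCompl 𝒜 I) :
    ∃ (d : ℕ) (e : 𝒜 d) (y : M.X (d + ℓ)),
      (e : R) ∉ P.1.asHomogeneousIdeal.toIdeal ∧ IsFrac s e y := by
  obtain ⟨V, hV, hPV, d, n, rfl, e, y, h⟩ := s.2 P
  obtain ⟨_, ⟨g, rfl⟩, hPg, hgV⟩ :=
    (ProjectiveSpectrum.isTopologicalBasis_basic_opens 𝒜).exists_subset_of_mem_open hPV hV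
  dsimp only at hPg hgV
  rw [ProjectiveSpectrum.basicOpen_eq_union_of_projection] at hPg hgV
  obtain ⟨i, hi⟩ := TopologicalSpace.Opens.mem_iSup.1 hPg
  let gi : 𝒜 i := decompose 𝒜 g i
  have hgi : (gi : R) ∉ P.1.asHomogeneousIdeal.toIdeal := hi
  refine ⟨i + d, ⟨(gi : R) * e, SetLike.mul_mem_graded gi.2 e.2⟩,
    M.act (by push_cast; ring) gi y, fun hmem => ?_, fun Q hQ => ?_⟩
  · exact (P.1.isPrime.mem_or_mem hmem).elim hgi (h P hPV).1
  · have hQg : (gi : R) ∉ Q.1.asHomogeneousIdeal.toIdeal := fun h' =>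
      hQ (Ideal.mul_mem_right _ _ h')
    obtain ⟨hf', hs⟩ := h Q (hgV (TopologicalSpace.Opens.mem_iSup.2 ⟨i, hQg⟩))
    rw [hs, ← M.smul_of]
    exact (LocalizedModule.mk_cancel_common_left (complOf gi hQg) (complOf e hf') (M.of _ y)).symm

lemma mem_twistSections_of_frac {M : GrMod 𝒜} {ℓ : ℤ}
    {s : ∀ P : projCompl 𝒜 I, LocalizedModule (homogCompl P.1) M.Total}
    (h : ∀ P : projCompl 𝒜 I, ∃ (d : ℕ) (e : 𝒜 d) (y : M.X (d + ℓ)),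
      (e : R) ∉ P.1.asHomogeneousIdeal.toIdeal ∧ ∀ (Q : projCompl 𝒜 I)
        (he : (e : R) ∉ Q.1.asHomogeneousIdeal.toIdeal),
        s Q = LocalizedModule.mk (M.of _ y) (complOf e he)) :
    s ∈ M.twistSections I ℓ := by
  intro P
  obtain ⟨d, e, y, he, hs⟩ := h P
  exact ⟨_, ProjectiveSpectrum.isOpen_basicOpen 𝒜 (a := (e : R)), he, d, _, rfl, e, y,
    fun Q hQ => ⟨hQ, hs Q hQ⟩⟩

/-- The map induced by a graded homomorphism on the localizations at `P`. -/
def localizedMap {M N : GrMod 𝒜} (φ : M ⟶ N) (P : ProjectiveSpectrum 𝒜) :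
    LocalizedModule (homogCompl P) M.Total →ₗ[R] LocalizedModule (homogCompl P) N.Total :=
  IsLocalizedModule.map (homogCompl P) (LocalizedModule.mkLinearMap _ M.Total)
    (LocalizedModule.mkLinearMap _ N.Total) (totalMap φ)

lemma localizedMap_mk {M N : GrMod 𝒜} (φ : M ⟶ N) (P : ProjectiveSpectrum 𝒜) {n : ℤ} (x : M.X n)
    (s : homogCompl P) : localizedMap φ P (LocalizedModule.mk (M.of n x) s) =
      LocalizedModule.mk (N.of n (φ.app n x)) s := by
  rw [← totalMap_of]
  exact IsLocalizedModule.map_LocalizedModules _ _ _ _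

lemma localizedMap_injective {M N : GrMod 𝒜} {φ : M ⟶ N} (h : ∀ n, Function.Injective (φ.app n))
    (P : ProjectiveSpectrum 𝒜) : Function.Injective (localizedMap φ P) :=
  IsLocalizedModule.map_injective _ _ _ _ (totalMap_injective h)

/-- The functoriality of the saturation. -/
def saturationMap (I : Ideal R) {M N : GrMod 𝒜} (φ : M ⟶ N) :
    saturation I M ⟶ saturation I N where
  app ℓ :=
    { toFun := fun s => ⟨fun P => localizedMap φ P.1 (s.1 P),
        mem_twistSections_of_frac fun P => by
          obtain ⟨d, e, y, he, hs⟩ := exists_isFrac s P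
          exact ⟨d, e, φ.app _ y, he, fun Q hQ => by rw [hs Q hQ, localizedMap_mk]⟩⟩
      map_add' := fun s t => Subtype.ext (funext fun P => map_add (localizedMap φ P.1) _ _)
      map_smul' := fun c s => Subtype.ext (funext fun P =>
        (localizedMap φ P.1).map_smul_of_tower c (s.1 P)) }
  comm _ a s := Subtype.ext (funext fun P => map_smul (localizedMap φ P.1) (a : R) (s.1 P))

lemma saturationMap_toSaturation (I : Ideal R) {M N : GrMod 𝒜} (φ : M ⟶ N) (n : ℤ) (x : M.X n) :
    (saturationMap I φ).app n ((toSaturation I M).app n x) =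
      (toSaturation I N).app n (φ.app n x) :=
  Subtype.ext (funext fun P => localizedMap_mk φ P.1 x 1)

lemma saturationMap_injective {M N : GrMod 𝒜} {φ : M ⟶ N} (h : ∀ n, Function.Injective (φ.app n))
    (n : ℤ) : Function.Injective ((saturationMap I φ).app n) := fun _ _ hst =>
  Subtype.ext (funext fun P =>
    localizedMap_injective h P.1 (congrFun (congrArg Subtype.val hst) P))

/-- The saturation is left exact. -/
lemma saturationMap_exact {A B C : GrMod 𝒜} {a : A ⟶ B} {b : B ⟶ C}
    (ha : ∀ n, Function.Injective (a.app n)) (hab : ∀ n, Function.Exact (a.app n) (b.app n))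
    (ℓ : ℤ) : Function.Exact ((saturationMap I a).app ℓ) ((saturationMap I b).app ℓ) := by
  intro s
  constructor
  · intro hs
    have key : ∀ P : projCompl 𝒜 I, ∃ (d : ℕ) (e : 𝒜 d) (y : A.X (d + ℓ)),
        (e : R) ∉ P.1.asHomogeneousIdeal.toIdeal ∧ IsFrac s e (a.app _ y) := by
      intro P
      obtain ⟨d, e, y, he, hy⟩ := exists_isFrac s P
      have h0 : localizedMap b P.1 (s.1 P) = 0 := congrFun (congrArg Subtype.val hs) P
      rw [hy P he, localizedMap_mk, mk_eq_zero_iff] at h0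
      obtain ⟨⟨u, ⟨i, hi⟩, hu⟩, h0⟩ := h0
      have h1 : C.of _ (C.act (n := (i + d : ℕ) + ℓ) (by push_cast; ring) ⟨u, hi⟩
          (b.app _ y)) = 0 := by
        rw [← C.smul_of]
        exact h0
      rw [← b.comm] at h1
      obtain ⟨x, hx⟩ := (hab _ _).1 (C.of_injective _ (h1.trans (map_zero _).symm))
      refine ⟨i + d, ⟨u * e, SetLike.mul_mem_graded hi e.2⟩, x, fun h =>
        (P.1.isPrime.mem_or_mem h).elim hu he, fun Q hQ => ?_⟩
      have hQu : u ∉ Q.1.asHomogeneousIdeal.toIdeal := fun h' => hQ (Ideal.mul_mem_right _ _ h')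
      have hQe : (e : R) ∉ Q.1.asHomogeneousIdeal.toIdeal := fun h' =>
        hQ (Ideal.mul_mem_left _ _ h')
      rw [hy Q hQe, hx, ← B.smul_of]
      exact (LocalizedModule.mk_cancel_common_left (complOf ⟨u, hi⟩ hQu) (complOf e hQe)
        (B.of _ y)).symm
    have hex : ∀ P : projCompl 𝒜 I, ∃ t, localizedMap a P.1 t = s.1 P := fun P => by
      obtain ⟨d, e, y, he, hy⟩ := key P
      exact ⟨LocalizedModule.mk (A.of _ y) (complOf e he), by rw [localizedMap_mk, hy P he]⟩
    choose t ht using hex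
    refine ⟨⟨t, mem_twistSections_of_frac fun P => ?_⟩, Subtype.ext (funext ht)⟩
    obtain ⟨d, e, y, he, hy⟩ := key P
    exact ⟨d, e, y, he, fun Q hQ => localizedMap_injective ha Q.1 (by
      rw [ht, hy Q hQ, localizedMap_mk])⟩
  · rintro ⟨t, rfl⟩
    refine Subtype.ext (funext fun P => ?_)
    obtain ⟨d, e, y, he, hy⟩ := exists_isFrac t P
    change localizedMap b P.1 (localizedMap a P.1 (t.1 P)) = 0
    rw [hy P he, localizedMap_mk, localizedMap_mk, (hab _).apply_apply_eq_zero, map_zero,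
      LocalizedModule.zero_mk]

/-! ### Surjectivity of `E → E^sat` for injective `E` -/

/-- If `f_j` acts bijectively on `X`, then a section which vanishes where `f_j ≠ 0` vanishes. -/
lemma GeneratesRadical.section_eq_zero (hf : GeneratesRadical f I) (j : Fin r) {X : GrMod 𝒜}
    (hX : ∀ {m n : ℤ} (e : (D : ℤ) + m = n), Function.Bijective (X.act e (f j))) {ℓ : ℤ}
    (s : (saturation I X).X ℓ) (hs : ∀ P : projCompl 𝒜 I,
      (f j : R) ∉ P.1.asHomogeneousIdeal.toIdeal → s.1 P = 0) : s = 0 := by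
  refine Subtype.ext (funext fun P => ?_)
  obtain ⟨d, e, y, he, hy⟩ := exists_isFrac s P
  obtain ⟨N, hN⟩ := hf.exists_pow_smul_eq_zero j e y fun Q h1 h2 =>
    mk_eq_zero_iff.1 ((hy Q h2).symm.trans (hs Q h1))
  have hcancel : ∀ (N : ℕ) (z : X.Total), (f j : R) ^ N • z = 0 → z = 0 := fun N => by
    induction N with
    | zero => exact fun z hz => by simpa using hz
    | succ N ih =>
      intro z hz
      rw [pow_succ, mul_smul] at hz
      exact X.eq_zero_of_smul_eq_zero (f j) (fun n => (hX rfl).1) (ih _ hz)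
  rw [mul_pow, mul_smul] at hN
  rw [hy P he]
  exact mk_eq_zero_iff.2 ⟨complOf e he ^ N, hcancel N _ hN⟩

/-- If `a` acts surjectively, then elements can be divided by powers of `a`. -/
lemma exists_pow_smul_of_eq {X : GrMod 𝒜} (a : 𝒜 D)
    (hX : ∀ {m n : ℤ} (e : (D : ℤ) + m = n), Function.Surjective (X.act e a)) (N : ℕ) {l n : ℤ}
    (h : (N : ℤ) * D + l = n) (w : X.X n) : ∃ x : X.X l, (a : R) ^ N • X.of l x = X.of n w := by
  induction N generalizing n with
  | zero =>
    obtain rfl : l = n := by simpa using h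
    exact ⟨w, by simp⟩
  | succ N ih =>
    obtain ⟨w, rfl⟩ := hX (m := n - D) (by ring) w
    obtain ⟨x, hx⟩ := ih (n := n - D) (by rw [← h]; push_cast; ring) w
    exact ⟨x, by rw [pow_succ', mul_smul, hx, X.smul_of]⟩

/-- If `f_j` acts bijectively on `X`, then `X → X^sat` is surjective: this is the computation of
the sections over the affine scheme `D₊(f_j)`. -/
lemma GeneratesRadical.toSaturation_surjective_of_bijective (hf : GeneratesRadical f I) (j : Fin r)
    {X : GrMod 𝒜} (hX : ∀ {m n : ℤ} (e : (D : ℤ) + m = n), Function.Bijective (X.act e (f j)))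
    (ℓ : ℤ) : Function.Surjective ((toSaturation I X).app ℓ) := by
  intro s
  have hcancel : ∀ (N : ℕ) (z : X.Total), (f j : R) ^ N • z = 0 → z = 0 := fun N => by
    induction N with
    | zero => exact fun z hz => by simpa using hz
    | succ N ih =>
      intro z hz
      rw [pow_succ, mul_smul] at hz
      exact X.eq_zero_of_smul_eq_zero (f j) (fun n => (hX rfl).1) (ih _ hz)
  -- the denominators of `s`
  let ℰ : Set R := {e | ∃ (d : ℕ) (he : e ∈ 𝒜 d) (y : X.X (d + ℓ)), IsFrac s ⟨e, he⟩ y}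
  have hℰ : (Ideal.span ℰ).IsHomogeneous 𝒜 :=
    Ideal.homogeneous_span 𝒜 ℰ fun e ⟨d, he, _⟩ => ⟨d, he⟩
  obtain ⟨N₀, hN₀⟩ := hf.mul_mem_radical j 1 hℰ fun P _ _ hle => by
    obtain ⟨d, e, y, he, hy⟩ := exists_isFrac s P
    exact he (hle (Ideal.subset_span ⟨d, e.2, y, hy⟩))
  rw [mul_one] at hN₀
  -- finitely many of them suffice to cover `D₊(f_j)`
  obtain ⟨F, hFℰ, hF⟩ := Submodule.mem_span_finite_of_mem_span hN₀
  have hFcover : ∀ P : projCompl 𝒜 I, (f j : R) ∉ P.1.asHomogeneousIdeal.toIdeal →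
      ∃ e : F, (e : R) ∉ P.1.asHomogeneousIdeal.toIdeal := fun P hP => by
    by_contra! h
    exact hP (P.1.isPrime.mem_of_pow_mem N₀
      ((Ideal.span_le.2 fun e he => h ⟨e, he⟩ : Ideal.span (F : Set R) ≤ _) hF))
  choose d he y hy using fun e : F => hFℰ e.2
  have hpair : ∀ e e' : F, ∃ N : ℕ, ((e : R) * e') ^ N •
      ((e : R) • X.of _ (y e') - (e' : R) • X.of _ (y e)) = 0 := by
    intro e e'
    have h1 : (e : R) • X.of _ (y e') = X.of _ (X.act (n := d e + (d e' + ℓ)) rfl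
      ⟨e, he e⟩ (y e')) := X.smul_of (r := ⟨e, he e⟩) _ _
    have h2 : (e' : R) • X.of _ (y e) = X.of _ (X.act (n := d e + (d e' + ℓ)) (by ring)
      ⟨e', he e'⟩ (y e)) := X.smul_of (r := ⟨e', he e'⟩) _ _
    obtain ⟨N, hN⟩ := hf.exists_pow_smul_eq_zero j ((e : R) * e')
      (X.act (n := d e + (d e' + ℓ)) rfl ⟨e, he e⟩ (y e') -
        X.act (n := d e + (d e' + ℓ)) (by ring) ⟨e', he e'⟩ (y e)) fun P _ hP => by
      have hPe : (e : R) ∉ P.1.asHomogeneousIdeal.toIdeal := fun h =>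
        hP (Ideal.mul_mem_right _ _ h)
      have hPe' : (e' : R) ∉ P.1.asHomogeneousIdeal.toIdeal := fun h =>
        hP (Ideal.mul_mem_left _ _ h)
      obtain ⟨u, hu⟩ := LocalizedModule.mk_eq.1 ((hy e P hPe).symm.trans (hy e' P hPe'))
      refine ⟨u, ?_⟩
      rw [map_sub, ← h1, ← h2, smul_sub, sub_eq_zero]
      exact hu.symm
    refine ⟨N, hcancel N _ ?_⟩
    rw [map_sub, ← h1, ← h2, mul_pow, mul_smul] at hN
    exact hN
  choose N hN using hpair
  let N₁ := Finset.univ.sup fun p : F × F => N p.1 p.2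
  have hN₁ : ∀ e e' : F, (e' : R) ^ N₁ • (e : R) ^ (N₁ + 1) • X.of _ (y e') =
      (e' : R) ^ N₁ • (e' : R) • (e : R) ^ N₁ • X.of _ (y e) := by
    intro e e'
    have hle : N e e' ≤ N₁ := Finset.le_sup (f := fun p : F × F => N p.1 p.2)
      (Finset.mem_univ (e, e'))
    have h := pow_smul_eq_zero_of_le (hN e e') hle
    rw [smul_sub, sub_eq_zero] at h
    rw [smul_smul, smul_smul, smul_smul]
    rw [smul_smul, smul_smul] at h
    convert h using 2 <;> ring
  -- the elements `a` of the ring such that `a s` is the image of an element of `X`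
  let K : Ideal R :=
    { carrier := {a | ∃ z : X.Total, ∀ P : projCompl 𝒜 I,
        (f j : R) ∉ P.1.asHomogeneousIdeal.toIdeal → a • s.1 P = LocalizedModule.mk z 1}
      zero_mem' := ⟨0, fun P _ => by rw [zero_smul, LocalizedModule.zero_mk]⟩
      add_mem' := by
        rintro a b ⟨z, hz⟩ ⟨w, hw⟩
        exact ⟨z + w, fun P hP => by
          rw [add_smul, hz P hP, hw P hP, LocalizedModule.mk_add_mk, one_smul, one_smul, mul_one]⟩
      smul_mem' := by
        rintro a b ⟨z, hz⟩
        exact ⟨a • z, fun P hP => by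
          rw [smul_eq_mul, mul_smul, hz P hP, LocalizedModule.smul'_mk]⟩ }
  have hFK : ∀ e : F, (e : R) ^ (N₁ + 1) ∈ K := fun e =>
    ⟨(e : R) ^ N₁ • X.of _ (y e), fun P hP => by
      obtain ⟨e', he'⟩ := hFcover P hP
      rw [hy e' P he', LocalizedModule.smul'_mk, LocalizedModule.mk_eq]
      refine ⟨complOf (⟨(e' : R), he e'⟩ : 𝒜 (d e')) he' ^ N₁, ?_⟩
      rw [one_smul]
      exact hN₁ e e'⟩
  obtain ⟨N₂, hN₂⟩ : (f j : R) ∈ K.radical :=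
    Ideal.radical_isRadical K ⟨N₀, (Ideal.span_le.2 fun e he =>
      ⟨N₁ + 1, hFK ⟨e, he⟩⟩ : Ideal.span (F : Set R) ≤ K.radical) hF⟩
  obtain ⟨z, hz⟩ := hN₂
  -- replace `z` by its component of the expected degree, and divide it by a power of `f_j`
  obtain ⟨x, hx⟩ := exists_pow_smul_of_eq (f j) (fun e => (hX e).2) N₂ (l := ℓ)
    (n := (N₂ • D : ℕ) + ℓ) (by simp) (X.component _ z)
  refine ⟨x, ?_⟩
  rw [← sub_eq_zero]
  refine hf.section_eq_zero j hX _ fun P hP => ?_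
  refine eq_zero_of_smul_localized (f j) hP N₂ ?_
  obtain ⟨d', e', y', hPe', hy'⟩ := exists_isFrac s P
  change (f j : R) ^ N₂ • (LocalizedModule.mk (X.of ℓ x) 1 - s.1 P) = 0
  rw [smul_sub, sub_eq_zero, LocalizedModule.smul'_mk]
  have h1 := hz P hP
  rw [hy' P hPe', LocalizedModule.smul'_mk, LocalizedModule.mk_eq] at h1
  obtain ⟨⟨u, ⟨i, hi⟩, huP⟩, hu⟩ := h1
  rw [hy' P hPe', LocalizedModule.smul'_mk, eq_comm, LocalizedModule.mk_eq]
  refine ⟨⟨u, ⟨i, hi⟩, huP⟩, ?_⟩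
  let g : 𝒜 (N₂ • D) := ⟨(f j : R) ^ N₂, SetLike.pow_mem_graded N₂ (f j).2⟩
  have hleft : u • (f j : R) ^ N₂ • X.of _ y' = X.of (i + (d' + ((N₂ • D : ℕ) + ℓ)))
      (X.act rfl ⟨u, hi⟩ (X.act (by ring) g y')) := by
    rw [show (f j : R) ^ N₂ = (g : R) from rfl,
      X.smul_of (n := d' + ((N₂ • D : ℕ) + ℓ)) (by ring)]
    exact X.smul_of rfl (⟨u, hi⟩ : 𝒜 i) _
  have hright : u • (e' : R) • X.of _ (X.component ((N₂ • D : ℕ) + ℓ) z) =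
      X.of _ (X.component (i + (d' + ((N₂ • D : ℕ) + ℓ))) (u • (e' : R) • z)) := by
    rw [X.component_smul (m := d' + ((N₂ • D : ℕ) + ℓ)) rfl (⟨u, hi⟩ : 𝒜 i),
      X.component_smul (m := (N₂ • D : ℕ) + ℓ) rfl, X.smul_of rfl]
    exact X.smul_of rfl (⟨u, hi⟩ : 𝒜 i) _
  change u • (1 : homogCompl P.1) • (f j : R) ^ N₂ • X.of _ y' = u • (e' : R) • z at hu
  change u • (1 : homogCompl P.1) • (f j : R) ^ N₂ • X.of _ y' =
    u • (e' : R) • (f j : R) ^ N₂ • X.of ℓ x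
  rw [one_smul] at hu ⊢
  rw [hx, hright, ← hu, hleft, component_of]

/-- For injective `E` the canonical map `E → E^sat` is surjective. By `injective_induction` it is
enough to treat pure modules `X`: either some `f_j` acts bijectively on `X`, or all of them act
locally nilpotently and `X^sat = 0`. -/
lemma GeneratesRadical.toSaturation_surjective [IsNoetherianRing R] (hf : GeneratesRadical f I)
    (E : GrMod 𝒜) [Injective E] (ℓ : ℤ) : Function.Surjective ((toSaturation I E).app ℓ) := by
  revert ℓ
  refine injective_induction f (P := fun X => ∀ ℓ, Function.Surjective ((toSaturation I X).app ℓ))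
    (fun X hX ℓ => ?_) (fun {A B C} i p _ h _ hA hC ℓ s => ?_) E
  · by_cases hj : ∃ j, ∀ {m n : ℤ} (e : (D : ℤ) + m = n), Function.Bijective (X.act e (f j))
    · obtain ⟨j, hj⟩ := hj
      exact hf.toSaturation_surjective_of_bijective j hj ℓ
    · push Not at hj
      refine fun s => ⟨0, ?_⟩
      rw [map_zero]
      refine Subtype.ext (funext fun P => ?_)
      obtain ⟨d, e, y, he, hy⟩ := exists_isFrac s P
      obtain ⟨j, hPj⟩ := hf.exists_notMem P
      obtain ⟨t, ht⟩ := (hX j).resolve_left (fun h => by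
        obtain ⟨m, n, e, he⟩ := hj j
        exact he (h e)) _ y
      rw [hy P he]
      exact (mk_eq_zero_iff.2 ⟨complOf (f j) hPj ^ t, ht⟩).symm
  · obtain ⟨c, hc⟩ := hC ℓ ((saturationMap I p).app ℓ s)
    obtain ⟨b, rfl⟩ := h.surj ℓ c
    obtain ⟨t, ht⟩ := (saturationMap_exact (I := I) h.inj h.exact ℓ
      (s - (toSaturation I B).app ℓ b)).1 (by
        rw [map_sub, saturationMap_toSaturation, hc, sub_self])
    obtain ⟨a, rfl⟩ := hA ℓ t
    refine ⟨i.app ℓ a + b, ?_⟩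
    rw [map_add, ← saturationMap_toSaturation, ht, sub_add_cancel]

end Saturation

end GrMod

/-! ### Rings: finiteness and generators up to radical -/

section StandardGraded

variable {k R : Type u} [Field k] [CommRing R] [Algebra k R]
variable {𝒜 : ℕ → Submodule k R} [GradedAlgebra 𝒜]

lemma IsStandardGraded.finiteType (h : IsStandardGraded 𝒜) : Algebra.FiniteType k R := by
  obtain ⟨n, φ, hφ, -⟩ := h
  exact Algebra.FiniteType.of_surjective φ hφ

lemma IsStandardGraded.isNoetherianRing (h : IsStandardGraded 𝒜) : IsNoetherianRing R :=
  haveI := h.finiteType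
  Algebra.FiniteType.isNoetherianRing k R

/-- Elements of degree zero of a standard graded algebra are scalars. -/
lemma IsStandardGraded.mem_range_algebraMap (h : IsStandardGraded 𝒜) {a : R} (ha : a ∈ 𝒜 0) :
    a ∈ Set.range (algebraMap k R) := by
  obtain ⟨n, φ, hφ, hX⟩ := h
  obtain ⟨p, rfl⟩ := hφ a
  rw [← decompose_of_mem_same 𝒜 ha]
  clear ha
  induction p using MvPolynomial.induction_on with
  | C c =>
    refine ⟨c, ?_⟩
    rw [← MvPolynomial.algebraMap_eq, AlgHom.commutes,
      decompose_of_mem_same 𝒜 (SetLike.algebraMap_mem_graded 𝒜 c)]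
  | add p q hp hq =>
    obtain ⟨c, hc⟩ := hp
    obtain ⟨d, hd⟩ := hq
    exact ⟨c + d, by rw [map_add, map_add, decompose_add, DirectSum.add_apply,
      Submodule.coe_add, hc, hd]⟩
  | mul_X p i _ =>
    refine ⟨0, ?_⟩
    rw [map_zero, map_mul, coe_decompose_mul_of_right_mem_of_not_le 𝒜 (hX i) (by omega)]

/-- Powers of homogeneous generators of `I` generate it up to radical and have the same degree `D`.
Every multiple `D` of some `D₀` is possible, so that two ideals can be given a common degree. -/
lemma IsStandardGraded.exists_generatesRadical (h : IsStandardGraded 𝒜) {I : Ideal R}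
    (hI : I.IsHomogeneous 𝒜) (hI' : I ≠ ⊤) : ∃ D₀ : ℕ, 0 < D₀ ∧ ∀ D : ℕ, 0 < D → D₀ ∣ D →
      ∃ (r : ℕ) (f : Fin r → 𝒜 D), GrMod.GeneratesRadical f I := by
  have := h.isNoetherianRing
  have hspan : Ideal.span {a : R | a ∈ I ∧ SetLike.IsHomogeneousElem 𝒜 a} = I := by
    refine le_antisymm (Ideal.span_le.2 fun a ha => ha.1) fun a ha => ?_
    classical
    rw [← sum_support_decompose 𝒜 a]
    exact Ideal.sum_mem _ fun i _ => Ideal.subset_span ⟨hI i ha, i, (decompose 𝒜 a i).2⟩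
  obtain ⟨G, hG, hGI⟩ := Submodule.fg_span_iff_fg_span_finset_subset _ |>.1
    (IsNoetherian.noetherian (Ideal.span {a : R | a ∈ I ∧ SetLike.IsHomogeneousElem 𝒜 a}))
  have hdeg : ∀ a : G, ∃ d : ℕ, 0 < d ∧ (a : R) ∈ 𝒜 d := by
    intro a
    obtain ⟨haI, d, hd⟩ := hG a.2
    rcases Nat.eq_zero_or_pos d with rfl | hpos
    · -- a form of degree zero in a proper ideal vanishes
      obtain ⟨c, hc⟩ := h.mem_range_algebraMap hd
      have hc0 : c = 0 := by
        by_contra hc0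
        exact hI' (Ideal.eq_top_of_isUnit_mem I haI (hc ▸ (isUnit_iff_ne_zero.2 hc0).map _))
      exact ⟨1, one_pos, by rw [← hc, hc0, map_zero]; exact zero_mem _⟩
    · exact ⟨d, hpos, hd⟩
  choose d hd hmem using hdeg
  refine ⟨∏ a, d a, Finset.prod_pos fun a _ => hd a, fun D hD hdvd => ?_⟩
  have hdD : ∀ a, D / d a * d a = D := fun a =>
    Nat.div_mul_cancel ((Finset.dvd_prod_of_mem d (Finset.mem_univ a)).trans hdvd)
  refine ⟨G.card, fun j => ⟨(G.equivFin.symm j : R) ^ (D / d (G.equivFin.symm j)), ?_⟩,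
    hD, fun j => ?_, ?_⟩
  · have := SetLike.pow_mem_graded (D / d (G.equivFin.symm j)) (hmem (G.equivFin.symm j))
    rwa [smul_eq_mul, hdD] at this
  · refine Ideal.pow_mem_of_mem I (hG (G.equivFin.symm j).2).1 _ ?_
    exact Nat.pos_of_ne_zero fun h0 => by have := hdD (G.equivFin.symm j); simp [h0] at this; omega
  · rw [← hspan]
    refine (le_of_eq hGI).trans (Submodule.span_le.2 fun a ha => ?_)
    refine ⟨D / d ⟨a, ha⟩, Ideal.subset_span ⟨G.equivFin ⟨a, ha⟩, ?_⟩⟩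
    simp

end StandardGraded

section SegreRing

variable {k R S : Type u} [Field k] [CommRing R] [Algebra k R] [CommRing S] [Algebra k S]
variable {𝒜 : ℕ → Submodule k R} [GradedAlgebra 𝒜] {ℬ : ℕ → Submodule k S} [GradedAlgebra ℬ]

/-- The projection of `R ⊗ S` to the Segre product, which forgets the components of bidegree
`(m, n)` with `m ≠ n`. -/
def segreRetraction (𝒜 : ℕ → Submodule k R) [GradedAlgebra 𝒜] (ℬ : ℕ → Submodule k S)
    [GradedAlgebra ℬ] : R ⊗[k] S →ₗ[k] SegreRing 𝒜 ℬ :=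
  DirectSum.coeLinearMap (segreGrading 𝒜 ℬ) ∘ₗ segreDecompose 𝒜 ℬ

lemma segreRetraction_tmul {n : ℕ} (r : 𝒜 n) (s : ℬ n) :
    segreRetraction 𝒜 ℬ ((r : R) ⊗ₜ (s : S)) = (segreIncl 𝒜 ℬ n (r ⊗ₜ s) : SegreRing 𝒜 ℬ) := by
  rw [segreRetraction, LinearMap.comp_apply, segreDecompose_tmul, DirectSum.coeLinearMap_lof]

lemma segreRetraction_tmul_of_ne {m n : ℕ} (hmn : m ≠ n) (r : 𝒜 m) (s : ℬ n) :
    segreRetraction 𝒜 ℬ ((r : R) ⊗ₜ (s : S)) = 0 := by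
  have h : decomposeLinearEquiv 𝒜 (r : R) = DirectSum.lof k ℕ (fun i => 𝒜 i) m r :=
    decomposeLinearEquiv_apply_coe 𝒜 m r
  have h' : gradedProj ℬ m (s : S) = 0 := by
    change (decompose ℬ (s : S)) m = 0
    rw [decompose_coe, of_eq_of_ne _ _ _ hmn]
  rw [segreRetraction, LinearMap.comp_apply, segreDecompose, TensorProduct.lift.tmul,
    LinearMap.comp_apply, LinearEquiv.coe_coe, h, DirectSum.toModule_lof]
  simp [h']

lemma segreRetraction_mul (t : SegreRing 𝒜 ℬ) (x : R ⊗[k] S) :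
    segreRetraction 𝒜 ℬ (segreVal 𝒜 ℬ t * x) = t * segreRetraction 𝒜 ℬ x := by
  induction t using DirectSum.Decomposition.inductionOn (segreGrading 𝒜 ℬ) with
  | zero => simp
  | add a b ha hb => rw [map_add, add_mul, map_add, ha, hb, add_mul]
  | @homogeneous i t =>
  induction t using GrMod.segreGrading_induction with
  | zero => simp
  | add a b ha hb => rw [Submodule.coe_add, map_add, add_mul, map_add, ha, hb, add_mul]
  | tmul r s =>
  induction x using TensorProduct.induction_on with
  | zero => simp
  | add x y hx hy => rw [mul_add, map_add, hx, hy, map_add, mul_add]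
  | tmul x y =>
  induction x using DirectSum.Decomposition.inductionOn 𝒜 with
  | zero => simp
  | add a b ha hb => rw [TensorProduct.add_tmul, mul_add, map_add, ha, hb, map_add, mul_add]
  | @homogeneous m x =>
  induction y using DirectSum.Decomposition.inductionOn ℬ with
  | zero => simp
  | add a b ha hb => rw [TensorProduct.tmul_add, mul_add, map_add, ha, hb, map_add, mul_add]
  | @homogeneous n y =>
  have e : segreVal 𝒜 ℬ (segreIncl 𝒜 ℬ i (r ⊗ₜ s) : SegreRing 𝒜 ℬ) * ((x : R) ⊗ₜ[k] (y : S)) =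
      ((⟨r * x, SetLike.mul_mem_graded r.2 x.2⟩ : 𝒜 (i + m)) : R) ⊗ₜ[k]
        ((⟨s * y, SetLike.mul_mem_graded s.2 y.2⟩ : ℬ (i + n)) : S) :=
    Algebra.TensorProduct.tmul_mul_tmul _ _ _ _
  rw [e]
  rcases eq_or_ne m n with rfl | hmn
  · rw [segreRetraction_tmul, segreRetraction_tmul]
    exact Subtype.ext (Algebra.TensorProduct.tmul_mul_tmul _ _ _ _).symm
  · rw [segreRetraction_tmul_of_ne hmn, segreRetraction_tmul_of_ne (by omega), mul_zero]

lemma segreRetraction_one : segreRetraction 𝒜 ℬ 1 = 1 :=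
  segreRetraction_tmul (⟨1, SetLike.one_mem_graded 𝒜⟩ : 𝒜 0) (⟨1, SetLike.one_mem_graded ℬ⟩ : ℬ 0)

/-- The Segre product is a direct summand, as a module over itself, of the Noetherian ring
`R ⊗ S`. -/
lemma isNoetherianRing_segreRing (h𝒜 : IsStandardGraded 𝒜) (hℬ : IsStandardGraded ℬ) :
    IsNoetherianRing (SegreRing 𝒜 ℬ) := by
  have := h𝒜.finiteType
  have := hℬ.isNoetherianRing
  have : Algebra.FiniteType S (S ⊗[k] R) := inferInstance
  have := Algebra.FiniteType.isNoetherianRing S (S ⊗[k] R)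
  have : IsNoetherianRing (R ⊗[k] S) :=
    isNoetherianRing_of_ringEquiv _ (Algebra.TensorProduct.comm k S R).toRingEquiv
  let φ : SegreRing 𝒜 ℬ →+* R ⊗[k] S := (segreVal 𝒜 ℬ).toRingHom
  have hφ : ∀ 𝔞 : Ideal (SegreRing 𝒜 ℬ), (𝔞.map φ).comap φ = 𝔞 := by
    refine fun 𝔞 => le_antisymm (fun a ha => ?_) Ideal.le_comap_map
    have key : ∀ x ∈ 𝔞.map φ, ∀ y, segreRetraction 𝒜 ℬ (y * x) ∈ 𝔞 := fun x hx => by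
      refine Submodule.span_induction (p := fun x _ => ∀ y, segreRetraction 𝒜 ℬ (y * x) ∈ 𝔞)
        ?_ (by simp) (fun x z _ _ hx hz y => ?_) (fun c x _ hx y => ?_) hx
      · rintro _ ⟨b, hb, rfl⟩ y
        rw [mul_comm]
        exact (segreRetraction_mul b y).symm ▸ 𝔞.mul_mem_right _ hb
      · rw [mul_add, map_add]
        exact add_mem (hx y) (hz y)
      · rw [smul_eq_mul, ← mul_assoc]
        exact hx _
    have := key _ ha (1 : R ⊗[k] S)
    rw [one_mul, show φ a = segreVal 𝒜 ℬ a * 1 from (mul_one _).symm, segreRetraction_mul,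
      segreRetraction_one, mul_one] at this
    exact this
  have hmono : StrictMono (Ideal.map φ) :=
    Monotone.strictMono_of_injective (fun _ _ h => Ideal.map_mono h)
      (Function.LeftInverse.injective hφ)
  have : WellFoundedGT (Ideal (SegreRing 𝒜 ℬ)) := hmono.wellFoundedGT
  exact isNoetherian_iff'.2 this

end SegreRing

namespace GrMod

section SegreForms

variable {k R S : Type u} [Field k] [CommRing R] [Algebra k R] [CommRing S] [Algebra k S]
variable {𝒜 : ℕ → Submodule k R} [GradedAlgebra 𝒜] {ℬ : ℕ → Submodule k S} [GradedAlgebra ℬ]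
variable {D r s : ℕ} {f : Fin r → 𝒜 D} {g : Fin s → ℬ D} {I : Ideal R} {J : Ideal S}

/-! ### Torsion in Segre products -/

/-- The forms `f_i ⊗ g_j` of the Segre product. -/
def segreForms (f : Fin r → 𝒜 D) (g : Fin s → ℬ D) (l : Fin (r * s)) : segreGrading 𝒜 ℬ D :=
  segreIncl 𝒜 ℬ D (f (finProdFinEquiv.symm l).1 ⊗ₜ g (finProdFinEquiv.symm l).2)

lemma segreForms_apply (f : Fin r → 𝒜 D) (g : Fin s → ℬ D) (i : Fin r) (j : Fin s) :
    segreForms f g (finProdFinEquiv (i, j)) = segreIncl 𝒜 ℬ D (f i ⊗ₜ g j) := by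
  simp [segreForms]

lemma forall_segreForms {p : segreGrading 𝒜 ℬ D → Prop} :
    (∀ l, p (segreForms f g l)) ↔ ∀ i j, p (segreIncl 𝒜 ℬ D (f i ⊗ₜ g j)) :=
  ⟨fun h i j => segreForms_apply f g i j ▸ h _, fun h _ => h _ _⟩

lemma exists_homogeneous_coefficients (f : Fin r → 𝒜 D) {m : ℕ} {x : R} (hx : x ∈ 𝒜 (m + D))
    (hxf : x ∈ Ideal.span (Set.range fun i => (f i : R))) :
    ∃ c : Fin r → 𝒜 m, ∑ i, (c i : R) * f i = x := by
  obtain ⟨c, rfl⟩ := Ideal.mem_span_range_iff_exists_fun.1 hxf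
  refine ⟨fun i => decompose 𝒜 (c i) m, ?_⟩
  rw [← decompose_of_mem_same 𝒜 hx, decompose_sum, DFinsupp.finsetSum_apply,
    AddSubmonoidClass.coe_finsetSum]
  refine Finset.sum_congr rfl fun i _ => ?_
  rw [coe_decompose_mul_of_right_mem 𝒜 _ (f i).2, if_pos (Nat.le_add_left D m),
    Nat.add_sub_cancel]

lemma eq_zero_of_mem_span_of_lt (f : Fin r → 𝒜 D) {m : ℕ} (hm : m < D) {x : R} (hx : x ∈ 𝒜 m)
    (hxf : x ∈ Ideal.span (Set.range fun i => (f i : R))) : x = 0 := by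
  obtain ⟨c, rfl⟩ := Ideal.mem_span_range_iff_exists_fun.1 hxf
  rw [← decompose_of_mem_same 𝒜 hx, decompose_sum, DFinsupp.finsetSum_apply,
    AddSubmonoidClass.coe_finsetSum]
  refine Finset.sum_eq_zero fun i _ => ?_
  rw [coe_decompose_mul_of_right_mem 𝒜 _ (f i).2, if_neg (by omega)]

lemma segreIncl_mem_span {m : ℕ} (x : 𝒜 m) (y : ℬ m)
    (hx : (x : R) ∈ Ideal.span (Set.range fun i => (f i : R)))
    (hy : (y : S) ∈ Ideal.span (Set.range fun i => (g i : S))) :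
    (segreIncl 𝒜 ℬ m (x ⊗ₜ y) : SegreRing 𝒜 ℬ) ∈
      Ideal.span (Set.range fun l => (segreForms f g l : SegreRing 𝒜 ℬ)) := by
  rcases lt_or_ge m D with hm | hm
  · have : x = 0 := Subtype.ext (eq_zero_of_mem_span_of_lt f hm x.2 hx)
    rw [this, TensorProduct.zero_tmul, map_zero]
    exact zero_mem _
  · obtain ⟨m, rfl⟩ := Nat.exists_eq_add_of_le' hm
    obtain ⟨c, hc⟩ := exists_homogeneous_coefficients f x.2 hx
    obtain ⟨d, hd⟩ := exists_homogeneous_coefficients g y.2 hy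
    have e : (segreIncl 𝒜 ℬ _ (x ⊗ₜ y) : SegreRing 𝒜 ℬ) = ∑ i, ∑ j,
        (segreIncl 𝒜 ℬ m (c i ⊗ₜ d j) : SegreRing 𝒜 ℬ) *
          (segreForms f g (finProdFinEquiv (i, j)) : SegreRing 𝒜 ℬ) := by
      refine segreVal_injective 𝒜 ℬ ?_
      simp only [map_sum, map_mul, segreForms_apply]
      change (x : R) ⊗ₜ[k] (y : S) = ∑ i, ∑ j, ((c i : R) ⊗ₜ[k] (d j : S)) *
        ((f i : R) ⊗ₜ[k] (g j : S))
      simp only [Algebra.TensorProduct.tmul_mul_tmul, ← TensorProduct.tmul_sum,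
        ← TensorProduct.sum_tmul, hc, hd]
    rw [e]
    exact Ideal.sum_mem _ fun i _ => Ideal.sum_mem _ fun j _ =>
      Ideal.mul_mem_left _ _ (Ideal.subset_span ⟨_, rfl⟩)

lemma segreIncl_pow {n : ℕ} (a : 𝒜 n) (b : ℬ n) (t : ℕ) :
    (segreIncl 𝒜 ℬ n (a ⊗ₜ b) : SegreRing 𝒜 ℬ) ^ t =
      (segreIncl 𝒜 ℬ (t • n) ((⟨(a : R) ^ t, SetLike.pow_mem_graded t a.2⟩ : 𝒜 (t • n)) ⊗ₜ
        (⟨(b : S) ^ t, SetLike.pow_mem_graded t b.2⟩ : ℬ (t • n))) : SegreRing 𝒜 ℬ) := by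
  refine segreVal_injective 𝒜 ℬ ?_
  rw [map_pow]
  exact Algebra.TensorProduct.tmul_pow _ _ _

/-- The forms `f_i ⊗ g_j` generate `I # J` up to radical. -/
lemma GeneratesRadical.segreForms (hf : GeneratesRadical f I) (hg : GeneratesRadical g J) :
    GeneratesRadical (segreForms f g) (segreIdeal 𝒜 ℬ I J) where
  pos := hf.pos
  mem := (forall_segreForms (p := fun a : segreGrading 𝒜 ℬ D =>
    (a : SegreRing 𝒜 ℬ) ∈ segreIdeal 𝒜 ℬ I J)).2 fun i j =>
      tmul_mem_segreSpan ⟨hf.mem i, (f i).2⟩ ⟨hg.mem j, (g j).2⟩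
  le_radical := by
    intro t ht
    let K := Ideal.span (Set.range fun l => (GrMod.segreForms f g l : SegreRing 𝒜 ℬ))
    obtain ⟨t', ht', hK⟩ : ∃ t', segreVal 𝒜 ℬ t' = segreVal 𝒜 ℬ t ∧ t' ∈ K.radical := by
      refine segreSpan_induction (p := fun x => ∃ t', segreVal 𝒜 ℬ t' = x ∧ t' ∈ K.radical)
        ⟨0, map_zero _, zero_mem _⟩ (fun n a ha b hb => ?_) ?_ _ ht
      · refine ⟨segreIncl 𝒜 ℬ n ((⟨a, ha.2⟩ : 𝒜 n) ⊗ₜ (⟨b, hb.2⟩ : ℬ n)), rfl, ?_⟩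
        obtain ⟨p, hp⟩ := hf.le_radical ha.1
        obtain ⟨q, hq⟩ := hg.le_radical hb.1
        refine ⟨p + q, ?_⟩
        rw [segreIncl_pow]
        refine segreIncl_mem_span _ _ ?_ ?_
        · change a ^ (p + q) ∈ _
          rw [pow_add]
          exact Ideal.mul_mem_right _ _ hp
        · change b ^ (p + q) ∈ _
          rw [pow_add]
          exact Ideal.mul_mem_left _ _ hq
      · rintro _ _ ⟨x, rfl, hx⟩ ⟨y, rfl, hy⟩
        exact ⟨x + y, map_add _ _ _, add_mem hx hy⟩
    exact segreVal_injective 𝒜 ℬ ht' ▸ hK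

lemma segre_act {M : GrMod 𝒜} {N : GrMod ℬ} {i : ℕ} {m n : ℤ} (h : (i : ℤ) + m = n) (a : 𝒜 i)
    (b : ℬ i) (z : M.X m ⊗[k] N.X m) : (segre M N).act h (segreIncl 𝒜 ℬ i (a ⊗ₜ b)) z =
      TensorProduct.map (M.act h a) (N.act h b) z := by
  change segreAct M N h (segreIncl 𝒜 ℬ i (a ⊗ₜ b)) z = _
  induction z using TensorProduct.induction_on with
  | zero => simp
  | tmul x y => rw [segreAct_tmul, TensorProduct.map_tmul]
  | add x y hx hy => rw [map_add, map_add, hx, hy]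

lemma isTors_iff_act {M : GrMod 𝒜} {a : 𝒜 D} {n : ℤ} {x : M.X n} : IsTors (a : R) x ↔
    ∃ t : ℕ, M.act (n := (t • D : ℕ) + n) rfl
      (⟨(a : R) ^ t, SetLike.pow_mem_graded t a.2⟩ : 𝒜 (t • D)) x = 0 := by
  refine exists_congr fun t => ?_
  rw [← map_eq_zero_iff _ (M.of_injective _), ← M.smul_of]

lemma isTors_segre_iff {M : GrMod 𝒜} {N : GrMod ℬ} {a : 𝒜 D} {b : ℬ D} {n : ℤ}
    {z : M.X n ⊗[k] N.X n} :
    IsTors (M := segre M N) (n := n) (segreIncl 𝒜 ℬ D (a ⊗ₜ b) : SegreRing 𝒜 ℬ) z ↔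
      ∃ t : ℕ, TensorProduct.map
        (M.act (n := (t • D : ℕ) + n) rfl
          (⟨(a : R) ^ t, SetLike.pow_mem_graded t a.2⟩ : 𝒜 (t • D)))
        (N.act (n := (t • D : ℕ) + n) rfl
          (⟨(b : S) ^ t, SetLike.pow_mem_graded t b.2⟩ : ℬ (t • D))) z = 0 := by
  refine isTors_iff_act.trans (exists_congr fun t => ?_)
  rw [← segre_act]
  have e : (⟨(segreIncl 𝒜 ℬ D (a ⊗ₜ b) : SegreRing 𝒜 ℬ) ^ t, SetLike.pow_mem_graded t
      (segreIncl 𝒜 ℬ D (a ⊗ₜ b)).2⟩ : segreGrading 𝒜 ℬ (t • D)) = segreIncl 𝒜 ℬ (t • D)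
        ((⟨(a : R) ^ t, SetLike.pow_mem_graded t a.2⟩ : 𝒜 (t • D)) ⊗ₜ
          (⟨(b : S) ^ t, SetLike.pow_mem_graded t b.2⟩ : ℬ (t • D))) :=
    Subtype.ext (segreIncl_pow a b t)
  rw [e]
  rfl

lemma isTors_tmul_left {M : GrMod 𝒜} {N : GrMod ℬ} {a : 𝒜 D} (b : ℬ D) {n : ℤ}
    {x : M.X n} (hx : IsTors (a : R) x) (y : N.X n) :
    IsTors (M := segre M N) (n := n) (segreIncl 𝒜 ℬ D (a ⊗ₜ b) : SegreRing 𝒜 ℬ) (x ⊗ₜ y) := by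
  obtain ⟨t, ht⟩ := isTors_iff_act.1 hx
  exact isTors_segre_iff.2 ⟨t, by rw [TensorProduct.map_tmul, ht, TensorProduct.zero_tmul]⟩

lemma isTors_tmul_right {M : GrMod 𝒜} {N : GrMod ℬ} (a : 𝒜 D) {b : ℬ D} {n : ℤ}
    (x : M.X n) {y : N.X n} (hy : IsTors (b : S) y) :
    IsTors (M := segre M N) (n := n) (segreIncl 𝒜 ℬ D (a ⊗ₜ b) : SegreRing 𝒜 ℬ) (x ⊗ₜ y) := by
  obtain ⟨t, ht⟩ := isTors_iff_act.1 hy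
  exact isTors_segre_iff.2 ⟨t, by rw [TensorProduct.map_tmul, ht, TensorProduct.tmul_zero]⟩

lemma Pure.segre {E : GrMod 𝒜} {F : GrMod ℬ} (hE : Pure f E) (hF : Pure g F) :
    Pure (segreForms f g) (segre E F) := by
  refine (forall_segreForms (p := fun a : segreGrading 𝒜 ℬ D => (∀ {m n : ℤ} (e : (D : ℤ) + m = n),
    Function.Bijective ((GrMod.segre E F).act e a)) ∨
      ∀ (n : ℤ) (x : (GrMod.segre E F).X n), IsTors (a : SegreRing 𝒜 ℬ) x)).2 fun i j => ?_
  rcases hE i with hi | hi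
  · rcases hF j with hj | hj
    · left
      intro m n e
      have : ⇑((GrMod.segre E F).act e (segreIncl 𝒜 ℬ D (f i ⊗ₜ g j))) =
          TensorProduct.congr (LinearEquiv.ofBijective _ (hi e))
            (LinearEquiv.ofBijective _ (hj e)) :=
        funext fun z => segre_act e (f i) (g j) z
      rw [this]
      exact LinearEquiv.bijective _
    · right
      intro n z
      change E.X n ⊗[k] F.X n at z
      induction z using TensorProduct.induction_on with
      | zero => exact IsTors.zero
      | tmul x y => exact isTors_tmul_right _ x (hj n y)
      | add x y hx hy => exact hx.add hy
  · right
    intro n z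
    change E.X n ⊗[k] F.X n at z
    induction z using TensorProduct.induction_on with
    | zero => exact IsTors.zero
    | tmul x y => exact isTors_tmul_left _ (hi n x) y
    | add x y hx hy => exact hx.add hy

lemma IsShortExact.segre_left {A B C : GrMod 𝒜} {i : A ⟶ B} {p : B ⟶ C} (h : IsShortExact i p)
    (F : GrMod ℬ) : IsShortExact (segreMap i (𝟙 F)) (segreMap p (𝟙 F)) where
  inj n := Module.Flat.rTensor_preserves_injective_linearMap (i.app n) (h.inj n)
  exact n := rTensor_exact (F.X n) (h.exact n) (h.surj n)
  surj n := LinearMap.rTensor_surjective (F.X n) (h.surj n)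

lemma IsShortExact.segre_right {A B C : GrMod ℬ} {i : A ⟶ B} {p : B ⟶ C} (h : IsShortExact i p)
    (E : GrMod 𝒜) : IsShortExact (segreMap (𝟙 E) i) (segreMap (𝟙 E) p) where
  inj n := Module.Flat.lTensor_preserves_injective_linearMap (i.app n) (h.inj n)
  exact n := lTensor_exact (E.X n) (h.exact n) (h.surj n)
  surj n := LinearMap.lTensor_surjective (E.X n) (h.surj n)

/-- Segre products of injective graded modules are acyclic: acyclicity is stable under extensions,
so `injective_induction` in both variables reduces to Segre products of pure modules, which are
pure. -/
lemma acyclic_segre [IsNoetherianRing R] [IsNoetherianRing S] (f : Fin r → 𝒜 D) (g : Fin s → ℬ D)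
    (E : GrMod 𝒜) [Injective E] (F : GrMod ℬ) [Injective F] :
    Acyclic (segreForms f g) (segre E F) := by
  refine injective_induction f (P := fun E => Acyclic (segreForms f g) (segre E F))
    (fun E hE => ?_) (fun i p _ h _ hA hC => hA.extension hC (h.segre_left F)) E
  exact injective_induction g (P := fun F => Acyclic (segreForms f g) (segre E F))
    (fun F hF => (hE.segre hF).acyclic)
    (fun i p _ h _ hA hC => hA.extension hC (h.segre_right E)) F

/-- Families of linear maps which are jointly injective remain so after tensoring them. -/
lemma eq_zero_of_forall_map_eq_zero {A B A' B' : Type*} [AddCommGroup A] [Module k A]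
    [AddCommGroup B] [Module k B] [AddCommGroup A'] [Module k A'] [AddCommGroup B'] [Module k B']
    {α : Fin r → A →ₗ[k] A'} {β : Fin s → B →ₗ[k] B'} (hα : ∀ x, (∀ i, α i x = 0) → x = 0)
    (hβ : ∀ y, (∀ j, β j y = 0) → y = 0) (z : A ⊗[k] B)
    (hz : ∀ i j, TensorProduct.map (α i) (β j) z = 0) : z = 0 := by
  have hα' : Function.Injective (LinearMap.pi α) :=
    LinearMap.ker_eq_bot.1 (LinearMap.ker_eq_bot'.2 fun x hx => hα x fun i => congrFun hx i)
  have hβ' : Function.Injective (LinearMap.pi β) :=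
    LinearMap.ker_eq_bot.1 (LinearMap.ker_eq_bot'.2 fun x hx => hβ x fun i => congrFun hx i)
  refine (map_eq_zero_iff _ (TensorProduct.map_injective_of_flat_flat _ _ hα' hβ')).1 ?_
  have key : TensorProduct.map (LinearMap.pi α) (LinearMap.pi β) = ∑ i, ∑ j,
      TensorProduct.map (LinearMap.single k (fun _ => A') i) (LinearMap.single k (fun _ => B') j) ∘ₗ
        TensorProduct.map (α i) (β j) := by
    refine TensorProduct.ext' fun x y => ?_
    simp only [LinearMap.sum_apply, LinearMap.comp_apply, TensorProduct.map_tmul,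
      ← TensorProduct.tmul_sum, ← TensorProduct.sum_tmul]
    congr 1
    · exact (LinearMap.sum_single_apply (fun _ => A') (LinearMap.pi α x)).symm
    · exact (LinearMap.sum_single_apply (fun _ => B') (LinearMap.pi β y)).symm
  rw [key]
  simp [LinearMap.sum_apply, hz]

/-- Segre products of torsion-free modules are torsion-free. -/
lemma segre_torsionFree {A : GrMod 𝒜} {B : GrMod ℬ}
    (hA : ∀ n (x : A.X n), (∀ i, IsTors (f i : R) x) → x = 0)
    (hB : ∀ n (y : B.X n), (∀ j, IsTors (g j : S) y) → y = 0) {n : ℤ} (z : (segre A B).X n)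
    (hz : ∀ l, IsTors (segreForms f g l : SegreRing 𝒜 ℬ) z) : z = 0 := by
  rw [forall_segreForms (p := fun a : segreGrading 𝒜 ℬ D => IsTors (a : SegreRing 𝒜 ℬ) z)] at hz
  choose t ht using fun i j => hz i j
  let T := Finset.univ.sup fun p : Fin r × Fin s => t p.1 p.2
  have hT : ∀ i j, (segreIncl 𝒜 ℬ D (f i ⊗ₜ g j) : SegreRing 𝒜 ℬ) ^ T • (segre A B).of n z = 0 :=
    fun i j => pow_smul_eq_zero_of_le (ht i j)
      (Finset.le_sup (f := fun p : Fin r × Fin s => t p.1 p.2) (Finset.mem_univ (i, j)))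
  refine eq_zero_of_forall_map_eq_zero (k := k)
    (α := fun i => A.act (n := (T • D : ℕ) + n) rfl
      (⟨(f i : R) ^ T, SetLike.pow_mem_graded T (f i).2⟩ : 𝒜 (T • D)))
    (β := fun j => B.act (n := (T • D : ℕ) + n) rfl
      (⟨(g j : S) ^ T, SetLike.pow_mem_graded T (g j).2⟩ : ℬ (T • D)))
    (fun x hx => hA n x fun i => isTors_iff_act.2 ⟨T, hx i⟩)
    (fun y hy => hB n y fun j => isTors_iff_act.2 ⟨T, hy j⟩) z fun i j => ?_
  refine (segre_act rfl _ _ z).symm.trans ?_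
  have h0 := hT i j
  rw [segreIncl_pow] at h0
  exact (segre A B).of_injective _
    (((smul_of _ rfl _ z).symm.trans h0).trans (map_zero ((segre A B).of _)).symm)

/-- The kernel of the Segre product of two surjections onto torsion-free modules with torsion
kernels is the torsion. -/
lemma segreMap_eq_zero_iff {E A : GrMod 𝒜} {F B : GrMod ℬ} {p : E ⟶ A} {q : F ⟶ B}
    (hp : ∀ n, Function.Surjective (p.app n)) (hq : ∀ n, Function.Surjective (q.app n))
    (hp' : ∀ n x, p.app n x = 0 → ∀ i, IsTors (f i : R) x)
    (hq' : ∀ n y, q.app n y = 0 → ∀ j, IsTors (g j : S) y)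
    (hA : ∀ n (x : A.X n), (∀ i, IsTors (f i : R) x) → x = 0)
    (hB : ∀ n (y : B.X n), (∀ j, IsTors (g j : S) y) → y = 0) {n : ℤ} (z : (segre E F).X n) :
    (segreMap p q).app n z = 0 ↔ ∀ l, IsTors (segreForms f g l : SegreRing 𝒜 ℬ) z := by
  refine ⟨fun h => ?_, fun h => segre_torsionFree hA hB _ fun l => (h l).map (segreMap p q)⟩
  change E.X n ⊗[k] F.X n at z
  have h' : z ∈ LinearMap.ker (TensorProduct.map (p.app n) (q.app n)) := h
  rw [TensorProduct.map_ker (f := (LinearMap.ker (p.app n)).subtype)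
    (f' := (LinearMap.ker (q.app n)).subtype) (fun x => by simp) (hp n) (fun x => by simp)
    (hq n), Submodule.mem_sup] at h'
  obtain ⟨_, ⟨x, rfl⟩, _, ⟨y, rfl⟩, rfl⟩ := h'
  clear h
  refine (forall_segreForms (p := fun a : segreGrading 𝒜 ℬ D => IsTors (M := segre E F) (n := n)
    (a : SegreRing 𝒜 ℬ) _)).2 fun i j => IsTors.add ?_ ?_
  · induction x using TensorProduct.induction_on with
    | zero => exact IsTors.zero
    | tmul x y => exact isTors_tmul_right _ x (hq' n _ y.2 j)
    | add x y hx hy => rw [map_add]; exact hx.add hy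
  · induction y using TensorProduct.induction_on with
    | zero => exact IsTors.zero
    | tmul x y => exact isTors_tmul_left _ (hp' n _ x.2 i) y
    | add x y hx hy => rw [map_add]; exact hx.add hy

end SegreForms

end GrMod

namespace GrMod

section Products

variable {k R : Type u} [Field k] [CommRing R] [Algebra k R]
variable {𝒜 : ℕ → Submodule k R} [GradedAlgebra 𝒜]

/-! ### Total complexes -/

/-- The product of a family of graded modules. -/
def piObj {ι : Type} (X : ι → GrMod 𝒜) : GrMod 𝒜 where
  X n := ∀ p, (X p).X n
  act h := LinearMap.mk₂ k (fun r x p => (X p).act h r (x p))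
    (by intros; ext; simp) (by intros; ext; simp) (by intros; ext; simp) (by intros; ext; simp)
  one_act h x := funext fun p => (X p).one_act h (x p)
  mul_act h₁ h₂ h₃ r s x := funext fun p => (X p).mul_act h₁ h₂ h₃ r s (x p)

section

variable {ι : Type} {X Y : ι → GrMod 𝒜}

/-- The projections of a product. -/
def piProj (X : ι → GrMod 𝒜) (p : ι) : piObj X ⟶ X p :=
  ⟨fun _ => LinearMap.proj p, fun _ _ _ => rfl⟩

/-- Homomorphisms to a product. -/
def piLift {Z : GrMod 𝒜} (φ : ∀ p, Z ⟶ X p) : Z ⟶ piObj X :=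
  ⟨fun n => LinearMap.pi fun p => (φ p).app n, fun h r x => funext fun p => (φ p).comm h r x⟩

/-- The product of a family of homomorphisms. -/
def piMap (φ : ∀ p, X p ⟶ Y p) : piObj X ⟶ piObj Y := piLift fun p => piProj X p ≫ φ p

lemma piMap_surjective {φ : ∀ p, X p ⟶ Y p} (n : ℤ)
    (h : ∀ p, Function.Surjective ((φ p).app n)) : Function.Surjective ((piMap φ).app n) := fun y =>
  ⟨fun p => (h p (y p)).choose, funext fun p => (h p (y p)).choose_spec⟩

lemma isTors_pi [Finite ι] {D : ℕ} {a : 𝒜 D} {n : ℤ} {x : (piObj X).X n} :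
    IsTors (a : R) x ↔ ∀ p, IsTors (M := X p) (a : R) (x p) := by
  refine ⟨fun h p => h.map (piProj X p), fun h => ?_⟩
  cases nonempty_fintype ι
  choose t ht using h
  let T := Finset.univ.sup t
  refine isTors_iff_act.2 ⟨T, funext fun p => ?_⟩
  have h1 := pow_smul_eq_zero_of_le (ht p) (Finset.le_sup (f := t) (Finset.mem_univ p) : t p ≤ T)
  exact (X p).of_injective _ (((smul_of (X p) rfl (⟨(a : R) ^ T, SetLike.pow_mem_graded T a.2⟩ :
    𝒜 (T • D)) (x p)).symm.trans h1).trans (map_zero _).symm)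

lemma Acyclic.pi [Finite ι] {D r : ℕ} {f : Fin r → 𝒜 D} (h : ∀ p, Acyclic f (X p)) :
    Acyclic f (piObj X) := by
  intro l m n e x hx
  choose y hy hy' using fun p => h p l e (x p) fun j hj => isTors_pi.1 (hx j hj) p
  exact ⟨y, fun j hj => isTors_pi.2 fun p => hy p j hj, isTors_pi.2 hy'⟩

end

/-- A scalar multiple of a homomorphism. -/
def smulHom {M N : GrMod 𝒜} (c : k) (φ : M ⟶ N) : M ⟶ N :=
  ⟨fun n => c • φ.app n, fun h r x => by simp [φ.comm]⟩

/-- A first quadrant double complex of graded modules, with commuting squares. -/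
structure GrBicomplex (𝒜 : ℕ → Submodule k R) [GradedAlgebra 𝒜] where
  /-- the terms -/
  X : ℕ → ℕ → GrMod 𝒜
  /-- the differentials in the first direction -/
  dL : ∀ i j, X i j ⟶ X (i + 1) j
  /-- the differentials in the second direction -/
  dR : ∀ i j, X i j ⟶ X i (j + 1)
  dL_dL : ∀ i j n x, (dL (i + 1) j).app n ((dL i j).app n x) = 0
  dR_dR : ∀ i j n x, (dR i (j + 1)).app n ((dR i j).app n x) = 0
  dL_dR : ∀ i j n x, (dL i (j + 1)).app n ((dR i j).app n x) =
    (dR (i + 1) j).app n ((dL i j).app n x)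

/-- The pairs of natural numbers with sum `q`. -/
abbrev SumPairs (q : ℕ) : Type := {p : ℕ × ℕ // p.1 + p.2 = q}

instance (q : ℕ) : Finite (SumPairs q) :=
  Finite.of_injective (fun p : SumPairs q => (⟨p.1.1, by have := p.2; omega⟩ : Fin (q + 1)))
    fun p p' h => by
      have h1 : p.1.1 = p'.1.1 := congrArg Fin.val h
      have h2 := p.2
      have h3 := p'.2
      exact Subtype.ext (Prod.ext h1 (by omega))

namespace GrBicomplex

variable (B : GrBicomplex 𝒜)

/-- The terms of the total complex. -/
def totX (q : ℕ) : GrMod 𝒜 := piObj fun p : SumPairs q => B.X p.1.1 p.1.2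

/-- The part of the differential of the total complex coming from the first direction. -/
def totL (q : ℕ) : ∀ p : SumPairs (q + 1), B.totX q ⟶ B.X p.1.1 p.1.2
  | ⟨(0, _), _⟩ => 0
  | ⟨(i + 1, j), h⟩ => piProj (fun p : SumPairs q => B.X p.1.1 p.1.2)
      ⟨(i, j), by dsimp only at h ⊢; omega⟩ ≫ B.dL i j

/-- The part of the differential of the total complex coming from the second direction, with the
sign `(-1)^i`. -/
def totR (q : ℕ) : ∀ p : SumPairs (q + 1), B.totX q ⟶ B.X p.1.1 p.1.2
  | ⟨(_, 0), _⟩ => 0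
  | ⟨(i, j + 1), h⟩ => piProj (fun p : SumPairs q => B.X p.1.1 p.1.2)
      ⟨(i, j), by dsimp only at h ⊢; omega⟩ ≫ smulHom ((-1) ^ i) (B.dR i j)

/-- The differential of the total complex. -/
def totD (q : ℕ) : B.totX q ⟶ B.totX (q + 1) := piLift fun p => B.totL q p + B.totR q p

variable {B} {q : ℕ} {n : ℤ}

/-- The component of bidegree `(i, j)` of an element of the total complex. -/
def entry (w : (B.totX q).X n) (i j : ℕ) (h : i + j = q) : (B.X i j).X n :=
  (piProj (fun p : SumPairs q => B.X p.1.1 p.1.2) ⟨(i, j), h⟩).app n w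

/-- The element of the total complex with given components. -/
def ofEntries (v : ∀ i j, i + j = q → (B.X i j).X n) : (B.totX q).X n := fun p => v _ _ p.2

lemma entry_ofEntries (v : ∀ i j, i + j = q → (B.X i j).X n) (i j : ℕ) (h : i + j = q) :
    entry (ofEntries v) i j h = v i j h := rfl

lemma entry_ext {w w' : (B.totX q).X n} (h : ∀ i j h, entry w i j h = entry w' i j h) : w = w' :=
  funext fun p => h _ _ p.2

lemma entry_zero (i j : ℕ) (h : i + j = q) : entry (0 : (B.totX q).X n) i j h = 0 := rfl

lemma entry_sub (w w' : (B.totX q).X n) (i j : ℕ) (h : i + j = q) :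
    entry (w - w') i j h = entry w i j h - entry w' i j h := rfl

lemma totD_zero_succ (w : (B.totX q).X n) (j : ℕ) (h : 0 + (j + 1) = q + 1) :
    entry ((B.totD q).app n w) 0 (j + 1) h = (B.dR 0 j).app n (entry w 0 j (by omega)) := by
  change 0 + ((-1 : k) ^ 0) • (B.dR 0 j).app n (entry w 0 j (by omega)) = _
  rw [pow_zero, one_smul, zero_add]

lemma totD_succ_zero (w : (B.totX q).X n) (i : ℕ) (h : i + 1 + 0 = q + 1) :
    entry ((B.totD q).app n w) (i + 1) 0 h = (B.dL i 0).app n (entry w i 0 (by omega)) :=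
  add_zero _

lemma totD_succ_succ (w : (B.totX q).X n) (i j : ℕ) (h : i + 1 + (j + 1) = q + 1) :
    entry ((B.totD q).app n w) (i + 1) (j + 1) h =
      (B.dL i (j + 1)).app n (entry w i (j + 1) (by omega)) +
        ((-1 : k) ^ (i + 1)) • (B.dR (i + 1) j).app n (entry w (i + 1) j (by omega)) :=
  rfl

variable (B)

/-- The total complex. -/
def tot : GrComplex 𝒜 where
  X := B.totX
  d := B.totD
  d_d q n w := by
    refine entry_ext fun i j h => ?_
    rw [entry_zero]
    match i, j, h with
    | 0, 0, h => exact absurd h (by simp)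
    | 0, 1, h => exact absurd h (by simp)
    | 1, 0, h => exact absurd h (by simp)
    | 0, j + 2, h => rw [totD_zero_succ, totD_zero_succ, B.dR_dR]
    | i + 2, 0, h => rw [totD_succ_zero, totD_succ_zero, B.dL_dL]
    | 1, 1, h =>
      rw [totD_succ_succ, totD_zero_succ, totD_succ_zero, B.dL_dR]
      simp
    | 1, j + 2, h =>
      rw [totD_succ_succ, totD_zero_succ, totD_succ_succ, map_add, map_smul, B.dR_dR, B.dL_dR]
      simp
    | i + 2, 1, h =>
      rw [totD_succ_succ, totD_succ_zero, totD_succ_succ, map_add, map_smul, B.dL_dL, B.dL_dR,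
        pow_succ (-1 : k) (i + 1)]
      module
    | i + 2, j + 2, h =>
      rw [totD_succ_succ, totD_succ_succ, totD_succ_succ, map_add, map_smul, map_add, map_smul,
        B.dL_dL, B.dL_dR, B.dR_dR, pow_succ (-1 : k) (i + 1)]
      module

variable {B}

/-- The homotopy argument in the proof of the Künneth formula. Let `s_L`, `s_R` be contracting
homotopies of the rows and columns onto the images of the operators `π_L`, `π_R`. Then a cocycle
`w` of the total complex is cohomologous to `π_L π_R w`; a primitive of the difference has
components `s_L w_{i+1,j} + (-1)^i π_L s_R w_{i,j+1}`. -/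
lemma sub_mem_boundaries
    {πL πR : ∀ i j, (B.X i j).X n →ₗ[k] (B.X i j).X n}
    {sL : ∀ i j, (B.X (i + 1) j).X n →ₗ[k] (B.X i j).X n}
    {sR : ∀ i j, (B.X i (j + 1)).X n →ₗ[k] (B.X i j).X n}
    (hL0 : ∀ j x, x - πL 0 j x = sL 0 j ((B.dL 0 j).app n x))
    (hL : ∀ i j x, x - πL (i + 1) j x = sL (i + 1) j ((B.dL (i + 1) j).app n x) +
      (B.dL i j).app n (sL i j x))
    (hR0 : ∀ i x, x - πR i 0 x = sR i 0 ((B.dR i 0).app n x))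
    (hR : ∀ i j x, x - πR i (j + 1) x = sR i (j + 1) ((B.dR i (j + 1)).app n x) +
      (B.dR i j).app n (sR i j x))
    (hdπ : ∀ i j x, (B.dL i j).app n (πL i j x) = 0)
    (hπd : ∀ i j x, πL (i + 1) j ((B.dL i j).app n x) = 0)
    (hsd : ∀ i j x, sL i (j + 1) ((B.dR (i + 1) j).app n x) = (B.dR i j).app n (sL i j x))
    (hπdR : ∀ i j x, πL i (j + 1) ((B.dR i j).app n x) = (B.dR i j).app n (πL i j x))
    (hπs : ∀ i j x, πL i j (sR i j x) = sR i j (πL i (j + 1) x))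
    (w : (B.totX q).X n) (hw : (B.totD q).app n w = 0) :
    w - ofEntries (fun i j h => πL i j (πR i j (entry w i j h))) ∈ B.tot.boundaries q n := by
  have key : ∀ i j x, x - πL i j (πR i j x) = (x - πL i j x) + πL i j (x - πR i j x) := by
    intro i j x
    rw [map_sub]
    abel
  -- the consequences of the cocycle condition
  have c0R : ∀ j (h : 0 + j = q), (B.dR 0 j).app n (entry w 0 j h) = 0 := fun j h => by
    rw [← totD_zero_succ w _ (by omega), hw, entry_zero]
  have cL0 : ∀ i (h : i + 0 = q), (B.dL i 0).app n (entry w i 0 h) = 0 := fun i h => by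
    rw [← totD_succ_zero w _ (by omega), hw, entry_zero]
  have c : ∀ i j (h : i + (j + 1) = q), (B.dL i (j + 1)).app n (entry w i (j + 1) h) =
      -(((-1 : k) ^ (i + 1)) • (B.dR (i + 1) j).app n (entry w (i + 1) j (by omega))) :=
    fun i j h => by
      rw [eq_neg_iff_add_eq_zero, ← totD_succ_succ w _ _ (by omega), hw, entry_zero]
  have cπ : ∀ i j (h : i + j = q), πL i (j + 1) ((B.dR i j).app n (entry w i j h)) = 0 := by
    intro i j h
    cases i with
    | zero => rw [c0R, map_zero]
    | succ i =>
      have := congrArg (πL (i + 1) (j + 1)) (c i j (by omega))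
      rw [hπd, map_neg, map_smul, zero_eq_neg, smul_eq_zero] at this
      exact this.resolve_left (pow_ne_zero _ (neg_ne_zero.2 one_ne_zero))
  have cs : ∀ i j (h : i + j = q), πL i j (sR i j ((B.dR i j).app n (entry w i j h))) = 0 :=
    fun i j h => by rw [hπs, cπ, map_zero]
  cases q with
  | zero =>
    have : w - ofEntries (fun i j h => πL i j (πR i j (entry w i j h))) = 0 :=
      entry_ext fun i j h => by
        obtain ⟨rfl, rfl⟩ : i = 0 ∧ j = 0 := by omega
        rw [entry_sub, entry_ofEntries, key, hL0, cL0, hR0, cs, map_zero, add_zero, entry_zero]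
    rw [this]
    exact Submodule.zero_mem _
  | succ q =>
    refine ⟨ofEntries fun i j h => sL i j (entry w (i + 1) j (by omega)) +
      ((-1 : k) ^ i) • πL i j (sR i j (entry w i (j + 1) (by omega))), entry_ext fun i j h => ?_⟩
    rw [entry_sub, entry_ofEntries, key]
    change entry ((B.totD q).app n _) i j h = _
    match i, j, h with
    | 0, 0, h => exact absurd h (by simp)
    | 0, j + 1, h =>
      rw [totD_zero_succ, entry_ofEntries, hL0, hR, map_add, map_add, cs, c 0 j h, map_smul,
        ← hsd, ← hπdR]
      simp
    | i + 1, 0, h =>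
      rw [totD_succ_zero, entry_ofEntries, hL, hR0, cs, cL0, map_add, map_smul, hdπ]
      simp
    | i + 1, j + 1, h =>
      have hsign : ((-1 : k) ^ (i + 1)) * (-1) ^ (i + 1) = 1 := by
        rw [← mul_pow]
        simp
      rw [totD_succ_succ, entry_ofEntries, entry_ofEntries, hL, hR, map_add, map_add, map_add,
        map_smul, map_smul, hdπ, cs, c (i + 1) j h, ← hsd, ← hπdR, map_neg, map_smul, smul_add,
        smul_smul, hsign, pow_succ (-1 : k) (i + 1)]
      module

end GrBicomplex

end Products

end GrMod

namespace GrMod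

/-! ### The Künneth formula -/

section LinearAlgebra

variable {k : Type*} [Field k]
variable {A A₁ A₂ B B₁ B₂ : Type*} [AddCommGroup A] [AddCommGroup A₁] [AddCommGroup A₂]
  [AddCommGroup B] [AddCommGroup B₁] [AddCommGroup B₂]
  [Module k A] [Module k A₁] [Module k A₂] [Module k B] [Module k B₁] [Module k B₂]

/-- Linear maps of vector spaces have a generalized inverse. -/
lemma exists_pseudoinverse (φ : A →ₗ[k] B) : ∃ ψ : B →ₗ[k] A, ∀ x, φ (ψ (φ x)) = φ x := by
  obtain ⟨g, hg⟩ := φ.rangeRestrict.exists_rightInverse_of_surjective φ.range_rangeRestrict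
  obtain ⟨ψ, hψ⟩ := LinearMap.exists_extend g
  refine ⟨ψ, fun x => ?_⟩
  have h1 : ψ (φ x) = g (φ.rangeRestrict x) := LinearMap.congr_fun hψ (φ.rangeRestrict x)
  rw [h1]
  exact congrArg Subtype.val (LinearMap.congr_fun hg (φ.rangeRestrict x))

lemma rTensor_rTensor_eq_zero {φ : A →ₗ[k] A₁} {ψ : A₁ →ₗ[k] A₂} (h : ∀ x, ψ (φ x) = 0)
    (z : A ⊗[k] B) : ψ.rTensor B (φ.rTensor B z) = 0 := by
  rw [← LinearMap.rTensor_comp_apply, show ψ ∘ₗ φ = 0 from LinearMap.ext h,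
    LinearMap.rTensor_zero, LinearMap.zero_apply]

lemma lTensor_lTensor_eq_zero {φ : B →ₗ[k] B₁} {ψ : B₁ →ₗ[k] B₂} (h : ∀ x, ψ (φ x) = 0)
    (z : A ⊗[k] B) : ψ.lTensor A (φ.lTensor A z) = 0 := by
  rw [← LinearMap.lTensor_comp_apply, show ψ ∘ₗ φ = 0 from LinearMap.ext h,
    LinearMap.lTensor_zero, LinearMap.zero_apply]

lemma rTensor_lTensor_comm (φ : A →ₗ[k] A₁) (ψ : B →ₗ[k] B₁) (z : A ⊗[k] B) :
    φ.rTensor B₁ (ψ.lTensor A z) = ψ.lTensor A₁ (φ.rTensor B z) := by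
  rw [← LinearMap.comp_apply, ← LinearMap.comp_apply, LinearMap.rTensor_comp_lTensor,
    LinearMap.lTensor_comp_rTensor]

lemma sub_rTensor_eq {π : A →ₗ[k] A} {d : A →ₗ[k] A₁} {s : A₁ →ₗ[k] A}
    (h : ∀ x, x - π x = s (d x)) (z : A ⊗[k] B) :
    z - π.rTensor B z = s.rTensor B (d.rTensor B z) := by
  have e : LinearMap.id - π = s ∘ₗ d := LinearMap.ext h
  rw [← LinearMap.rTensor_comp_apply, ← e, LinearMap.rTensor_sub, LinearMap.rTensor_id]
  rfl

lemma sub_rTensor_eq_add {π : A →ₗ[k] A} {d : A →ₗ[k] A₁} {s : A₁ →ₗ[k] A} {d' : A₂ →ₗ[k] A}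
    {s' : A →ₗ[k] A₂} (h : ∀ x, x - π x = s (d x) + d' (s' x)) (z : A ⊗[k] B) :
    z - π.rTensor B z = s.rTensor B (d.rTensor B z) + d'.rTensor B (s'.rTensor B z) := by
  have e : LinearMap.id - π = s ∘ₗ d + d' ∘ₗ s' := LinearMap.ext h
  rw [← LinearMap.rTensor_comp_apply, ← LinearMap.rTensor_comp_apply, ← LinearMap.add_apply,
    ← LinearMap.rTensor_add, ← e, LinearMap.rTensor_sub, LinearMap.rTensor_id]
  rfl

lemma sub_lTensor_eq {π : B →ₗ[k] B} {d : B →ₗ[k] B₁} {s : B₁ →ₗ[k] B}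
    (h : ∀ x, x - π x = s (d x)) (z : A ⊗[k] B) :
    z - π.lTensor A z = s.lTensor A (d.lTensor A z) := by
  have e : LinearMap.id - π = s ∘ₗ d := LinearMap.ext h
  rw [← LinearMap.lTensor_comp_apply, ← e, LinearMap.lTensor_sub, LinearMap.lTensor_id]
  rfl

lemma sub_lTensor_eq_add {π : B →ₗ[k] B} {d : B →ₗ[k] B₁} {s : B₁ →ₗ[k] B} {d' : B₂ →ₗ[k] B}
    {s' : B →ₗ[k] B₂} (h : ∀ x, x - π x = s (d x) + d' (s' x)) (z : A ⊗[k] B) :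
    z - π.lTensor A z = s.lTensor A (d.lTensor A z) + d'.lTensor A (s'.lTensor A z) := by
  have e : LinearMap.id - π = s ∘ₗ d + d' ∘ₗ s' := LinearMap.ext h
  rw [← LinearMap.lTensor_comp_apply, ← LinearMap.lTensor_comp_apply, ← LinearMap.add_apply,
    ← LinearMap.lTensor_add, ← e, LinearMap.lTensor_sub, LinearMap.lTensor_id]
  rfl

end LinearAlgebra

section Splitting

variable {k R : Type u} [Field k] [CommRing R] [Algebra k R]
variable {𝒜 : ℕ → Submodule k R} [GradedAlgebra 𝒜]

namespace GrComplex

/-- In a fixed degree a complex of vector spaces retracts, up to the homotopy `s`, onto the image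
of an endomorphism `π` with values in the cocycles and vanishing on the coboundaries. -/
structure IsSplitting (C : GrComplex 𝒜) (n : ℤ) (π : ∀ q, (C.X q).X n →ₗ[k] (C.X q).X n)
    (s : ∀ q, (C.X (q + 1)).X n →ₗ[k] (C.X q).X n) : Prop where
  sub_zero : ∀ x, x - π 0 x = s 0 ((C.d 0).app n x)
  sub_succ : ∀ q x, x - π (q + 1) x = s (q + 1) ((C.d (q + 1)).app n x) + (C.d q).app n (s q x)
  d_proj : ∀ q x, (C.d q).app n (π q x) = 0
  proj_d : ∀ q x, π (q + 1) ((C.d q).app n x) = 0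

/-- Complexes of vector spaces split: generalized inverses of the differentials are a homotopy. -/
lemma exists_isSplitting (C : GrComplex 𝒜) (n : ℤ) : ∃ π s, C.IsSplitting n π s := by
  choose s hs using fun q => exists_pseudoinverse ((C.d q).app n)
  let π : ∀ q, (C.X q).X n →ₗ[k] (C.X q).X n
    | 0 => LinearMap.id - s 0 ∘ₗ (C.d 0).app n
    | q + 1 => LinearMap.id - s (q + 1) ∘ₗ (C.d (q + 1)).app n - (C.d q).app n ∘ₗ s q
  refine ⟨π, s, fun x => sub_sub_cancel _ _, fun q x => ?_, fun q x => ?_, fun q x => ?_⟩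
  · change x - (x - s (q + 1) _ - (C.d q).app n (s q x)) = _
    abel
  · cases q with
    | zero =>
      change (C.d 0).app n (x - s 0 _) = 0
      rw [map_sub, hs, sub_self]
    | succ q =>
      change (C.d (q + 1)).app n (x - s (q + 1) _ - (C.d q).app n (s q x)) = 0
      rw [map_sub, map_sub, hs, C.d_d, sub_self, sub_zero]
  · change (C.d q).app n x - s (q + 1) ((C.d (q + 1)).app n ((C.d q).app n x)) -
      (C.d q).app n (s q ((C.d q).app n x)) = 0
    rw [C.d_d, map_zero, hs, sub_zero, sub_self]

namespace IsSplitting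

variable {C : GrComplex 𝒜} {n : ℤ} {π : ∀ q, (C.X q).X n →ₗ[k] (C.X q).X n}
  {s : ∀ q, (C.X (q + 1)).X n →ₗ[k] (C.X q).X n}

/-- The retraction onto cocycles. -/
def toCocycles (h : C.IsSplitting n π s) (q : ℕ) : (C.X q).X n →ₗ[k] (C.cocycles q).X n :=
  (π q).codRestrict _ (h.d_proj q)

lemma cocyclesι_toCocycles (h : C.IsSplitting n π s) (q : ℕ) (x : (C.X q).X n) :
    (C.cocyclesι q).app n (h.toCocycles q x) = π q x := rfl

lemma toCocycles_d (h : C.IsSplitting n π s) (q : ℕ) (x : (C.X q).X n) :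
    h.toCocycles (q + 1) ((C.d q).app n x) = 0 := Subtype.ext (h.proj_d q x)

lemma cohπ_toCocycles (h : C.IsSplitting n π s) (q : ℕ) (z : (C.cocycles q).X n) :
    (C.cohπ q).app n (h.toCocycles q ((C.cocyclesι q).app n z)) = (C.cohπ q).app n z := by
  refine (C.cohπ_eq ?_).symm
  rw [cocyclesι_toCocycles]
  have hz : (C.d q).app n ((C.cocyclesι q).app n z) = 0 := z.2
  cases q with
  | zero =>
    rw [h.sub_zero, hz, map_zero]
    exact Submodule.zero_mem _
  | succ q =>
    rw [h.sub_succ, hz, map_zero, zero_add]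
    exact ⟨_, rfl⟩

/-- The retraction onto cocycles factors, on cocycles, through the cohomology. -/
lemma exists_section (h : C.IsSplitting n π s) (q : ℕ) :
    ∃ σ : (C.coh q).X n →ₗ[k] (C.cocycles q).X n, ∀ z,
      σ ((C.cohπ q).app n z) = h.toCocycles q ((C.cocyclesι q).app n z) := by
  refine ⟨((C.boundaries q n).comap ((C.cocyclesι q).app n)).liftQ
    (h.toCocycles q ∘ₗ (C.cocyclesι q).app n) fun z hz => ?_, fun z => rfl⟩
  rw [LinearMap.mem_ker, LinearMap.comp_apply]
  have hz' : (C.cocyclesι q).app n z ∈ C.boundaries q n := hz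
  cases q with
  | zero =>
    have : (C.cocyclesι 0).app n z = 0 := hz'
    rw [this, map_zero]
  | succ q =>
    obtain ⟨y, hy⟩ := hz'
    rw [← hy, toCocycles_d]

end IsSplitting

end GrComplex

end Splitting

section Kunneth

variable {k R S : Type u} [Field k] [CommRing R] [Algebra k R] [CommRing S] [Algebra k S]
variable {𝒜 : ℕ → Submodule k R} [GradedAlgebra 𝒜] {ℬ : ℕ → Submodule k S} [GradedAlgebra ℬ]

lemma segreMap_segreMap {M M' M'' : GrMod 𝒜} {N N' N'' : GrMod ℬ} (φ : M ⟶ M') (φ' : M' ⟶ M'')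
    (ψ : N ⟶ N') (ψ' : N' ⟶ N'') (n : ℤ) (z : (segre M N).X n) :
    (segreMap φ' ψ').app n ((segreMap φ ψ).app n z) = (segreMap (φ ≫ φ') (ψ ≫ ψ')).app n z :=
  (LinearMap.congr_fun (TensorProduct.map_comp (φ'.app n) (ψ'.app n) (φ.app n) (ψ.app n)) z).symm

/-- The double complex `C_i # C'_j`. -/
def segreBicomplex (C : GrComplex 𝒜) (C' : GrComplex ℬ) : GrBicomplex (segreGrading 𝒜 ℬ) where
  X i j := segre (C.X i) (C'.X j)
  dL i _ := segreMap (C.d i) (𝟙 _)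
  dR _ j := segreMap (𝟙 _) (C'.d j)
  dL_dL i _ n z := rTensor_rTensor_eq_zero (C.d_d i n) z
  dR_dR _ j n z := lTensor_lTensor_eq_zero (C'.d_d j n) z
  dL_dR i j n z := rTensor_lTensor_comm ((C.d i).app n) ((C'.d j).app n) z

variable (C : GrComplex 𝒜) (C' : GrComplex ℬ) (q : ℕ)

/-- The products of cocycles of `C` and `C'`. -/
def kunnethCocycles : GrMod (segreGrading 𝒜 ℬ) :=
  piObj fun p : SumPairs q => segre (C.cocycles p.1.1) (C'.cocycles p.1.2)

/-- The cocycles of the total complex given by products of cocycles. -/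
def kunnethι : kunnethCocycles C C' q ⟶ (segreBicomplex C C').totX q :=
  piMap fun p : SumPairs q => segreMap (C.cocyclesι p.1.1) (C'.cocyclesι p.1.2)

/-- The products of cohomology classes of `C` and `C'`. -/
def kunnethCoh : GrMod (segreGrading 𝒜 ℬ) :=
  piObj fun p : SumPairs q => segre (C.coh p.1.1) (C'.coh p.1.2)

/-- The products of the classes of cocycles. -/
def kunnethπ : kunnethCocycles C C' q ⟶ kunnethCoh C C' q :=
  piMap fun p : SumPairs q => segreMap (C.cohπ p.1.1) (C'.cohπ p.1.2)

lemma kunnethπ_surjective (n : ℤ) : Function.Surjective ((kunnethπ C C' q).app n) :=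
  piMap_surjective n fun p =>
    TensorProduct.map_surjective (C.cohπ_surjective p.1.1 n) (C'.cohπ_surjective p.1.2 n)

variable {C C' q}

lemma totD_kunnethι (n : ℤ) (y : (kunnethCocycles C C' q).X n) :
    ((segreBicomplex C C').totD q).app n ((kunnethι C C' q).app n y) = 0 := by
  have hL : ∀ i j (h : i + j = q), ((segreBicomplex C C').dL i j).app n
      (GrBicomplex.entry ((kunnethι C C' q).app n y) i j h) = 0 := fun i j h => by
    refine (segreMap_segreMap (C.cocyclesι i) (C.d i) (C'.cocyclesι j) (𝟙 _) n
      (y ⟨(i, j), h⟩)).trans ?_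
    rw [show C.cocyclesι i ≫ C.d i = 0 from subι_ker_comp _]
    exact LinearMap.congr_fun (TensorProduct.map_zero_left _) _
  have hR : ∀ i j (h : i + j = q), ((segreBicomplex C C').dR i j).app n
      (GrBicomplex.entry ((kunnethι C C' q).app n y) i j h) = 0 := fun i j h => by
    refine (segreMap_segreMap (C.cocyclesι i) (𝟙 _) (C'.cocyclesι j) (C'.d j) n
      (y ⟨(i, j), h⟩)).trans ?_
    rw [show C'.cocyclesι j ≫ C'.d j = 0 from subι_ker_comp _]
    exact LinearMap.congr_fun (TensorProduct.map_zero_right _) _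
  refine GrBicomplex.entry_ext fun i j h => ?_
  rw [GrBicomplex.entry_zero]
  match i, j, h with
  | 0, 0, h => exact absurd h (by simp)
  | 0, j + 1, h => rw [GrBicomplex.totD_zero_succ, hR]
  | i + 1, 0, h => rw [GrBicomplex.totD_succ_zero, hL]
  | i + 1, j + 1, h => rw [GrBicomplex.totD_succ_succ, hL, hR, smul_zero, add_zero]

section Splitting

variable {n : ℤ} {π : ∀ q, (C.X q).X n →ₗ[k] (C.X q).X n}
  {s : ∀ q, (C.X (q + 1)).X n →ₗ[k] (C.X q).X n} {π' : ∀ q, (C'.X q).X n →ₗ[k] (C'.X q).X n}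
  {s' : ∀ q, (C'.X (q + 1)).X n →ₗ[k] (C'.X q).X n}

/-- The products of the retractions onto cocycles. -/
def kunnethRetraction (h : C.IsSplitting n π s) (h' : C'.IsSplitting n π' s') :
    ((segreBicomplex C C').totX q).X n →ₗ[k] (kunnethCocycles C C' q).X n :=
  LinearMap.pi fun p : SumPairs q =>
    TensorProduct.map (h.toCocycles p.1.1) (h'.toCocycles p.1.2) ∘ₗ
      LinearMap.proj (φ := fun p : SumPairs q => ((segreBicomplex C C').X p.1.1 p.1.2).X n) p

/-- Cocycles of the total complex are cohomologous to sums of products of cocycles. -/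
lemma sub_kunnethRetraction_mem (h : C.IsSplitting n π s) (h' : C'.IsSplitting n π' s')
    (w : ((segreBicomplex C C').totX q).X n)
    (hw : ((segreBicomplex C C').totD q).app n w = 0) :
    w - (kunnethι C C' q).app n (kunnethRetraction h h' w) ∈
      (segreBicomplex C C').tot.boundaries q n := by
  have e : (kunnethι C C' q).app n (kunnethRetraction h h' w) =
      GrBicomplex.ofEntries (B := segreBicomplex C C') fun i j hij =>
        (π i).rTensor _ ((π' j).lTensor _ (GrBicomplex.entry w i j hij)) := by
    refine GrBicomplex.entry_ext fun i j hij => ?_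
    change TensorProduct.map ((C.cocyclesι i).app n) ((C'.cocyclesι j).app n)
      (TensorProduct.map (h.toCocycles i) (h'.toCocycles j) (GrBicomplex.entry w i j hij)) =
        (π i).rTensor _ ((π' j).lTensor _ (GrBicomplex.entry w i j hij))
    generalize GrBicomplex.entry w i j hij = z
    change (C.X i).X n ⊗[k] (C'.X j).X n at z
    induction z using TensorProduct.induction_on with
    | zero => simp only [map_zero]
    | tmul x y => rfl
    | add x y hx hy => simp only [map_add, hx, hy]
  rw [e]
  exact GrBicomplex.sub_mem_boundaries (B := segreBicomplex C C')
    (πL := fun i j => (π i).rTensor ((C'.X j).X n)) (πR := fun i j => (π' j).lTensor ((C.X i).X n))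
    (sL := fun i j => (s i).rTensor ((C'.X j).X n)) (sR := fun i j => (s' j).lTensor ((C.X i).X n))
    (fun _ z => sub_rTensor_eq h.sub_zero z) (fun i _ z => sub_rTensor_eq_add (h.sub_succ i) z)
    (fun _ z => sub_lTensor_eq h'.sub_zero z) (fun _ j z => sub_lTensor_eq_add (h'.sub_succ j) z)
    (fun i _ z => rTensor_rTensor_eq_zero (h.d_proj i) z)
    (fun i _ z => rTensor_rTensor_eq_zero (h.proj_d i) z)
    (fun i j z => rTensor_lTensor_comm (s i) ((C'.d j).app n) z)
    (fun i j z => rTensor_lTensor_comm (π i) ((C'.d j).app n) z)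
    (fun i j z => rTensor_lTensor_comm (π i) (s' j) z) w hw

lemma kunnethRetraction_boundaries (h : C.IsSplitting n π s) (h' : C'.IsSplitting n π' s')
    {w : ((segreBicomplex C C').totX q).X n} (hw : w ∈ (segreBicomplex C C').tot.boundaries q n) :
    kunnethRetraction h h' w = 0 := by
  cases q with
  | zero =>
    obtain rfl : w = 0 := hw
    exact map_zero _
  | succ q =>
    obtain ⟨w, rfl⟩ := hw
    funext p
    obtain ⟨⟨i, j⟩, hij⟩ := p
    change TensorProduct.map (h.toCocycles i) (h'.toCocycles j)
      (GrBicomplex.entry (((segreBicomplex C C').totD q).app n w) i j hij) = 0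
    have hL : ∀ i j (z : (C.X i).X n ⊗[k] (C'.X j).X n), TensorProduct.map (h.toCocycles (i + 1))
        (h'.toCocycles j) (((segreBicomplex C C').dL i j).app n z) = 0 := fun i j z => by
      have e : TensorProduct.map (h.toCocycles (i + 1)) (h'.toCocycles j) ∘ₗ
          ((C.d i).app n).rTensor _ = 0 := TensorProduct.ext' fun x y => by
        rw [LinearMap.comp_apply, LinearMap.rTensor_tmul, TensorProduct.map_tmul, h.toCocycles_d,
          TensorProduct.zero_tmul, LinearMap.zero_apply]
      exact LinearMap.congr_fun e z
    have hR : ∀ i j (z : (C.X i).X n ⊗[k] (C'.X j).X n), TensorProduct.map (h.toCocycles i)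
        (h'.toCocycles (j + 1)) (((segreBicomplex C C').dR i j).app n z) = 0 := fun i j z => by
      have e : TensorProduct.map (h.toCocycles i) (h'.toCocycles (j + 1)) ∘ₗ
          ((C'.d j).app n).lTensor _ = 0 := TensorProduct.ext' fun x y => by
        rw [LinearMap.comp_apply, LinearMap.lTensor_tmul, TensorProduct.map_tmul, h'.toCocycles_d,
          TensorProduct.tmul_zero, LinearMap.zero_apply]
      exact LinearMap.congr_fun e z
    match i, j, hij with
    | 0, 0, hij => exact absurd hij (by simp)
    | 0, j + 1, hij => exact (congrArg _ (GrBicomplex.totD_zero_succ w j hij)).trans (hR _ _ _)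
    | i + 1, 0, hij => exact (congrArg _ (GrBicomplex.totD_succ_zero w i hij)).trans (hL _ _ _)
    | i + 1, j + 1, hij =>
      refine (congrArg _ (GrBicomplex.totD_succ_succ w i j hij)).trans ((map_add _ _ _).trans ?_)
      exact (congrArg₂ (· + ·) (hL _ _ _) ((map_smul _ _ _).trans
        ((congrArg _ (hR _ _ _)).trans (smul_zero _)))).trans (add_zero 0)

/-- A sum of products of cocycles is a coboundary if and only if its class in the tensor product of
the cohomologies vanishes. -/
lemma kunnethι_mem_boundaries_iff (y : (kunnethCocycles C C' q).X n) :
    (kunnethι C C' q).app n y ∈ (segreBicomplex C C').tot.boundaries q n ↔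
      (kunnethπ C C' q).app n y = 0 := by
  obtain ⟨π, s, h⟩ := C.exists_isSplitting n
  obtain ⟨π', s', h'⟩ := C'.exists_isSplitting n
  constructor
  · intro hy
    have h0 := kunnethRetraction_boundaries h h' hy
    funext p
    obtain ⟨⟨i, j⟩, hij⟩ := p
    have h1 : TensorProduct.map ((C.cohπ i).app n) ((C'.cohπ j).app n)
        (kunnethRetraction h h' ((kunnethι C C' q).app n y) ⟨(i, j), hij⟩) = 0 := by
      rw [h0]
      exact map_zero _
    change TensorProduct.map ((C.cohπ i).app n) ((C'.cohπ j).app n) (y ⟨(i, j), hij⟩) = 0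
    refine Eq.trans ?_ h1
    change _ = TensorProduct.map ((C.cohπ i).app n) ((C'.cohπ j).app n)
      (TensorProduct.map (h.toCocycles i) (h'.toCocycles j)
        (TensorProduct.map ((C.cocyclesι i).app n) ((C'.cocyclesι j).app n) (y ⟨(i, j), hij⟩)))
    generalize y ⟨(i, j), hij⟩ = z
    change (C.cocycles i).X n ⊗[k] (C'.cocycles j).X n at z
    induction z using TensorProduct.induction_on with
    | zero => simp only [map_zero]
    | tmul x y => simp only [TensorProduct.map_tmul, h.cohπ_toCocycles, h'.cohπ_toCocycles]
    | add x y hx hy => simp only [map_add, hx, hy]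
  · intro hy
    have h0 := sub_kunnethRetraction_mem h h' _ (totD_kunnethι n y)
    have h1 : kunnethRetraction h h' ((kunnethι C C' q).app n y) = 0 := by
      funext p
      obtain ⟨⟨i, j⟩, hij⟩ := p
      obtain ⟨σ, hσ⟩ := h.exists_section i
      obtain ⟨σ', hσ'⟩ := h'.exists_section j
      change TensorProduct.map (h.toCocycles i) (h'.toCocycles j)
        (TensorProduct.map ((C.cocyclesι i).app n) ((C'.cocyclesι j).app n) (y ⟨(i, j), hij⟩)) = 0
      have h2 : TensorProduct.map ((C.cohπ i).app n) ((C'.cohπ j).app n) (y ⟨(i, j), hij⟩) = 0 :=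
        congrFun hy ⟨(i, j), hij⟩
      refine Eq.trans ?_ ((congrArg (TensorProduct.map σ σ') h2).trans (map_zero _))
      generalize y ⟨(i, j), hij⟩ = z
      change (C.cocycles i).X n ⊗[k] (C'.cocycles j).X n at z
      induction z using TensorProduct.induction_on with
      | zero => simp only [map_zero]
      | tmul x y => simp only [TensorProduct.map_tmul, hσ, hσ']
      | add x y hx hy => simp only [map_add, hx, hy]
    rwa [h1, map_zero, sub_zero] at h0

lemma exists_kunneth_representative (w : ((segreBicomplex C C').totX q).X n)
    (hw : ((segreBicomplex C C').totD q).app n w = 0) : ∃ y : (kunnethCocycles C C' q).X n,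
      w - (kunnethι C C' q).app n y ∈ (segreBicomplex C C').tot.boundaries q n := by
  obtain ⟨π, s, h⟩ := C.exists_isSplitting n
  obtain ⟨π', s', h'⟩ := C'.exists_isSplitting n
  exact ⟨_, sub_kunnethRetraction_mem h h' w hw⟩

end Splitting

variable (C C' q) in
/-- The Künneth formula for the total complex of a Segre product of complexes: the products of
cocycles map onto both sides, with the same kernel. -/
def kunnethIso : kunnethCoh C C' q ≅ (segreBicomplex C C').tot.coh q :=
  isoOfSurjective (kunnethπ C C' q)
    (GrComplex.cocyclesLift (segreBicomplex C C').tot (kunnethι C C' q) totD_kunnethι ≫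
      GrComplex.cohπ _ q)
    (kunnethπ_surjective C C' q)
    (fun n z => by
      obtain ⟨w, rfl⟩ := GrComplex.cohπ_surjective _ _ _ z
      obtain ⟨y, hy⟩ := exists_kunneth_representative w.1 w.2
      exact ⟨y, (GrComplex.cohπ_eq _ hy).symm⟩)
    (fun n => by
      ext y
      exact (kunnethι_mem_boundaries_iff y).symm.trans
        (GrComplex.cohπ_eq_zero (segreBicomplex C C').tot (q := q) (n := n)
          (x := ⟨(kunnethι C C' q).app n y, totD_kunnethι n y⟩)).symm)

end Kunneth

end GrMod

namespace GrMod

/-! ### Segre products of resolutions and of saturated complexes -/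

section TotZero

variable {k R S : Type u} [Field k] [CommRing R] [Algebra k R] [CommRing S] [Algebra k S]
variable {𝒜 : ℕ → Submodule k R} [GradedAlgebra 𝒜] {ℬ : ℕ → Submodule k S} [GradedAlgebra ℬ]
variable {C W : GrComplex 𝒜} {C' W' : GrComplex ℬ} {X : GrMod 𝒜} {X' : GrMod ℬ}

/-- Segre products of commutative squares commute. -/
lemma segreMap_congr {M N M' : GrMod 𝒜} {A B A' : GrMod ℬ} {φ : M ⟶ M'} {φ' : M' ⟶ N}
    {ψ : A ⟶ A'} {ψ' : A' ⟶ B} {M'' : GrMod 𝒜} {A'' : GrMod ℬ} {χ : M ⟶ M''} {χ' : M'' ⟶ N}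
    {ω : A ⟶ A''} {ω' : A'' ⟶ B} (h : φ ≫ φ' = χ ≫ χ') (h' : ψ ≫ ψ' = ω ≫ ω') (n : ℤ)
    (z : (segre M A).X n) : (segreMap φ' ψ').app n ((segreMap φ ψ).app n z) =
      (segreMap χ' ω').app n ((segreMap χ ω).app n z) := by
  rw [segreMap_segreMap, segreMap_segreMap, h, h']

/-- The Segre product of augmentations `X → C⁰` and `X' → C'⁰`. -/
def segreAugmentation (η : X ⟶ C.X 0) (η' : X' ⟶ C'.X 0) :
    segre X X' ⟶ (segreBicomplex C C').totX 0 :=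
  piLift fun
    | ⟨(0, 0), _⟩ => segreMap η η'
    | ⟨(_ + 1, _), _⟩ => 0
    | ⟨(0, _ + 1), _⟩ => 0

lemma entry_segreAugmentation (η : X ⟶ C.X 0) (η' : X' ⟶ C'.X 0) {n : ℤ} (x : (segre X X').X n) :
    GrBicomplex.entry ((segreAugmentation η η').app n x) 0 0 rfl = (segreMap η η').app n x := rfl

lemma entry_zero_ext {B : GrBicomplex 𝒜} {n : ℤ} {w w' : (B.totX 0).X n}
    (h : GrBicomplex.entry w 0 0 rfl = GrBicomplex.entry w' 0 0 rfl) : w = w' :=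
  GrBicomplex.entry_ext fun i j hij => by
    obtain ⟨rfl, rfl⟩ : i = 0 ∧ j = 0 := by omega
    exact h

lemma segreAugmentation_injective {η : X ⟶ C.X 0} {η' : X' ⟶ C'.X 0}
    (h : ∀ n, Function.Injective (η.app n)) (h' : ∀ n, Function.Injective (η'.app n)) (n : ℤ) :
    Function.Injective ((segreAugmentation η η').app n) := fun _ _ hxy =>
  TensorProduct.map_injective_of_flat_flat (η.app n) (η'.app n) (h n) (h' n)
    (congrArg (fun w : ((segreBicomplex C C').totX 0).X n => GrBicomplex.entry w 0 0 rfl) hxy)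

/-- In degree zero the cocycles of the total complex are the products of cocycles. -/
lemma segreAugmentation_exact {η : X ⟶ C.X 0} {η' : X' ⟶ C'.X 0}
    (h : ∀ n, Function.Exact (η.app n) ((C.d 0).app n))
    (h' : ∀ n, Function.Exact (η'.app n) ((C'.d 0).app n)) (n : ℤ) :
    Function.Exact ((segreAugmentation η η').app n) (((segreBicomplex C C').totD 0).app n) := by
  intro w
  constructor
  · intro hw
    obtain ⟨y, hy⟩ := exists_kunneth_representative w hw
    have hwy : w = (kunnethι C C' 0).app n y := sub_eq_zero.1 ((Submodule.mem_bot k).1 hy)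
    let ζ := C.cocyclesLift η fun n x => (h n).apply_apply_eq_zero x
    let ζ' := C'.cocyclesLift η' fun n x => (h' n).apply_apply_eq_zero x
    have hζ : Function.Surjective (ζ.app n) := fun z => by
      obtain ⟨x, hx⟩ := (h n z.1).1 z.2
      exact ⟨x, Subtype.ext hx⟩
    have hζ' : Function.Surjective (ζ'.app n) := fun z => by
      obtain ⟨x, hx⟩ := (h' n z.1).1 z.2
      exact ⟨x, Subtype.ext hx⟩
    obtain ⟨x, hx⟩ := TensorProduct.map_surjective hζ hζ' (y ⟨(0, 0), rfl⟩)
    refine ⟨x, ?_⟩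
    rw [hwy]
    refine entry_zero_ext ((entry_segreAugmentation η η' x).trans ?_)
    change _ = TensorProduct.map ((C.cocyclesι 0).app n) ((C'.cocyclesι 0).app n) (y ⟨(0, 0), rfl⟩)
    rw [← hx]
    exact (segreMap_segreMap ζ (C.cocyclesι 0) ζ' (C'.cocyclesι 0) n x).symm
  · rintro ⟨x, rfl⟩
    refine GrBicomplex.entry_ext fun i j hij => ?_
    rw [GrBicomplex.entry_zero]
    match i, j, hij with
    | 0, 0, hij => exact absurd hij (by simp)
    | 0, j + 2, hij => exact absurd hij (by omega)
    | 0, 1, hij =>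
      rw [GrBicomplex.totD_zero_succ, entry_segreAugmentation]
      refine (segreMap_segreMap η (𝟙 _) η' (C'.d 0) n x).trans ?_
      rw [show η' ≫ C'.d 0 = 0 from hom_ext fun n x => (h' n).apply_apply_eq_zero x]
      exact LinearMap.congr_fun (TensorProduct.map_zero_right _) x
    | i + 1, j + 1, hij => exact absurd hij (by omega)
    | i + 2, 0, hij => exact absurd hij (by omega)
    | 1, 0, hij =>
      rw [GrBicomplex.totD_succ_zero, entry_segreAugmentation]
      refine (segreMap_segreMap η (C.d 0) η' (𝟙 _) n x).trans ?_
      rw [show η ≫ C.d 0 = 0 from hom_ext fun n x => (h n).apply_apply_eq_zero x]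
      exact LinearMap.congr_fun (TensorProduct.map_zero_left _) x

lemma GrComplex.IsResolution.coh_eq_zero {η : X ⟶ C.X 0} (h : C.IsResolution η) (q : ℕ) {n : ℤ}
    (x : (C.coh (q + 1)).X n) : x = 0 := by
  obtain ⟨z, rfl⟩ := C.cohπ_surjective _ _ x
  exact C.cohπ_eq_zero.2 ((h.exact_succ q n z.1).1 z.2)

/-- The total complex of the Segre product of two resolutions is a resolution. -/
lemma isResolution_segre {η : X ⟶ C.X 0} {η' : X' ⟶ C'.X 0} (h : C.IsResolution η)
    (h' : C'.IsResolution η') :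
    (segreBicomplex C C').tot.IsResolution (segreAugmentation η η') where
  inj := segreAugmentation_injective h.inj h'.inj
  exact_zero := segreAugmentation_exact h.exact_zero h'.exact_zero
  exact_succ q n w := by
    refine ⟨fun hw => ?_, fun ⟨v, hv⟩ => hv ▸ (segreBicomplex C C').tot.d_d q n v⟩
    obtain ⟨y, hy⟩ := exists_kunneth_representative w hw
    have hy' : (kunnethι C C' (q + 1)).app n y ∈
        (segreBicomplex C C').tot.boundaries (q + 1) n := by
      rw [kunnethι_mem_boundaries_iff]
      funext p
      obtain ⟨⟨i, j⟩, hij⟩ := p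
      have key : ∀ z : (C.coh i).X n ⊗[k] (C'.coh j).X n, z = 0 := fun z => by
        induction z using TensorProduct.induction_on with
        | zero => rfl
        | add x y hx hy => rw [hx, hy, add_zero]
        | tmul x y =>
          match i, j, hij with
          | 0, 0, hij => exact absurd hij (by simp)
          | i + 1, j, hij => rw [h.coh_eq_zero i x, TensorProduct.zero_tmul]
          | 0, j + 1, hij => rw [h'.coh_eq_zero j y, TensorProduct.tmul_zero]
      exact key _
    obtain ⟨v, hv⟩ := Submodule.add_mem _ hy hy'
    exact ⟨v, hv.trans (sub_add_cancel w _)⟩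

/-- The map of total complexes induced by two maps of complexes. -/
def segreTotMap (φ : ∀ q, C.X q ⟶ W.X q) (φ' : ∀ q, C'.X q ⟶ W'.X q) (q : ℕ) :
    (segreBicomplex C C').totX q ⟶ (segreBicomplex W W').totX q :=
  piMap fun p : SumPairs q => segreMap (φ p.1.1) (φ' p.1.2)

lemma entry_segreTotMap (φ : ∀ q, C.X q ⟶ W.X q) (φ' : ∀ q, C'.X q ⟶ W'.X q) (q : ℕ) {n : ℤ}
    (w : ((segreBicomplex C C').totX q).X n) (i j : ℕ) (h : i + j = q) :
    GrBicomplex.entry ((segreTotMap φ φ' q).app n w) i j h =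
      (segreMap (φ i) (φ' j)).app n (GrBicomplex.entry w i j h) := rfl

lemma segreTotMap_comm {φ : ∀ q, C.X q ⟶ W.X q} {φ' : ∀ q, C'.X q ⟶ W'.X q}
    (h : ∀ q, C.d q ≫ φ (q + 1) = φ q ≫ W.d q) (h' : ∀ q, C'.d q ≫ φ' (q + 1) = φ' q ≫ W'.d q)
    (q : ℕ) (n : ℤ) (w : ((segreBicomplex C C').totX q).X n) :
    (segreTotMap φ φ' (q + 1)).app n (((segreBicomplex C C').totD q).app n w) =
      ((segreBicomplex W W').totD q).app n ((segreTotMap φ φ' q).app n w) := by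
  have hL : ∀ i j (z : ((segreBicomplex C C').X i j).X n), (segreMap (φ (i + 1)) (φ' j)).app n
      (((segreBicomplex C C').dL i j).app n z) =
        ((segreBicomplex W W').dL i j).app n ((segreMap (φ i) (φ' j)).app n z) := fun i j z =>
    segreMap_congr (h i) (by rw [Category.id_comp, Category.comp_id]) n z
  have hR : ∀ i j (z : ((segreBicomplex C C').X i j).X n), (segreMap (φ i) (φ' (j + 1))).app n
      (((segreBicomplex C C').dR i j).app n z) =
        ((segreBicomplex W W').dR i j).app n ((segreMap (φ i) (φ' j)).app n z) := fun i j z =>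
    segreMap_congr (by rw [Category.id_comp, Category.comp_id]) (h' j) n z
  refine GrBicomplex.entry_ext fun i j hij => ?_
  rw [entry_segreTotMap]
  match i, j, hij with
  | 0, 0, hij => exact absurd hij (by simp)
  | 0, j + 1, hij =>
    rw [GrBicomplex.totD_zero_succ, GrBicomplex.totD_zero_succ, entry_segreTotMap]
    exact hR _ _ _
  | i + 1, 0, hij =>
    rw [GrBicomplex.totD_succ_zero, GrBicomplex.totD_succ_zero, entry_segreTotMap]
    exact hL _ _ _
  | i + 1, j + 1, hij =>
    rw [GrBicomplex.totD_succ_succ, GrBicomplex.totD_succ_succ, entry_segreTotMap,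
      entry_segreTotMap, ← hL, ← hR]
    exact (map_add _ _ _).trans (congrArg₂ (· + ·) rfl (map_smul _ _ _))

end TotZero

section SaturationComplex

variable {k R : Type u} [Field k] [CommRing R] [Algebra k R]
variable {𝒜 : ℕ → Submodule k R} [GradedAlgebra 𝒜]

/-- The saturations of the terms of a complex. -/
def saturationComplex (I : Ideal R) (C : GrComplex 𝒜) : GrComplex 𝒜 where
  X q := saturation I (C.X q)
  d q := saturationMap I (C.d q)
  d_d q n s := by
    refine Subtype.ext (funext fun P => ?_)
    obtain ⟨d, e, y, he, hy⟩ := exists_isFrac s P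
    change localizedMap _ P.1 (localizedMap _ P.1 (s.1 P)) = 0
    rw [hy P he, localizedMap_mk, localizedMap_mk, C.d_d, map_zero, LocalizedModule.zero_mk]

variable {D r : ℕ} {f : Fin r → 𝒜 D} {I : Ideal R}

/-- The saturation of a complex of injective modules is its quotient by torsion. -/
lemma GeneratesRadical.isTorsionFreeQuotient [IsNoetherianRing R] (hf : GeneratesRadical f I)
    (C : GrComplex 𝒜) [∀ q, Injective (C.X q)] :
    IsTorsionFreeQuotient I C (saturationComplex I C) fun q => toSaturation I (C.X q) where
  comm q n x := (saturationMap_toSaturation I (C.d q) n x).symm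
  surj q n := hf.toSaturation_surjective (C.X q) n
  ker _ _ x := (hf.toSaturation_eq_zero x).trans (hf.detects _ _ _).symm

lemma nonempty_coh_zero_iso {C : GrComplex 𝒜} {X : GrMod 𝒜} {θ : X ⟶ C.X 0}
    (h : ∀ n, Function.Injective (θ.app n))
    (h' : ∀ n, Function.Exact (θ.app n) ((C.d 0).app n)) : Nonempty (C.coh 0 ≅ X) := by
  refine ⟨(isoOfBijective (C.cocyclesLift θ (fun n x => (h' n).apply_apply_eq_zero x) ≫
    C.cohπ 0) fun n => ⟨(injective_iff_map_eq_zero _).2 fun x hx => ?_, fun z => ?_⟩).symm⟩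
  · exact h n (((Submodule.mem_bot k).1 (C.cohπ_eq_zero.1 hx)).trans (map_zero _).symm)
  · obtain ⟨z, rfl⟩ := C.cohπ_surjective _ _ z
    obtain ⟨x, hx⟩ := (h' n z.1).1 z.2
    exact ⟨x, congrArg ((C.cohπ 0).app n) (Subtype.ext hx)⟩

/-- The cohomology of the saturation of a resolution: `M^sat` in degree `0` and `H^{q+1}_I(M)` in
degree `q > 0`. -/
def saturationCoh (I : Ideal R) (M : GrMod 𝒜) : ℕ → GrMod 𝒜
  | 0 => saturation I M
  | q + 1 => localCohomology I (q + 2) M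

lemma GeneratesRadical.nonempty_coh_saturationComplex_iso [IsNoetherianRing R]
    (hf : GeneratesRadical f I) {M : GrMod 𝒜} {C : GrComplex 𝒜} [∀ q, Injective (C.X q)]
    {η : M ⟶ C.X 0} (hC : C.IsResolution η) (q : ℕ) :
    Nonempty ((saturationComplex I C).coh q ≅ saturationCoh I M q) := by
  cases q with
  | zero =>
    exact nonempty_coh_zero_iso (θ := saturationMap I η) (saturationMap_injective hC.inj)
      (saturationMap_exact hC.inj hC.exact_zero)
  | succ q =>
    exact (nonempty_localCohomology_iso_coh hf.detects hC (fun q => acyclic_of_injective f (C.X q))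
      (hf.isTorsionFreeQuotient C) q).map Iso.symm

end SaturationComplex

section Reindex

variable {k R S : Type u} [Field k] [CommRing R] [Algebra k R] [CommRing S] [Algebra k S]
variable {𝒜 : ℕ → Submodule k R} [GradedAlgebra 𝒜] {ℬ : ℕ → Submodule k S} [GradedAlgebra ℬ]

/-- Segre products of isomorphisms. -/
def segreIso {M M' : GrMod 𝒜} {N N' : GrMod ℬ} (e : M ≅ M') (e' : N ≅ N') :
    segre M N ≅ segre M' N' where
  hom := segreMap e.hom e'.hom
  inv := segreMap e.inv e'.inv
  hom_inv_id := hom_ext fun n z => by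
    rw [comp_app, segreMap_segreMap, e.hom_inv_id, e'.hom_inv_id]
    exact LinearMap.congr_fun TensorProduct.map_id z
  inv_hom_id := hom_ext fun n z => by
    rw [comp_app, segreMap_segreMap, e.inv_hom_id, e'.inv_hom_id]
    exact LinearMap.congr_fun TensorProduct.map_id z

/-- Products of isomorphisms. -/
def piIso {ι : Type} {X Y : ι → GrMod 𝒜} (e : ∀ p, X p ≅ Y p) : piObj X ≅ piObj Y where
  hom := piMap fun p => (e p).hom
  inv := piMap fun p => (e p).inv
  hom_inv_id := hom_ext fun n x => funext fun p =>
    congrArg (fun φ : X p ⟶ X p => φ.app n (x p)) (e p).hom_inv_id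
  inv_hom_id := hom_ext fun n x => funext fun p =>
    congrArg (fun φ : Y p ⟶ Y p => φ.app n (x p)) (e p).inv_hom_id

lemma piLift_piProj {ι : Type} {X : ι → GrMod 𝒜} {Z : GrMod 𝒜} (φ : ∀ p, Z ⟶ X p) (p : ι) :
    piLift φ ≫ piProj X p = φ p := rfl

lemma piObj_hom_ext {ι : Type} {X : ι → GrMod 𝒜} {Z : GrMod 𝒜} {φ ψ : Z ⟶ piObj X}
    (h : ∀ p, φ ≫ piProj X p = ψ ≫ piProj X p) : φ = ψ :=
  hom_ext fun n x => funext fun p => congrArg (fun φ : Z ⟶ X p => φ.app n x) (h p)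

lemma mem_pairsGeTwo {m : ℕ} {p : ℕ × ℕ} :
    p ∈ pairsGeTwo m ↔ p.1 + p.2 = m ∧ 2 ≤ p.1 ∧ 2 ≤ p.2 := by
  rw [pairsGeTwo, Finset.mem_filter, Finset.HasAntidiagonal.mem_antidiagonal]

/-- A product over the pairs with sum `q + 1`, with the pairs `(0, q + 1)` and `(q + 1, 0)` split
off and the others shifted by `(1, 1)`. -/
def piSumPairsIso (V : ℕ → ℕ → GrMod 𝒜) (q : ℕ) :
    (piObj fun p : SumPairs (q + 1) => V p.1.1 p.1.2) ≅
      (V 0 (q + 1) ⊞ V (q + 1) 0) ⊞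
        ⨁ fun p : pairsGeTwo (q + 3) => V (p.1.1 - 1) (p.1.2 - 1) where
  hom := biprod.lift
    (biprod.lift (piProj (fun p : SumPairs (q + 1) => V p.1.1 p.1.2) ⟨(0, q + 1), by simp⟩)
      (piProj (fun p : SumPairs (q + 1) => V p.1.1 p.1.2) ⟨(q + 1, 0), by simp⟩))
    (biproduct.lift fun p => piProj (fun p : SumPairs (q + 1) => V p.1.1 p.1.2)
      ⟨(p.1.1 - 1, p.1.2 - 1), by have := mem_pairsGeTwo.1 p.2; dsimp only; omega⟩)
  inv := piLift fun
    | ⟨(0, j), h⟩ => biprod.fst ≫ biprod.fst ≫ eqToHom (by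
        obtain rfl : j = q + 1 := by dsimp only at h; omega
        rfl)
    | ⟨(i + 1, 0), h⟩ => biprod.fst ≫ biprod.snd ≫ eqToHom (by
        obtain rfl : i = q := by dsimp only at h; omega
        rfl)
    | ⟨(i + 1, j + 1), h⟩ => biprod.snd ≫
        biproduct.π (fun p : pairsGeTwo (q + 3) => V (p.1.1 - 1) (p.1.2 - 1))
          ⟨(i + 2, j + 2), mem_pairsGeTwo.2 (by dsimp only at h ⊢; omega)⟩
  hom_inv_id := by
    refine piObj_hom_ext fun p => ?_
    rw [Category.assoc, piLift_piProj, Category.id_comp]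
    obtain ⟨⟨i, j⟩, h⟩ := p
    match i, j, h with
    | 0, j, h =>
      obtain rfl : j = q + 1 := by dsimp only at h; omega
      simp
    | i + 1, 0, h =>
      obtain rfl : i = q := by dsimp only at h; omega
      simp
    | i + 1, j + 1, h => simp
  inv_hom_id := by
    refine biprod.hom_ext _ _ (biprod.hom_ext _ _ ?_ ?_) (biproduct.hom_ext _ _ fun p => ?_)
    · rw [Category.assoc, Category.assoc, biprod.lift_fst_assoc, biprod.lift_fst, piLift_piProj]
      simp
    · rw [Category.assoc, Category.assoc, biprod.lift_fst_assoc, biprod.lift_snd, piLift_piProj]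
      simp
    · obtain ⟨⟨i, j⟩, h⟩ := p
      obtain ⟨h0, h1, h2⟩ := mem_pairsGeTwo.1 h
      obtain ⟨i, rfl⟩ := Nat.exists_eq_add_of_le' h1
      obtain ⟨j, rfl⟩ := Nat.exists_eq_add_of_le' h2
      rw [Category.assoc, Category.assoc, biprod.lift_snd_assoc, biproduct.lift_π, piLift_piProj]
      simp

end Reindex

end GrMod

namespace GrMod

section Main

variable {k R S : Type u} [Field k] [CommRing R] [Algebra k R] [CommRing S] [Algebra k S]
variable {𝒜 : ℕ → Submodule k R} [GradedAlgebra 𝒜] {ℬ : ℕ → Submodule k S} [GradedAlgebra ℬ]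

/-! ### The comparison of the two double complexes -/

/-- The total complex of `sat E # sat F` is the quotient of that of `E # F` by its torsion. -/
lemma isTorsionFreeQuotient_segre [IsNoetherianRing R] [IsNoetherianRing S]
    [IsNoetherianRing (SegreRing 𝒜 ℬ)] {D r s : ℕ} {f : Fin r → 𝒜 D} {g : Fin s → ℬ D}
    {I : Ideal R} {J : Ideal S} (hf : GeneratesRadical f I) (hg : GeneratesRadical g J)
    (C : GrComplex 𝒜) (C' : GrComplex ℬ) [∀ q, Injective (C.X q)] [∀ q, Injective (C'.X q)] :
    IsTorsionFreeQuotient (segreIdeal 𝒜 ℬ I J) (segreBicomplex C C').tot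
      (segreBicomplex (saturationComplex I C) (saturationComplex J C')).tot
      (segreTotMap (fun q => toSaturation I (C.X q)) (fun q => toSaturation J (C'.X q))) where
  comm := segreTotMap_comm
    (fun q => hom_ext fun n x => (hf.isTorsionFreeQuotient C).comm q n x)
    (fun q => hom_ext fun n x => (hg.isTorsionFreeQuotient C').comm q n x)
  surj q n := piMap_surjective n fun p => TensorProduct.map_surjective
    (hf.toSaturation_surjective (C.X p.1.1) n) (hg.toSaturation_surjective (C'.X p.1.2) n)
  ker q n w := by
    rw [(hf.segreForms hg).detects]
    have key : ∀ p : SumPairs q, (segreMap (toSaturation I (C.X p.1.1))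
        (toSaturation J (C'.X p.1.2))).app n (w p) = 0 ↔
          ∀ l, IsTors (M := segre (C.X p.1.1) (C'.X p.1.2))
            (segreForms f g l : SegreRing 𝒜 ℬ) (w p) := fun p =>
      segreMap_eq_zero_iff (hf.toSaturation_surjective (C.X p.1.1))
        (hg.toSaturation_surjective (C'.X p.1.2)) (fun _ x hx => (hf.toSaturation_eq_zero x).1 hx)
        (fun _ y hy => (hg.toSaturation_eq_zero y).1 hy) (fun _ => hf.saturation_torsionFree)
        (fun _ => hg.saturation_torsionFree) (w p)
    exact ⟨fun h l => isTors_pi.2 fun p => (key p).1 (congrFun h p) l,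
      fun h => funext fun p => (key p).2 fun l => isTors_pi.1 (h l) p⟩

/-- The cohomology of the total complex of `sat E # sat F`, for resolutions `E` and `F`. -/
lemma nonempty_coh_segre_saturationComplex_iso [IsNoetherianRing R] [IsNoetherianRing S]
    {D r s : ℕ} {f : Fin r → 𝒜 D} {g : Fin s → ℬ D} {I : Ideal R} {J : Ideal S}
    (hf : GeneratesRadical f I) (hg : GeneratesRadical g J) {M : GrMod 𝒜} {N : GrMod ℬ}
    {C : GrComplex 𝒜} {C' : GrComplex ℬ} [∀ q, Injective (C.X q)] [∀ q, Injective (C'.X q)]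
    {η : M ⟶ C.X 0} {η' : N ⟶ C'.X 0} (hC : C.IsResolution η) (hC' : C'.IsResolution η') (q : ℕ) :
    Nonempty ((segreBicomplex (saturationComplex I C) (saturationComplex J C')).tot.coh (q + 1) ≅
      (segre (saturation I M) (localCohomology J (q + 2) N) ⊞
        segre (localCohomology I (q + 2) M) (saturation J N)) ⊞
        ⨁ fun p : pairsGeTwo (q + 3) =>
          segre (localCohomology I p.1.1 M) (localCohomology J p.1.2 N)) := by
  let e := fun q => (hf.nonempty_coh_saturationComplex_iso hC q).some
  let e' := fun q => (hg.nonempty_coh_saturationComplex_iso hC' q).some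
  let V : ℕ → ℕ → GrMod (segreGrading 𝒜 ℬ) := fun i j =>
    segre (saturationCoh I M i) (saturationCoh J N j)
  have hV : ∀ p : pairsGeTwo (q + 3), V (p.1.1 - 1) (p.1.2 - 1) =
      segre (localCohomology I p.1.1 M) (localCohomology J p.1.2 N) := by
    rintro ⟨⟨i, j⟩, h⟩
    obtain ⟨h0, h1, h2⟩ := mem_pairsGeTwo.1 h
    obtain ⟨i, rfl⟩ := Nat.exists_eq_add_of_le' h1
    obtain ⟨j, rfl⟩ := Nat.exists_eq_add_of_le' h2
    rfl
  exact ⟨(kunnethIso _ _ (q + 1)).symm ≪≫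
    piIso (fun p : SumPairs (q + 1) => segreIso (e p.1.1) (e' p.1.2)) ≪≫
    piSumPairsIso V q ≪≫ biprod.mapIso (Iso.refl _) (biproduct.mapIso fun p => eqToIso (hV p))⟩

end Main

end GrMod

end

theorem mainTheorem1 {k R S : Type u} [Field k] [CommRing R] [Algebra k R]
    [CommRing S] [Algebra k S]
    (𝒜 : ℕ → Submodule k R) [GradedAlgebra 𝒜] (ℬ : ℕ → Submodule k S) [GradedAlgebra ℬ]
    (h𝒜 : IsStandardGraded 𝒜) (hℬ : IsStandardGraded ℬ)
    (I : Ideal R) (hI : I.IsHomogeneous 𝒜) (hI_proper : I ≠ ⊤)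
    (J : Ideal S) (hJ : J.IsHomogeneous ℬ) (hJ_proper : J ≠ ⊤)
    (M : GrMod 𝒜) (N : GrMod ℬ) :
    (∃ (ι : GrMod.localCohomology (segreIdeal 𝒜 ℬ I J) 0 (GrMod.segre M N) ⟶ GrMod.segre M N)
      (δ : GrMod.segre (GrMod.saturation I M) (GrMod.saturation J N) ⟶
        GrMod.localCohomology (segreIdeal 𝒜 ℬ I J) 1 (GrMod.segre M N))
      (w₁ : ι ≫ GrMod.segreMap (GrMod.toSaturation I M) (GrMod.toSaturation J N) = 0)
      (w₂ : GrMod.segreMap (GrMod.toSaturation I M) (GrMod.toSaturation J N) ≫ δ = 0),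
      Mono ι ∧ (ShortComplex.mk _ _ w₁).Exact ∧ (ShortComplex.mk _ _ w₂).Exact ∧ Epi δ) ∧
    ∀ n : ℕ, 2 ≤ n →
      Nonempty (GrMod.localCohomology (segreIdeal 𝒜 ℬ I J) n (GrMod.segre M N) ≅
        (GrMod.segre (GrMod.saturation I M) (GrMod.localCohomology J n N) ⊞
          GrMod.segre (GrMod.localCohomology I n M) (GrMod.saturation J N)) ⊞
        ⨁ fun p : pairsGeTwo (n + 1) =>
          GrMod.segre (GrMod.localCohomology I p.1.1 M) (GrMod.localCohomology J p.1.2 N)) := by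
  have := h𝒜.isNoetherianRing
  have := hℬ.isNoetherianRing
  have := isNoetherianRing_segreRing h𝒜 hℬ
  obtain ⟨D₁, hD₁, hf⟩ := h𝒜.exists_generatesRadical hI hI_proper
  obtain ⟨D₂, hD₂, hg⟩ := hℬ.exists_generatesRadical hJ hJ_proper
  -- forms of a common degree, so that the products `f_i ⊗ g_j` are forms of the Segre product
  obtain ⟨r, f, hf⟩ := hf (D₁ * D₂) (Nat.mul_pos hD₁ hD₂) (Dvd.intro _ rfl)
  obtain ⟨s, g, hg⟩ := hg (D₁ * D₂) (Nat.mul_pos hD₁ hD₂) (Dvd.intro_left _ rfl)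
  let E := injectiveResolution M
  let F := injectiveResolution N
  let C := GrMod.GrComplex.ofCochainComplex E.cocomplex
  let C' := GrMod.GrComplex.ofCochainComplex F.cocomplex
  have hCinj : ∀ q, Injective (C.X q) := E.injective
  have hCinj' : ∀ q, Injective (C'.X q) := F.injective
  have hC := GrMod.isResolution_of_injectiveResolution E
  have hC' := GrMod.isResolution_of_injectiveResolution F
  have hT := GrMod.isResolution_segre hC hC'
  have haT : ∀ q, GrMod.Acyclic (GrMod.segreForms f g) ((GrMod.segreBicomplex C C').totX q) :=
    fun q => GrMod.Acyclic.pi fun p => GrMod.acyclic_segre f g (C.X p.1.1) (C'.X p.1.2)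
  have hW := GrMod.isTorsionFreeQuotient_segre hf hg C C'
  have hdet := (hf.segreForms hg).detects
  refine ⟨?_, fun n hn => ?_⟩
  · refine GrMod.exists_localCohomology_sequence hdet hT haT hW
      (GrMod.segreAugmentation (C := GrMod.saturationComplex I C)
        (C' := GrMod.saturationComplex J C') (GrMod.saturationMap I _) (GrMod.saturationMap J _))
      (GrMod.segreAugmentation_injective (GrMod.saturationMap_injective hC.inj)
        (GrMod.saturationMap_injective hC'.inj))
      (GrMod.segreAugmentation_exact (GrMod.saturationMap_exact hC.inj hC.exact_zero)
        (GrMod.saturationMap_exact hC'.inj hC'.exact_zero))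
      _ fun n x => GrMod.entry_zero_ext (GrMod.segreMap_congr
        (GrMod.hom_ext fun n x => GrMod.saturationMap_toSaturation I _ n x)
        (GrMod.hom_ext fun n x => GrMod.saturationMap_toSaturation J _ n x) n x)
  · obtain ⟨q, rfl⟩ := Nat.exists_eq_add_of_le' hn
    obtain ⟨e⟩ := GrMod.nonempty_localCohomology_iso_coh hdet hT haT hW q
    obtain ⟨e'⟩ := GrMod.nonempty_coh_segre_saturationComplex_iso hf hg hC hC' q
    exact ⟨e ≪≫ e'⟩
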